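/- Let $\gamma\in(0,1]$, $\rho>0$, and for $z\in\mathbb Z$ let $Q^\gamma_z$ (with expectation $E^\gamma_z$) be the canonical law on $\mathbb Z^{\mathbb N}$ of the random walk started at $z$ which at each step jumps to each of its two neighbors with probability $\gamma/2$ and stays put with probability $1-\gamma$. Let $Z$ be the canonical process, $\theta_n$ the canonical shift, $H_U=\inf\{n\ge0: Z_n\in U\}$, $T_U=\inf\{n\ge 0: Z_n\notin U\}$ for $U\subseteq\mathbb Z$, and $L^z_n=\sum_{0\le m<n}1\{Z_m=z\}$. Let $(a_N)_{N\ge1},(h_N)_{N\ge1},(d_N)_{N\ge1}$ be sequences of non-negative integers with $\lim_N a_N=\lim_N h_N=\infty$, $d_N=o(h_N)$, $h_N=o(a_N)$. Let $L\ge1$ be a fixed integer and $z^*_\ell(N)\in\mathbb Z$, $1\le\ell\le L$, $N\ge1$, be points such that for all large $N$ $$|z^*_\ell(N)-z^*_{\ell'}(N)|\ge 100\,h_N\quad\text{for all } \ell\ne\ell'. \qquad (\mathrm{i})$$ Call $N\ge 1$ admissible if $20(d_N+1)<h_N$, $100h_N<a_N$ and (i) holds; all large $N$ are admissible. Define the grid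 $$\mathcal G=\{z^*_\ell(N):1\le\ell\le L\}\cup\{z\in 2h_N\mathbb Z: |z-z^*_\ell(N)|\ge 2h_N\text{ for }1\le\ell\le L\},$$ the sets $C=\mathcal G+[-d_N,d_N]$ and $O=\mathcal G+(-h_N,h_N)$ (integer intervals), and the successive returns to $C$ and departures from $O$, $$R_1=H_C,\quad D_1=T_O\circ\theta_{R_1}+R_1,\quad R_{k+1}=R_1\circ\theta_{D_k}+D_k,\quad D_{k+1}=D_1\circ\theta_{D_k}+D_k\quad(k\ge1).$$ Set $D_0=0$. Let $t_N=E^\gamma_0[T_{(-h_N+d_N,\,h_N-d_N)}]+E^\gamma_{d_N}[T_{(-h_N,h_N)}]$ and $$T=[\rho a_N^2],\qquad \sigma=[\rho a_N^2/t_N],\qquad k_*=\sigma-[\sigma^{3/4}],\qquad k^*=\sigma+[\sigma^{3/4}].$$ Then $$\lim_N\, Q^\gamma_0[D_{k_*}\le T\le D_{k^*}]=1,$$ $$\lim_N\,\sup_{z\in C}\,E^\gamma_0\big[(|L^z_T-L^z_{D_{k_*}}|/a_N)\wedge1\big]=0,$$ $$\sup_N\,\sup_I\,\frac{h_N}{a_N}\,E^\gamma_0\Big[\sum_{1\le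 k\le k_*}1\{Z_{R_k}\in I\}\Big]<\infty,$$ $$\lim_N\,\sup_I\,\sup_{z\in I}\,\frac1{a_N}\,E^\gamma_0\Big[\Big|L^z_{D_{k_*}}-\frac{h_N}{\gamma}\sum_{1\le k\le k_*}1\{Z_{R_k}\in I\}\Big|\Big]=0,$$ where $I$ runs over the components $u+[-d_N,d_N]$, $u\in\mathcal G$, of $C$, and $N$ runs over the admissible integers. -/

import Mathlib

open Filter Topology MeasureTheory
open scoped ENNReal

noncomputable section

namespace GridWalk

/-! ### The lazy walk on `ℤ` -/

/-- The law of one step: `±1` with probability `γ / 2` each, `0` with probability `1 - γ`. -/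
def stepLaw (γ : ℝ) : Measure ℤ :=
  ENNReal.ofReal (γ / 2) • Measure.dirac 1 + ENNReal.ofReal (γ / 2) • Measure.dirac (-1) +
    ENNReal.ofReal (1 - γ) • Measure.dirac 0

/-- The trajectory started at `z` with successive steps `ξ 0, ξ 1, …`. -/
def path (z : ℤ) (ξ : ℕ → ℤ) (n : ℕ) : ℤ := z + ∑ i ∈ Finset.range n, ξ i

/-- The canonical law `Q^γ_z` on `ℤ^ℕ` of the lazy walk started at `z` (for `0 ≤ γ ≤ 1`). The
canonical process is `Z_n(ω) = ω n`. -/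
def Q (γ : ℝ) (z : ℤ) : Measure (ℕ → ℤ) :=
  (Measure.infinitePi fun _ : ℕ => stepLaw γ).map (path z)

theorem isProbabilityMeasure_stepLaw {γ : ℝ} (h0 : 0 ≤ γ) (h1 : γ ≤ 1) :
    IsProbabilityMeasure (stepLaw γ) := by
  constructor
  simp only [stepLaw, Measure.coe_add, Measure.coe_smul, Pi.add_apply, Pi.smul_apply,
    measure_univ, smul_eq_mul, mul_one]
  rw [← ENNReal.ofReal_add (by positivity) (by positivity),
    ← ENNReal.ofReal_add (by positivity) (by linarith)]
  simp

theorem measurable_path (z : ℤ) : Measurable (path z) := by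
  unfold path
  fun_prop

theorem isProbabilityMeasure_Q {γ : ℝ} (h0 : 0 ≤ γ) (h1 : γ ≤ 1) (z : ℤ) :
    IsProbabilityMeasure (Q γ z) := by
  have := isProbabilityMeasure_stepLaw h0 h1
  exact Measure.isProbabilityMeasure_map (measurable_path z).aemeasurable

/-! ### Entrance times, exit times, local times -/

/-- The canonical shift `θ_m`. -/
def shift (m : ℕ) (ω : ℕ → ℤ) : ℕ → ℤ := fun n => ω (m + n)

/-- The entrance time `H_U = inf {n ≥ 0 ; Z_n ∈ U}`, with `inf ∅ = ∞`. -/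
def entranceTime (U : Set ℤ) (ω : ℕ → ℤ) : ℕ∞ := ⨅ (n : ℕ) (_ : ω n ∈ U), (n : ℕ∞)

/-- The exit time `T_U = inf {n ≥ 0 ; Z_n ∉ U}`, with `inf ∅ = ∞`. -/
def exitTime (U : Set ℤ) (ω : ℕ → ℤ) : ℕ∞ := ⨅ (n : ℕ) (_ : ω n ∉ U), (n : ℕ∞)

/-- The random time `τ ∘ θ_s + s`; it is `∞` where `s = ∞`, as `∞ + x = ∞`. -/
def afterTime (s τ : (ℕ → ℤ) → ℕ∞) (ω : ℕ → ℤ) : ℕ∞ :=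
  s ω + τ (shift (s ω).toNat ω)

/-- The local time `L^z_n = ∑_{0 ≤ m < n} 1{Z_m = z}`, for a time `n ∈ ℕ ∪ {∞}`. -/
def localTime (z : ℤ) (n : ℕ∞) (ω : ℕ → ℤ) : ℝ≥0∞ :=
  ∑' m : ℕ, if (m : ℕ∞) < n ∧ ω m = z then 1 else 0

/-- `|x - y|` for `x, y ∈ [0, ∞]`; one of the two truncated differences vanishes. -/
def absDiff (x y : ℝ≥0∞) : ℝ≥0∞ := (x - y) + (y - x)

/-! ### The grid, for fixed `N`

Here `h = h_N`, `d = d_N`, and `zs ℓ = z^*_ℓ(N)`. -/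

/-- The grid `𝒢 = 𝒢^* ∪ 𝒢^0`. -/
def grid {L : ℕ} (h : ℕ) (zs : Fin L → ℤ) : Set ℤ :=
  Set.range zs ∪ {z | (2 * (h : ℤ)) ∣ z ∧ ∀ ℓ, 2 * (h : ℤ) ≤ |z - zs ℓ|}

/-- The interval `u + [-d, d]` of `ℤ`. -/
def closedBlock (d : ℕ) (u : ℤ) : Set ℤ := Set.Icc (u - d) (u + d)

/-- The interval `u + (-h, h)` of `ℤ`. -/
def openBlock (h : ℕ) (u : ℤ) : Set ℤ := Set.Ioo (u - h) (u + h)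

/-- `C = 𝒢 + [-d, d]`. -/
def setC {L : ℕ} (h d : ℕ) (zs : Fin L → ℤ) : Set ℤ := ⋃ u ∈ grid h zs, closedBlock d u

/-- `O = 𝒢 + (-h, h)`. -/
def setO {L : ℕ} (h : ℕ) (zs : Fin L → ℤ) : Set ℤ := ⋃ u ∈ grid h zs, openBlock h u

/-- Pairwise separation of the points `z^*_ℓ` by at least `100 h`. -/
def Separated {L : ℕ} (h : ℕ) (zs : Fin L → ℤ) : Prop :=
  ∀ ℓ ℓ' : Fin L, ℓ ≠ ℓ' → 100 * (h : ℤ) ≤ |zs ℓ - zs ℓ'|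

/-- The standing requirement on `N`: `20 (d + 1) < h`, `100 h < a`, and separation. -/
def Admissible {L : ℕ} (a h d : ℕ) (zs : Fin L → ℤ) : Prop :=
  20 * (d + 1) < h ∧ 100 * h < a ∧ Separated h zs

/-! ### Successive returns to `C` and departures from `O` -/

/-- The departure times: `D_1 = T_O ∘ θ_{R_1} + R_1` with `R_1 = H_C`, and
`D_{k+1} = D_1 ∘ θ_{D_k} + D_k`, with the convention `D_0 = 0`. -/
def depTime {L : ℕ} (h d : ℕ) (zs : Fin L → ℤ) : ℕ → (ℕ → ℤ) → ℕ∞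
  | 0 => fun _ => 0
  | k + 1 => afterTime (depTime h d zs k)
      (afterTime (entranceTime (setC h d zs)) (exitTime (setO h zs)))

/-- The return times: `R_1 = H_C` and `R_{k+1} = R_1 ∘ θ_{D_k} + D_k`. Only the `R_k` with `k ≥ 1`
are meaningful. -/
def retTime {L : ℕ} (h d : ℕ) (zs : Fin L → ℤ) : ℕ → (ℕ → ℤ) → ℕ∞
  | 0 => fun _ => 0
  | k + 1 => afterTime (depTime h d zs k) (entranceTime (setC h d zs))

open Classical in
/-- `∑_{1 ≤ k ≤ K} 1{Z_{R_k} ∈ I}`, where the event requires `R_k < ∞`. -/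
def visitCount {L : ℕ} (h d : ℕ) (zs : Fin L → ℤ) (I : Set ℤ) (K : ℕ) (ω : ℕ → ℤ) : ℝ≥0∞ :=
  ∑ k ∈ Finset.Icc 1 K, if ∃ n : ℕ, retTime h d zs k ω = n ∧ ω n ∈ I then 1 else 0

/-! ### Calibration -/

/-- `t_N = E^γ_0[T_{(-h+d, h-d)}] + E^γ_d[T_{(-h, h)}]`, a finite number for `0 < γ ≤ 1`. -/
def meanExcursion (γ : ℝ) (h d : ℕ) : ℝ :=
  ((∫⁻ ω, ((exitTime (Set.Ioo (-(h : ℤ) + d) ((h : ℤ) - d)) ω : ℕ∞) : ℝ≥0∞) ∂(Q γ 0)) +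
    ∫⁻ ω, ((exitTime (Set.Ioo (-(h : ℤ)) (h : ℤ)) ω : ℕ∞) : ℝ≥0∞) ∂(Q γ d)).toReal

/-- `T = [ρ a²]`. -/
def timeT (ρ : ℝ) (a : ℕ) : ℕ := ⌊ρ * (a : ℝ) ^ 2⌋₊

/-- `σ = [ρ a² / t_N]`. -/
def sigma (γ ρ : ℝ) (a h d : ℕ) : ℕ := ⌊ρ * ((a : ℝ) ^ 2 / meanExcursion γ h d)⌋₊

/-- `k_* = σ - [σ^{3/4}]`; the subtraction never truncates, as `[σ^{3/4}] ≤ σ`. -/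
def kLow (γ ρ : ℝ) (a h d : ℕ) : ℕ :=
  sigma γ ρ a h d - ⌊(sigma γ ρ a h d : ℝ) ^ (3 / 4 : ℝ)⌋₊

/-- `k^* = σ + [σ^{3/4}]`. -/
def kHigh (γ ρ : ℝ) (a h d : ℕ) : ℕ :=
  sigma γ ρ a h d + ⌊(sigma γ ρ a h d : ℝ) ^ (3 / 4 : ℝ)⌋₊

end GridWalk

end

/-! The path is cut at the departure times. An excursion hits C and then leaves O; D_k, L^z_{D_k}
and the number of visits to a component are sums, over k successive excursions, of functionals of a
single excursion. By the strong Markov property an excursion depends on the past only through its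
starting point, which from the second excursion on lies at distance h from the grid. Each such sum
splits into a martingale with orthogonal increments and a sum of conditional means
(`lintegral_abs_iterSum_le`).

Visits. The positions X_k at the times D_k form a martingale with steps at most 6h, so E|X_k - x| ≤
6h√k. The distance |X_k - u| to a grid point u is a submartingale which gains at least h - d at each
visit to u + [-d,d] (a discrete Tanaka formula). Hence a single component receives on average at
most 12√k visits, uniformly in the component and the starting point (`lintegral_iterSum_visit_le`).

Durations. From the midpoint of a gap of length 2h the mean duration is exactly t_N. Any other gap
has some z*_ℓ as an endpoint, and the block of that point is then hit with probability at least 1/5.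
The total bias is therefore at most a constant times h² times the number of visits to the L special
blocks, that is O(h²√k), the same order as the fluctuations. Since t_N is of order h², E|D_k - k
t_N| = O(t_N √σ) for 1 ≤ k ≤ 2σ, which is negligible against t_N σ^{3/4}; Markov's inequality gives
the first claim (`measure_compl_good_le`).

Local times. By the explicit Green function of an interval, a visit to the block of z produces local
time at z with mean h/γ up to 3d/γ and second moment O((h/γ)²). With O(√k) visits the error against
the visit count is O(h k^{1/4} + d √k). Since h√σ = O(a), σ → ∞ and d = o(h), this is o(a), the
fourth claim; the visit bound itself gives the third. For the second, T lies with high probability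
between two departure times separated by 2[σ^{3/4}] excursions, which collect at z only O(h σ^{3/8})
= O(a σ^{-1/8}). -/

noncomputable section

namespace GridWalk

section

/-! ### The Markov property -/

/-- The trajectory that starts at `x` and then follows `ω`. -/
def consPath (x : ℤ) (ω : ℕ → ℤ) : ℕ → ℤ
  | 0 => x
  | n + 1 => ω n

@[simp] theorem consPath_zero (x : ℤ) (ω : ℕ → ℤ) : consPath x ω 0 = x := rfl

@[simp] theorem consPath_succ (x : ℤ) (ω : ℕ → ℤ) (n : ℕ) : consPath x ω (n + 1) = ω n := rfl

theorem measurable_consPath_prod : Measurable fun p : ℤ × (ℕ → ℤ) => consPath p.1 p.2 := by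
  refine measurable_pi_lambda _ fun n => ?_
  cases n with
  | zero => exact measurable_fst
  | succ n => exact (measurable_pi_apply n).comp measurable_snd

theorem measurable_consPath (x : ℤ) : Measurable (consPath x) :=
  measurable_consPath_prod.comp (measurable_const.prodMk measurable_id)

theorem shift_zero (ω : ℕ → ℤ) : shift 0 ω = ω := by
  funext n; simp [shift]

theorem shift_shift (m n : ℕ) (ω : ℕ → ℤ) : shift n (shift m ω) = shift (m + n) ω := by
  funext k; simp [shift, add_assoc]

theorem shift_succ_consPath (n : ℕ) (x : ℤ) (ω : ℕ → ℤ) :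
    shift (n + 1) (consPath x ω) = shift n ω := by
  funext k
  simp only [shift]
  rw [show n + 1 + k = n + k + 1 by ring, consPath_succ]

theorem measurable_shift (n : ℕ) : Measurable (shift n) :=
  measurable_pi_lambda _ fun _ => measurable_pi_apply _

theorem measurable_shift_prod : Measurable fun p : ℕ × (ℕ → ℤ) => shift p.1 p.2 :=
  measurable_from_prod_countable_right fun n => measurable_shift n

theorem measurable_shift_of {τ : (ℕ → ℤ) → ℕ} (hτ : Measurable τ) :
    Measurable fun ω => shift (τ ω) ω :=
  measurable_shift_prod.comp (hτ.prodMk measurable_id)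

theorem path_consPath (x e : ℤ) (ξ : ℕ → ℤ) :
    path x (consPath e ξ) = consPath x (path (x + e) ξ) := by
  funext n
  cases n with
  | zero => simp [path]
  | succ n => simp [path, Finset.sum_range_succ']; ring

/-- An i.i.d. sequence is an independent first term followed by an i.i.d. sequence with the same
law. This is the source of the Markov property; it is checked on cylinders. -/
theorem infinitePi_eq_map_consPath (μ : Measure ℤ) [IsProbabilityMeasure μ] :
    (Measure.infinitePi fun _ : ℕ => μ) =
      (μ.prod (Measure.infinitePi fun _ : ℕ => μ)).map fun p => consPath p.1 p.2 := by
  symm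
  apply Measure.eq_infinitePi
  intro s t ht
  classical
  obtain ⟨n, hn⟩ : ∃ n, s ⊆ Finset.range (n + 1) :=
    ⟨s.sup id, fun i hi => Finset.mem_range.2 (Nat.lt_succ_of_le (Finset.le_sup (f := id) hi))⟩
  -- Trivial factors extend the cylinder to an initial segment of indices, so that coordinate 0 can
  -- be split off.
  let t' : ℕ → Set ℤ := fun i => if i ∈ s then t i else Set.univ
  have h1 : Set.pi (s : Set ℕ) t = Set.pi (Finset.range (n + 1) : Set ℕ) t' := by
    ext ω
    simp only [Set.mem_pi, Finset.mem_coe, t']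
    constructor
    · intro h i _
      split_ifs with hi
      exacts [h i hi, trivial]
    · intro h i hi
      have := h i (hn hi)
      rwa [if_pos hi] at this
  have h2 : ∏ i ∈ s, μ (t i) = ∏ i ∈ Finset.range (n + 1), μ (t' i) := by
    rw [← Finset.prod_subset hn]
    · exact Finset.prod_congr rfl fun i hi => by simp [t', hi]
    · intro i _ hi
      simp [t', hi]
  have ht' : ∀ i, MeasurableSet (t' i) := fun i => MeasurableSet.of_discrete
  rw [h1, h2, Measure.map_apply measurable_consPath_prod
    (MeasurableSet.pi (Finset.countable_toSet _) fun i _ => ht' i)]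
  have h3 : (fun p : ℤ × (ℕ → ℤ) => consPath p.1 p.2) ⁻¹'
      Set.pi (Finset.range (n + 1) : Set ℕ) t' =
        t' 0 ×ˢ Set.pi (Finset.range n : Set ℕ) fun i => t' (i + 1) := by
    ext ⟨x, ω⟩
    simp only [Set.mem_preimage, Set.mem_pi, Finset.mem_coe, Finset.mem_range, Set.mem_prod]
    constructor
    · intro h
      exact ⟨h 0 (by omega), fun i hi => h (i + 1) (by omega)⟩
    · rintro ⟨h0, h⟩ i hi
      cases i with
      | zero => exact h0
      | succ i => exact h i (by omega)
  rw [h3, Measure.prod_prod, Measure.infinitePi_pi _ (fun i _ => ht' _),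
    Finset.prod_range_succ', mul_comm]

variable {γ : ℝ}

/-- The kernel `z ↦ Q^γ_z`. -/
def kerQ (γ : ℝ) : ProbabilityTheory.Kernel ℤ (ℕ → ℤ) where
  toFun := Q γ
  measurable' := Measurable.of_discrete

theorem isMarkovKernel_kerQ (h0 : 0 ≤ γ) (h1 : γ ≤ 1) : ProbabilityTheory.IsMarkovKernel (kerQ γ) :=
  ⟨fun z => isProbabilityMeasure_Q h0 h1 z⟩

theorem measurable_lintegral_Q (h0 : 0 ≤ γ) (h1 : γ ≤ 1) {Φ : (ℕ → ℤ) → (ℕ → ℤ) → ℝ≥0∞}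
    (hΦ : Measurable (Function.uncurry Φ)) {f : (ℕ → ℤ) → ℤ} (hf : Measurable f) :
    Measurable fun ω => ∫⁻ ω', Φ ω ω' ∂(Q γ (f ω)) := by
  have := isMarkovKernel_kerQ h0 h1
  exact Measurable.lintegral_kernel_prod_right (κ := (kerQ γ).comap f hf) hΦ

/-- The Markov property at time 1; both the Markov property at time n and all first-step equations
are derived from it. -/
theorem lintegral_Q_step (h0 : 0 ≤ γ) (h1 : γ ≤ 1) (x : ℤ) {F : (ℕ → ℤ) → ℝ≥0∞}
    (hF : Measurable F) :
    ∫⁻ ω, F ω ∂(Q γ x) = ∫⁻ e, ∫⁻ ω, F (consPath x ω) ∂(Q γ (x + e)) ∂(stepLaw γ) := by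
  have := isProbabilityMeasure_stepLaw h0 h1
  have hF' : Measurable fun ξ => F (path x ξ) := hF.comp (measurable_path x)
  have hF'' : Measurable fun p : ℤ × (ℕ → ℤ) => F (path x (consPath p.1 p.2)) :=
    hF'.comp measurable_consPath_prod
  have hc : Measurable fun ω => F (consPath x ω) := hF.comp (measurable_consPath x)
  unfold Q
  rw [lintegral_map hF (measurable_path x), infinitePi_eq_map_consPath,
    lintegral_map hF' measurable_consPath_prod,
    lintegral_prod _ hF''.aemeasurable]
  refine lintegral_congr fun e => ?_
  rw [← infinitePi_eq_map_consPath, lintegral_map hc (measurable_path _)]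
  refine lintegral_congr fun ξ => ?_
  simp only [path_consPath]

theorem ae_start (γ : ℝ) (x : ℤ) : ∀ᵐ ω ∂(Q γ x), ω 0 = x := by
  unfold Q
  rw [ae_map_iff (measurable_path x).aemeasurable
    (measurableSet_eq_fun (measurable_pi_apply 0) measurable_const)]
  exact Eventually.of_forall fun ξ => by simp [path]

/-- The paths whose increments are at most `1` in absolute value. -/
def NearestNeighbour (ω : ℕ → ℤ) : Prop := ∀ n, |ω (n + 1) - ω n| ≤ 1

theorem ae_nearestNeighbour (h0 : 0 ≤ γ) (h1 : γ ≤ 1) (x : ℤ) :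
    ∀ᵐ ω ∂(Q γ x), NearestNeighbour ω := by
  have := isProbabilityMeasure_stepLaw h0 h1
  unfold NearestNeighbour
  rw [ae_all_iff]
  intro n
  unfold Q
  rw [ae_map_iff (measurable_path x).aemeasurable
    (measurableSet_le (by fun_prop) measurable_const)]
  have h2 : ∀ᵐ e ∂(stepLaw γ), |e| ≤ 1 := by
    rw [ae_iff]
    simp [stepLaw]
  have h3 := (measurePreserving_eval_infinitePi (fun _ : ℕ => stepLaw γ) n).quasiMeasurePreserving.ae h2
  filter_upwards [h3] with ξ hξ
  simpa [path, Finset.sum_range_succ] using hξ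

/-- The simple Markov property, for a functional of the path up to time `n` and the path
after time `n`. -/
theorem lintegral_shift (h0 : 0 ≤ γ) (h1 : γ ≤ 1) (n : ℕ) (x : ℤ)
    {Φ : (ℕ → ℤ) → (ℕ → ℤ) → ℝ≥0∞} (hΦ : Measurable (Function.uncurry Φ))
    (hloc : ∀ ω₁ ω₂ ω', (∀ i ≤ n, ω₁ i = ω₂ i) → Φ ω₁ ω' = Φ ω₂ ω') :
    ∫⁻ ω, Φ ω (shift n ω) ∂(Q γ x) = ∫⁻ ω, ∫⁻ ω', Φ ω ω' ∂(Q γ (ω n)) ∂(Q γ x) := by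
  induction n generalizing x Φ with
  | zero =>
    have := isProbabilityMeasure_Q h0 h1 x
    have key : ∀ ω : ℕ → ℤ, ω 0 = x → ∀ ω', Φ ω ω' = Φ (fun _ => x) ω' := fun ω hω ω' =>
      hloc _ _ _ fun i hi => by rw [Nat.le_zero.1 hi, hω]
    have e1 : ∫⁻ ω, Φ ω (shift 0 ω) ∂(Q γ x) = ∫⁻ ω, Φ (fun _ => x) ω ∂(Q γ x) := by
      refine lintegral_congr_ae ?_
      filter_upwards [ae_start γ x] with ω hω
      rw [shift_zero, key ω hω]
    have e2 : ∫⁻ ω, ∫⁻ ω', Φ ω ω' ∂(Q γ (ω 0)) ∂(Q γ x) =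
        ∫⁻ ω, ∫⁻ ω', Φ (fun _ => x) ω' ∂(Q γ x) ∂(Q γ x) := by
      refine lintegral_congr_ae ?_
      filter_upwards [ae_start γ x] with ω hω
      rw [hω]
      exact lintegral_congr fun ω' => key ω hω ω'
    rw [e1, e2]
    simp
  | succ n ih =>
    have m1 : Measurable fun ω => Φ ω (shift (n + 1) ω) :=
      hΦ.comp (measurable_id.prodMk (measurable_shift _))
    rw [lintegral_Q_step h0 h1 x m1, lintegral_Q_step h0 h1 x
      (measurable_lintegral_Q h0 h1 hΦ (measurable_pi_apply (n + 1)))]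
    refine lintegral_congr fun e => ?_
    simp only [shift_succ_consPath, consPath_succ]
    -- The starting point is absorbed into the functional, which then depends on the remaining path
    -- only up to time n.
    refine ih (x + e) (Φ := fun ω ω' => Φ (consPath x ω) ω') ?_ ?_
    · exact hΦ.comp (((measurable_consPath x).comp measurable_fst).prodMk measurable_snd)
    · intro ω₁ ω₂ ω' h
      refine hloc _ _ _ fun i hi => ?_
      cases i with
      | zero => rfl
      | succ i => exact h i (by omega)

/-- `τ` is a stopping time and, on `{τ < ∞}`, the functional `ψ` depends only on the path up to
time `τ`. -/
def LocalAt {α : Type*} (τ : (ℕ → ℤ) → ℕ∞) (ψ : (ℕ → ℤ) → α) : Prop :=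
  ∀ ω₁ ω₂ (n : ℕ), τ ω₁ = n → (∀ i ≤ n, ω₁ i = ω₂ i) → τ ω₂ = n ∧ ψ ω₁ = ψ ω₂

/-- The strong Markov property. -/
theorem lintegral_shift_stopping (h0 : 0 ≤ γ) (h1 : γ ≤ 1) (x : ℤ) {τ : (ℕ → ℤ) → ℕ∞}
    (hτ : Measurable τ) (hfin : ∀ᵐ ω ∂(Q γ x), τ ω ≠ ⊤)
    {Φ : (ℕ → ℤ) → (ℕ → ℤ) → ℝ≥0∞} (hΦ : Measurable (Function.uncurry Φ))
    (hloc : LocalAt τ Φ) :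
    ∫⁻ ω, Φ ω (shift (τ ω).toNat ω) ∂(Q γ x) =
      ∫⁻ ω, ∫⁻ ω', Φ ω ω' ∂(Q γ (ω (τ ω).toNat)) ∂(Q γ x) := by
  have hτs : ∀ n : ℕ, MeasurableSet {ω | τ ω = n} := fun n => hτ (MeasurableSet.singleton _)
  -- The integrals are partitioned by the value of τ; on {τ = n} the simple Markov property at time
  -- n applies, because that event is itself determined by the path up to n.
  have split : ∀ G : (ℕ → ℤ) → ℝ≥0∞, ∀ᵐ ω ∂(Q γ x),
      G ω = ∑' n : ℕ, {ω | τ ω = (n : ℕ∞)}.indicator G ω := by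
    intro G
    filter_upwards [hfin] with ω hω
    obtain ⟨n, hn⟩ := ENat.ne_top_iff_exists.1 hω
    rw [tsum_eq_single n]
    · simp [hn]
    · intro m hm
      rw [Set.indicator_of_notMem]
      simp only [Set.mem_ofPred_eq, ← hn]
      exact_mod_cast hm.symm
  have m1 : Measurable fun ω => (τ ω).toNat := Measurable.of_discrete.comp hτ
  have m2 : Measurable fun ω => Φ ω (shift (τ ω).toNat ω) :=
    hΦ.comp (measurable_id.prodMk (measurable_shift_of m1))
  have m3 : Measurable fun ω : ℕ → ℤ => ω (τ ω).toNat := by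
    have := (measurable_pi_apply (X := fun _ : ℕ => ℤ) 0).comp (measurable_shift_of m1)
    simpa [shift, Function.comp_def] using this
  have m4 := measurable_lintegral_Q h0 h1 hΦ m3
  rw [lintegral_congr_ae (split _), lintegral_congr_ae (split fun ω => ∫⁻ ω', Φ ω ω' ∂_),
    lintegral_tsum fun n => (m2.indicator (hτs n)).aemeasurable,
    lintegral_tsum fun n => (m4.indicator (hτs n)).aemeasurable]
  congr 1
  funext n
  have e1 : ∀ ω, {ω | τ ω = (n : ℕ∞)}.indicator (fun ω => Φ ω (shift (τ ω).toNat ω)) ω =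
      (fun ω ω' => {ω | τ ω = (n : ℕ∞)}.indicator (fun ω => Φ ω ω') ω) ω (shift n ω) := by
    intro ω
    by_cases h : τ ω = n <;> simp [h]
  have e2 : ∀ ω, {ω | τ ω = (n : ℕ∞)}.indicator
      (fun ω => ∫⁻ ω', Φ ω ω' ∂(Q γ (ω (τ ω).toNat))) ω =
      ∫⁻ ω', (fun ω ω' => {ω | τ ω = (n : ℕ∞)}.indicator (fun ω => Φ ω ω') ω) ω ω' ∂(Q γ (ω n)) := by
    intro ω
    by_cases h : τ ω = n <;> simp [h]
  simp_rw [e1, e2]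
  refine lintegral_shift h0 h1 n x
    (Φ := fun ω ω' => {ω | τ ω = (n : ℕ∞)}.indicator (fun ω => Φ ω ω') ω) ?_ ?_
  · have : Function.uncurry (fun ω ω' => {ω | τ ω = (n : ℕ∞)}.indicator (fun ω => Φ ω ω') ω) =
        (Prod.fst ⁻¹' {ω | τ ω = (n : ℕ∞)}).indicator (Function.uncurry Φ) := by
      funext ⟨ω, ω'⟩
      by_cases h : τ ω = n <;> simp [h]
    rw [this]
    exact hΦ.indicator (measurable_fst (hτs n))
  · intro ω₁ ω₂ ω' h
    by_cases h1 : τ ω₁ = n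
    · obtain ⟨h2, h3⟩ := hloc ω₁ ω₂ n h1 h
      simp [h1, h2, h3]
    · have h2 : τ ω₂ ≠ n := fun h2 => h1 (hloc ω₂ ω₁ n h2 fun i hi => (h i hi).symm).1
      simp [h1, h2]

end

section

variable {γ : ℝ}

/-! ### Exit times -/

theorem le_exitTime_iff (U : Set ℤ) (ω : ℕ → ℤ) (n : ℕ) :
    (n : ℕ∞) ≤ exitTime U ω ↔ ∀ i < n, ω i ∈ U := by
  simp only [exitTime, le_iInf_iff, Nat.cast_le]
  constructor
  · intro h i hi
    by_contra hU
    exact absurd (h i hU) (by omega)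
  · intro h i hi
    by_contra hlt
    exact hi (h i (by omega))

theorem lt_exitTime_iff (U : Set ℤ) (ω : ℕ → ℤ) (n : ℕ) :
    (n : ℕ∞) < exitTime U ω ↔ ∀ i ≤ n, ω i ∈ U := by
  rw [← Order.add_one_le_iff_of_not_isMax (by simp), ← Nat.cast_add_one, le_exitTime_iff]
  simp only [Nat.lt_succ_iff]

theorem exitTime_eq_iff (U : Set ℤ) (ω : ℕ → ℤ) (n : ℕ) :
    exitTime U ω = n ↔ ω n ∉ U ∧ ∀ i < n, ω i ∈ U := by
  rw [le_antisymm_iff, le_exitTime_iff, ← not_lt, lt_exitTime_iff]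
  constructor
  · rintro ⟨h1, h2⟩
    refine ⟨fun h => h1 fun i hi => ?_, h2⟩
    rcases hi.lt_or_eq with h3 | rfl
    exacts [h2 i h3, h]
  · rintro ⟨h1, h2⟩
    exact ⟨fun h => h1 (h n le_rfl), h2⟩

theorem exitTime_consPath_of_mem {U : Set ℤ} {x : ℤ} (hx : x ∈ U) (ω : ℕ → ℤ) :
    exitTime U (consPath x ω) = exitTime U ω + 1 := by
  refine ENat.eq_of_forall_natCast_le_iff fun n => ?_
  cases n with
  | zero => simp
  | succ n =>
    rw [le_exitTime_iff, Nat.cast_add_one, ENat.add_le_add_iff_right ENat.one_ne_top, le_exitTime_iff]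
    constructor
    · intro h i hi
      exact h (i + 1) (by omega)
    · intro h i hi
      cases i with
      | zero => exact hx
      | succ i => exact h i (by omega)

theorem exitTime_eq_zero {U : Set ℤ} {ω : ℕ → ℤ} (h : ω 0 ∉ U) : exitTime U ω = 0 := by
  have := (exitTime_eq_iff U ω 0).2 ⟨h, fun i hi => absurd hi (by omega)⟩
  simpa using this

theorem entranceTime_eq_exitTime (U : Set ℤ) : entranceTime U = exitTime Uᶜ := by
  funext ω
  simp [entranceTime, exitTime]

theorem measurable_exitTime (U : Set ℤ) : Measurable (exitTime U) := by
  have hle : ∀ n : ℕ, MeasurableSet {ω : ℕ → ℤ | (n : ℕ∞) ≤ exitTime U ω} := fun n => by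
    simp only [le_exitTime_iff]
    have : {ω : ℕ → ℤ | ∀ i < n, ω i ∈ U} = ⋂ i, ⋂ (_ : i < n), (fun ω => ω i) ⁻¹' U := by
      ext ω; simp
    rw [this]
    exact MeasurableSet.iInter fun i => MeasurableSet.iInter fun _ =>
      measurable_pi_apply i MeasurableSet.of_discrete
  refine measurable_to_countable' fun t => ?_
  induction t using ENat.recTopCoe with
  | top =>
    have : exitTime U ⁻¹' {⊤} = ⋂ n : ℕ, {ω | (n : ℕ∞) ≤ exitTime U ω} := by
      ext ω
      simp [ENat.eq_top_iff_forall_ge]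
    rw [this]
    exact MeasurableSet.iInter hle
  | coe n =>
    have : exitTime U ⁻¹' {(n : ℕ∞)} =
        {ω | (n : ℕ∞) ≤ exitTime U ω} \ {ω | ((n + 1 : ℕ) : ℕ∞) ≤ exitTime U ω} := by
      ext ω
      simp only [Set.mem_preimage, Set.mem_singleton_iff, Set.mem_sdiff, Set.mem_ofPred_eq,
        exitTime_eq_iff, le_exitTime_iff, Nat.lt_succ_iff_lt_or_eq]
      grind
    rw [this]
    exact (hle n).diff (hle (n + 1))

/-- The position at the exit time of `U`. -/
def exitPos (U : Set ℤ) (ω : ℕ → ℤ) : ℤ := ω (exitTime U ω).toNat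

theorem measurable_apply_toNat {τ : (ℕ → ℤ) → ℕ∞} (hτ : Measurable τ) :
    Measurable fun ω : ℕ → ℤ => ω (τ ω).toNat := by
  have m1 : Measurable fun ω => (τ ω).toNat := Measurable.of_discrete.comp hτ
  have := (measurable_pi_apply (X := fun _ : ℕ => ℤ) 0).comp (measurable_shift_of m1)
  simpa [shift, Function.comp_def] using this

theorem measurable_exitPos (U : Set ℤ) : Measurable (exitPos U) :=
  measurable_apply_toNat (measurable_exitTime U)

theorem exitPos_consPath_of_mem {U : Set ℤ} {x : ℤ} (hx : x ∈ U) {ω : ℕ → ℤ}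
    (hω : exitTime U ω ≠ ⊤) : exitPos U (consPath x ω) = exitPos U ω := by
  obtain ⟨n, hn⟩ := ENat.ne_top_iff_exists.1 hω
  have h1 : exitTime U (consPath x ω) = ((n + 1 : ℕ) : ℕ∞) := by
    rw [exitTime_consPath_of_mem hx, ← hn]; simp
  rw [exitPos, exitPos, h1, ← hn, ENat.toNat_natCast, ENat.toNat_natCast, consPath_succ]

theorem exitPos_eq_start {U : Set ℤ} {ω : ℕ → ℤ} (h : ω 0 ∉ U) : exitPos U ω = ω 0 := by
  simp [exitPos, exitTime_eq_zero h]

theorem exitPos_notMem {U : Set ℤ} {ω : ℕ → ℤ} (hω : exitTime U ω ≠ ⊤) : exitPos U ω ∉ U := by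
  obtain ⟨n, hn⟩ := ENat.ne_top_iff_exists.1 hω
  rw [exitPos, ← hn]
  exact ((exitTime_eq_iff U ω n).1 hn.symm).1

theorem exitPos_Ioo {α β : ℤ} {ω : ℕ → ℤ} (hs : ω 0 ∈ Set.Icc α β) (hnn : NearestNeighbour ω)
    (hω : exitTime (Set.Ioo α β) ω ≠ ⊤) :
    exitPos (Set.Ioo α β) ω = α ∨ exitPos (Set.Ioo α β) ω = β := by
  obtain ⟨n, hn⟩ := ENat.ne_top_iff_exists.1 hω
  obtain ⟨h1, h2⟩ := (exitTime_eq_iff _ ω n).1 hn.symm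
  simp only [exitPos, ← hn, ENat.toNat_natCast]
  simp only [Set.mem_Icc, Set.mem_Ioo] at *
  cases n with
  | zero => omega
  | succ n =>
    have h3 := h2 n (by omega)
    have h4 := abs_le.1 (hnn n)
    omega

/-- A nearest-neighbour path leaves an interval through an endpoint, and the endpoints are already
outside U. This reduces hitting C and leaving O to exits from explicit intervals. -/
theorem exitTime_eq_of_Ioo_subset {U : Set ℤ} {α β : ℤ} (hU : Set.Ioo α β ⊆ U) (hα : α ∉ U)
    (hβ : β ∉ U) {ω : ℕ → ℤ} (hs : ω 0 ∈ Set.Icc α β) (hnn : NearestNeighbour ω)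
    (hω : exitTime (Set.Ioo α β) ω ≠ ⊤) : exitTime U ω = exitTime (Set.Ioo α β) ω := by
  have h3 := exitPos_Ioo hs hnn hω
  obtain ⟨n, hn⟩ := ENat.ne_top_iff_exists.1 hω
  obtain ⟨h1, h2⟩ := (exitTime_eq_iff _ ω n).1 hn.symm
  simp only [exitPos, ← hn, ENat.toNat_natCast] at h3
  rw [← hn, exitTime_eq_iff]
  refine ⟨?_, fun i hi => hU (h2 i hi)⟩
  rcases h3 with h | h <;> rwa [h]

/-! ### Occupation functionals before an exit time -/

open Classical in
/-- `∑_{m < T_U} f (Z_m)`. -/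
def occ (f : ℤ → ℝ≥0∞) (U : Set ℤ) (ω : ℕ → ℤ) : ℝ≥0∞ :=
  ∑' m : ℕ, if (m : ℕ∞) < exitTime U ω then f (ω m) else 0

open Classical in
/-- `∑_{m < min(n, T_U)} f (Z_m)`. -/
def occUpTo (f : ℤ → ℝ≥0∞) (U : Set ℤ) (n : ℕ) (ω : ℕ → ℤ) : ℝ≥0∞ :=
  ∑ m ∈ Finset.range n, if (m : ℕ∞) < exitTime U ω then f (ω m) else 0

theorem occ_eq_iSup (f : ℤ → ℝ≥0∞) (U : Set ℤ) (ω : ℕ → ℤ) :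
    occ f U ω = ⨆ n, occUpTo f U n ω := ENNReal.tsum_eq_iSup_nat

theorem occUpTo_mono (f : ℤ → ℝ≥0∞) (U : Set ℤ) : Monotone (occUpTo f U) := fun _ _ hmn _ =>
  Finset.sum_le_sum_of_subset (Finset.range_mono hmn)

theorem measurable_occUpTo (f : ℤ → ℝ≥0∞) (U : Set ℤ) (n : ℕ) : Measurable (occUpTo f U n) := by
  unfold occUpTo
  refine Finset.measurable_sum _ fun m _ => Measurable.ite ?_ ?_ measurable_const
  · exact measurable_exitTime U (MeasurableSet.of_discrete (s := Set.Ioi (m : ℕ∞)))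
  · exact Measurable.of_discrete.comp (measurable_pi_apply m)

theorem measurable_occ (f : ℤ → ℝ≥0∞) (U : Set ℤ) : Measurable (occ f U) := by
  have : occ f U = fun ω => ⨆ n, occUpTo f U n ω := funext (occ_eq_iSup f U)
  rw [this]
  exact Measurable.iSup fun n => measurable_occUpTo f U n

theorem occUpTo_consPath_of_mem (f : ℤ → ℝ≥0∞) {U : Set ℤ} {x : ℤ} (hx : x ∈ U) (n : ℕ)
    (ω : ℕ → ℤ) : occUpTo f U (n + 1) (consPath x ω) = f x + occUpTo f U n ω := by
  unfold occUpTo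
  rw [Finset.sum_range_succ', add_comm]
  congr 1
  · simp [exitTime_consPath_of_mem hx]
  · refine Finset.sum_congr rfl fun m _ => ?_
    rw [exitTime_consPath_of_mem hx, consPath_succ, Nat.cast_add_one]
    simp only [ENat.add_lt_add_iff_right ENat.one_ne_top]

theorem occ_consPath_of_mem (f : ℤ → ℝ≥0∞) {U : Set ℤ} {x : ℤ} (hx : x ∈ U)
    (ω : ℕ → ℤ) : occ f U (consPath x ω) = f x + occ f U ω := by
  unfold occ
  rw [tsum_eq_zero_add' ENNReal.summable]
  congr 1
  · simp [exitTime_consPath_of_mem hx]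
  · congr 1
    funext m
    rw [exitTime_consPath_of_mem hx, consPath_succ, Nat.cast_add_one]
    simp only [ENat.add_lt_add_iff_right ENat.one_ne_top]

theorem occ_eq_zero (f : ℤ → ℝ≥0∞) {U : Set ℤ} {ω : ℕ → ℤ} (h : ω 0 ∉ U) : occ f U ω = 0 := by
  simp [occ, exitTime_eq_zero h]

theorem occUpTo_eq_zero (f : ℤ → ℝ≥0∞) {U : Set ℤ} {ω : ℕ → ℤ} (h : ω 0 ∉ U) (n : ℕ) :
    occUpTo f U n ω = 0 := by
  simp [occUpTo, exitTime_eq_zero h]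

open Classical in
theorem toENNReal_eq_tsum (t : ℕ∞) :
    (t : ℝ≥0∞) = ∑' m : ℕ, if (m : ℕ∞) < t then 1 else 0 := by
  induction t using ENat.recTopCoe with
  | top => simp
  | coe n =>
    rw [tsum_eq_sum (s := Finset.range n)]
    · rw [Finset.sum_congr rfl (g := fun _ => 1)]
      · simp
      · intro m hm
        rw [if_pos]
        exact_mod_cast Finset.mem_range.1 hm
    · intro m hm
      rw [if_neg]
      rw [Nat.cast_lt]
      simpa using hm

/-- Durations (f = 1) and local times (f the indicator of a point) are both occupation functionals,
so the Poisson equation and the second moment bound are needed only once. -/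
theorem occ_one (U : Set ℤ) (ω : ℕ → ℤ) : occ (fun _ => 1) U ω = (exitTime U ω : ℝ≥0∞) := by
  rw [toENNReal_eq_tsum]
  rfl

theorem localTime_exitTime (z : ℤ) (U : Set ℤ) (ω : ℕ → ℤ) :
    localTime z (exitTime U ω) ω = occ (fun y => if y = z then 1 else 0) U ω := by
  unfold localTime occ
  congr 1
  funext m
  by_cases h1 : (m : ℕ∞) < exitTime U ω <;> by_cases h2 : ω m = z <;> simp [h1, h2]

/-! ### First-step analysis -/

/-- The transition operator of the walk, on `[0, ∞]`-valued functions. -/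
def transOp (γ : ℝ) (g : ℤ → ℝ≥0∞) (x : ℤ) : ℝ≥0∞ :=
  ENNReal.ofReal (γ / 2) * g (x + 1) + ENNReal.ofReal (γ / 2) * g (x - 1) +
    ENNReal.ofReal (1 - γ) * g x

theorem transOp_mono {g g' : ℤ → ℝ≥0∞} (h : ∀ x, g x ≤ g' x) (x : ℤ) :
    transOp γ g x ≤ transOp γ g' x := by
  unfold transOp
  gcongr <;> apply h

theorem transOp_const_mul (c : ℝ≥0∞) (g : ℤ → ℝ≥0∞) (x : ℤ) :
    transOp γ (fun y => c * g y) x = c * transOp γ g x := by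
  unfold transOp
  ring

theorem lintegral_stepLaw (f : ℤ → ℝ≥0∞) (x : ℤ) :
    ∫⁻ e, f (x + e) ∂(stepLaw γ) = transOp γ f x := by
  simp [stepLaw, transOp, lintegral_add_measure, lintegral_smul_measure, sub_eq_add_neg]

theorem lintegral_Q_eq_transOp (h0 : 0 ≤ γ) (h1 : γ ≤ 1) (x : ℤ) {F G : (ℕ → ℤ) → ℝ≥0∞}
    (hF : Measurable F) (h : ∀ y, ∀ᵐ ω ∂(Q γ y), F (consPath x ω) = G ω) :
    ∫⁻ ω, F ω ∂(Q γ x) = transOp γ (fun y => ∫⁻ ω, G ω ∂(Q γ y)) x := by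
  rw [lintegral_Q_step h0 h1 x hF, ← lintegral_stepLaw]
  exact lintegral_congr fun e => lintegral_congr_ae (h _)

theorem transOp_add (f g : ℤ → ℝ≥0∞) (x : ℤ) :
    transOp γ (fun y => f y + g y) x = transOp γ f x + transOp γ g x := by
  unfold transOp
  ring

theorem transOp_const (h0 : 0 ≤ γ) (h1 : γ ≤ 1) (c : ℝ≥0∞) (x : ℤ) :
    transOp γ (fun _ => c) x = c := by
  unfold transOp
  rw [← add_mul, ← add_mul, ← ENNReal.ofReal_add (by positivity) (by positivity),
    ← ENNReal.ofReal_add (by positivity) (by linarith)]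
  simp

/-- The Poisson equation E = f + P E on U, obtained by conditioning on the first step. -/
theorem lintegral_occ_of_mem (h0 : 0 ≤ γ) (h1 : γ ≤ 1) (f : ℤ → ℝ≥0∞) {U : Set ℤ} {x : ℤ}
    (hx : x ∈ U) :
    ∫⁻ ω, occ f U ω ∂(Q γ x) = f x + transOp γ (fun y => ∫⁻ ω, occ f U ω ∂(Q γ y)) x := by
  rw [lintegral_Q_eq_transOp h0 h1 x (measurable_occ f U) (G := fun ω => f x + occ f U ω)
    (fun y => Eventually.of_forall fun ω => occ_consPath_of_mem f hx ω)]
  conv_rhs => rw [← transOp_const h0 h1 (f x) x, ← transOp_add]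
  congr 1
  funext y
  have := isProbabilityMeasure_Q h0 h1 y
  rw [lintegral_add_left measurable_const]
  simp

theorem lintegral_occUpTo_of_mem (h0 : 0 ≤ γ) (h1 : γ ≤ 1) (f : ℤ → ℝ≥0∞) {U : Set ℤ} {x : ℤ}
    (hx : x ∈ U) (n : ℕ) :
    ∫⁻ ω, occUpTo f U (n + 1) ω ∂(Q γ x) =
      f x + transOp γ (fun y => ∫⁻ ω, occUpTo f U n ω ∂(Q γ y)) x := by
  rw [lintegral_Q_eq_transOp h0 h1 x (measurable_occUpTo f U _)
    (G := fun ω => f x + occUpTo f U n ω)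
    (fun y => Eventually.of_forall fun ω => occUpTo_consPath_of_mem f hx n ω)]
  conv_rhs => rw [← transOp_const h0 h1 (f x) x, ← transOp_add]
  congr 1
  funext y
  have := isProbabilityMeasure_Q h0 h1 y
  rw [lintegral_add_left measurable_const]
  simp

theorem lintegral_eq_zero_of_start {x : ℤ} {U : Set ℤ} (hx : x ∉ U) {F : (ℕ → ℤ) → ℝ≥0∞}
    (hF : ∀ ω, ω 0 ∉ U → F ω = 0) : ∫⁻ ω, F ω ∂(Q γ x) = 0 := by
  rw [lintegral_congr_ae (g := fun _ => 0)]
  · simp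
  · filter_upwards [ae_start γ x] with ω hω
    exact hF ω (by rwa [hω])

/-- A supersolution of `g ≥ f + P g` on `U` dominates the expected occupation functional. -/
theorem lintegral_occ_le (h0 : 0 ≤ γ) (h1 : γ ≤ 1) {f g : ℤ → ℝ≥0∞} {U : Set ℤ}
    (hg : ∀ x ∈ U, f x + transOp γ g x ≤ g x) (x : ℤ) :
    ∫⁻ ω, occ f U ω ∂(Q γ x) ≤ g x := by
  -- With a finite horizon the domination follows by induction from E_{n+1} = f + P E_n; monotone
  -- convergence then removes the horizon.
  have key : ∀ n x, ∫⁻ ω, occUpTo f U n ω ∂(Q γ x) ≤ g x := by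
    intro n
    induction n with
    | zero => intro x; simp [occUpTo]
    | succ n ih =>
      intro x
      by_cases hx : x ∈ U
      · rw [lintegral_occUpTo_of_mem h0 h1 f hx]
        exact le_trans (by gcongr; exact transOp_mono ih x) (hg x hx)
      · rw [lintegral_eq_zero_of_start hx fun ω hω => occUpTo_eq_zero f hω _]
        exact zero_le
  simp_rw [occ_eq_iSup]
  rw [lintegral_iSup (fun n => measurable_occUpTo f U n) (occUpTo_mono f U)]
  exact iSup_le fun n => key n x

/-- A second moment bound for occupation functionals. -/
theorem lintegral_occ_sq_le (h0 : 0 ≤ γ) (h1 : γ ≤ 1) (f : ℤ → ℝ≥0∞) (U : Set ℤ) (S : ℝ≥0∞)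
    (hS : ∀ x, ∫⁻ ω, occ f U ω ∂(Q γ x) ≤ S) (x : ℤ) :
    ∫⁻ ω, occ f U ω ^ 2 ∂(Q γ x) ≤ 2 * S * ∫⁻ ω, occ f U ω ∂(Q γ x) := by
  have hle : ∀ n ω, occUpTo f U n ω ≤ occ f U ω := fun n ω => by
    rw [occ_eq_iSup]; exact le_iSup (fun n => occUpTo f U n ω) n
  have hS' : ∀ n x, ∫⁻ ω, occUpTo f U n ω ∂(Q γ x) ≤ S := fun n x =>
    (lintegral_mono fun ω => hle n ω).trans (hS x)
  have key : ∀ n x, ∫⁻ ω, occUpTo f U n ω ^ 2 ∂(Q γ x) ≤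
      2 * S * ∫⁻ ω, occUpTo f U n ω ∂(Q γ x) := by
    intro n
    induction n with
    | zero => intro x; simp [occUpTo]
    | succ n ih =>
      intro x
      by_cases hx : x ∈ U
      · have hm := measurable_occUpTo f U n
        have e1 : ∫⁻ ω, occUpTo f U (n + 1) ω ^ 2 ∂(Q γ x) =
            f x ^ 2 + 2 * f x * transOp γ (fun y => ∫⁻ ω, occUpTo f U n ω ∂(Q γ y)) x +
              transOp γ (fun y => ∫⁻ ω, occUpTo f U n ω ^ 2 ∂(Q γ y)) x := by
          rw [lintegral_Q_eq_transOp h0 h1 x ((measurable_occUpTo f U _).pow_const 2)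
            (G := fun ω => f x ^ 2 + 2 * f x * occUpTo f U n ω + occUpTo f U n ω ^ 2)
            (fun y => Eventually.of_forall fun ω => by
              rw [occUpTo_consPath_of_mem f hx n ω]; ring)]
          rw [← transOp_const_mul, ← transOp_const h0 h1 (f x ^ 2) x, ← transOp_add, ← transOp_add,
            transOp_const h0 h1]
          congr 1
          funext y
          have := isProbabilityMeasure_Q h0 h1 y
          rw [lintegral_add_right _ (hm.pow_const 2), lintegral_add_left measurable_const,
            lintegral_const_mul _ hm]
          simp
        have e2 := lintegral_occUpTo_of_mem h0 h1 f hx n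
        have e3 := hS' (n + 1) x
        rw [e1, e2]
        rw [e2] at e3
        set p := transOp γ (fun y => ∫⁻ ω, occUpTo f U n ω ∂(Q γ y)) x
        have e4 : transOp γ (fun y => ∫⁻ ω, occUpTo f U n ω ^ 2 ∂(Q γ y)) x ≤ 2 * S * p := by
          rw [← transOp_const_mul]
          exact transOp_mono ih x
        -- One extra `f x ^ 2` is added to produce the factor `f x + p`. That factor is the mean
        -- with horizon n + 1, hence at most S.
        calc f x ^ 2 + 2 * f x * p + transOp γ (fun y => ∫⁻ ω, occUpTo f U n ω ^ 2 ∂(Q γ y)) x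
            ≤ f x ^ 2 + 2 * f x * p + 2 * S * p := by gcongr
          _ ≤ 2 * f x ^ 2 + 2 * f x * p + 2 * S * p := by
            gcongr
            exact le_mul_of_one_le_left zero_le one_le_two
          _ = 2 * f x * (f x + p) + 2 * S * p := by ring
          _ ≤ 2 * f x * S + 2 * S * p := by gcongr
          _ = 2 * S * (f x + p) := by ring
      · rw [lintegral_eq_zero_of_start hx fun ω hω => by rw [occUpTo_eq_zero f hω]; simp]
        exact zero_le
  have e : ∀ ω, occ f U ω ^ 2 = ⨆ n, occUpTo f U n ω ^ 2 := fun ω => by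
    rw [occ_eq_iSup]
    exact ENNReal.iSup_pow _ 2
  simp_rw [e]
  rw [lintegral_iSup (fun n => (measurable_occUpTo f U n).pow_const 2)
    (fun m n hmn ω => by gcongr; exact occUpTo_mono f U hmn ω)]
  refine iSup_le fun n => (key n x).trans ?_
  gcongr
  exact hle _ _

end

section

variable {γ : ℝ}

/-! ### Exit from an interval -/

/-- The recurrence forces w(α + n) = n w(α + 1), an affine function, and a second zero at β kills
the slope. -/
theorem eq_zero_of_discrete_harmonic {α β : ℤ} {w : ℤ → ℝ} (hα : w α = 0) (hβ : w β = 0)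
    (hw : ∀ x ∈ Set.Ioo α β, 2 * w x = w (x + 1) + w (x - 1)) {x : ℤ} (hx : x ∈ Set.Icc α β) :
    w x = 0 := by
  -- Two consecutive values are carried because the recurrence is of second order.
  have key : ∀ n : ℕ, (α + n ≤ β → w (α + n) = n * w (α + 1)) ∧
      (α + n + 1 ≤ β → w (α + n + 1) = (n + 1) * w (α + 1)) := by
    intro n
    induction n with
    | zero => simp [hα]
    | succ n ih =>
      constructor
      · intro h
        have := ih.2 (by push_cast at h; linarith)
        push_cast
        rw [← add_assoc, this]
      · intro h
        push_cast at h ⊢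
        have e1 := ih.1 (by linarith)
        have e2 := ih.2 (by linarith)
        have e3 := hw (α + n + 1) ⟨by linarith, by linarith⟩
        rw [show α + (n : ℤ) + 1 - 1 = α + n by ring, e1, e2] at e3
        rw [← add_assoc]
        linarith
  have e : ∀ y, α ≤ y → y ≤ β → w y = (y - α) * w (α + 1) := by
    intro y h1 h2
    have := (key (y - α).toNat).1 (by rw [Int.toNat_of_nonneg (by linarith)]; linarith)
    have hc : (((y - α).toNat : ℤ) : ℝ) = ((y - α : ℤ) : ℝ) := by
      rw [Int.toNat_of_nonneg (by linarith)]
    rw [Int.toNat_of_nonneg (by linarith)] at this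
    rw [← Int.cast_natCast (R := ℝ), hc] at this
    simpa using this
  obtain ⟨h1, h2⟩ := hx
  rcases h1.eq_or_lt with rfl | h3
  · exact hα
  · have e1 := e β (by linarith) le_rfl
    rw [hβ] at e1
    have : ((β : ℝ) - α) ≠ 0 := by
      have : (α : ℝ) < β := by exact_mod_cast lt_of_lt_of_le h3 h2
      linarith
    have e2 : w (α + 1) = 0 := by
      rcases mul_eq_zero.1 e1.symm with h | h
      exacts [absurd h this, h]
    rw [e x h1 h2, e2, mul_zero]

/-- A solution of the Poisson equation on an interval is determined by its boundary values. -/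
theorem eq_ofReal_of_poisson (h0 : 0 < γ) (h1 : γ ≤ 1) {α β : ℤ} {E : ℤ → ℝ≥0∞} {c g : ℤ → ℝ}
    (hfin : ∀ x ∈ Set.Icc α β, E x ≠ ⊤) (hc : ∀ x ∈ Set.Ioo α β, 0 ≤ c x)
    (hE : ∀ x ∈ Set.Ioo α β, E x = ENNReal.ofReal (c x) + transOp γ E x)
    (hg : ∀ x ∈ Set.Ioo α β, γ * (2 * g x - g (x + 1) - g (x - 1)) = 2 * c x)
    (hα : (E α).toReal = g α) (hβ : (E β).toReal = g β) {x : ℤ} (hx : x ∈ Set.Icc α β) :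
    E x = ENNReal.ofReal (g x) := by
  have key : (E x).toReal - g x = 0 := by
    refine eq_zero_of_discrete_harmonic (w := fun x => (E x).toReal - g x) (by simp [hα])
      (by simp [hβ]) ?_ hx
    intro y hy
    obtain ⟨hy1, hy2⟩ := hy
    have f0 := hfin y ⟨hy1.le, hy2.le⟩
    have f1 := hfin (y + 1) ⟨by linarith, by linarith⟩
    have f2 := hfin (y - 1) ⟨by linarith, by linarith⟩
    have e := congrArg ENNReal.toReal (hE y ⟨hy1, hy2⟩)
    unfold transOp at e
    rw [ENNReal.toReal_add (by finiteness) (by finiteness),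
      ENNReal.toReal_add (by finiteness) (by finiteness),
      ENNReal.toReal_add (by finiteness) (by finiteness), ENNReal.toReal_mul,
      ENNReal.toReal_mul, ENNReal.toReal_mul, ENNReal.toReal_ofReal (hc y ⟨hy1, hy2⟩),
      ENNReal.toReal_ofReal (by linarith), ENNReal.toReal_ofReal (by linarith)] at e
    have e' := hg y ⟨hy1, hy2⟩
    have : γ * (2 * ((E y).toReal - g y)) =
        γ * (((E (y + 1)).toReal - g (y + 1)) + ((E (y - 1)).toReal - g (y - 1))) := by linarith
    exact mul_left_cancel₀ h0.ne' this
  rw [← ENNReal.ofReal_toReal (hfin x hx), sub_eq_zero.1 key]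

/-- A step has variance γ, so (x - α)(β - x)/γ satisfies g = 1 + P g inside the interval. The
supersolution bound comes before the exact formula because uniqueness for the Poisson equation
requires finite solutions. -/
theorem lintegral_exitTime_Ioo_le (h0 : 0 < γ) (h1 : γ ≤ 1) (α β x : ℤ) :
    ∫⁻ ω, (exitTime (Set.Ioo α β) ω : ℝ≥0∞) ∂(Q γ x) ≤
      ENNReal.ofReal ((x - α) * (β - x) / γ) := by
  simp_rw [← occ_one]
  refine lintegral_occ_le h0.le h1 (g := fun x : ℤ => ENNReal.ofReal ((x - α) * (β - x) / γ)) ?_ x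
  intro y hy
  have hy1 : (α : ℝ) + 1 ≤ y := by exact_mod_cast hy.1
  have hy2 : (y : ℝ) + 1 ≤ β := by exact_mod_cast hy.2
  have n0 : 0 ≤ ((y : ℝ) - α) * (β - y) / γ :=
    div_nonneg (mul_nonneg (by linarith) (by linarith)) h0.le
  have n1 : 0 ≤ ((y : ℝ) + 1 - α) * (β - (y + 1)) / γ :=
    div_nonneg (mul_nonneg (by linarith) (by linarith)) h0.le
  have n2 : 0 ≤ ((y : ℝ) - 1 - α) * (β - (y - 1)) / γ :=
    div_nonneg (mul_nonneg (by linarith) (by linarith)) h0.le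
  have n3 : 0 ≤ 1 - γ := by linarith
  unfold transOp
  push_cast
  rw [← ENNReal.ofReal_mul (by positivity), ← ENNReal.ofReal_mul (by positivity),
    ← ENNReal.ofReal_mul (by linarith), ← ENNReal.ofReal_add (by positivity) (by positivity),
    ← ENNReal.ofReal_add (by positivity) (by positivity), ← ENNReal.ofReal_one,
    ← ENNReal.ofReal_add (by positivity) (by positivity)]
  apply ENNReal.ofReal_le_ofReal
  apply le_of_eq
  field_simp
  ring

theorem ae_exitTime_Ioo_ne_top (h0 : 0 < γ) (h1 : γ ≤ 1) (α β x : ℤ) :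
    ∀ᵐ ω ∂(Q γ x), exitTime (Set.Ioo α β) ω ≠ ⊤ := by
  have hm : Measurable fun ω => (exitTime (Set.Ioo α β) ω : ℝ≥0∞) :=
    Measurable.of_discrete.comp (measurable_exitTime _)
  filter_upwards [ae_lt_top hm
    ((lintegral_exitTime_Ioo_le h0 h1 α β x).trans_lt ENNReal.ofReal_lt_top).ne] with ω hω
  exact (ENat.toENNReal_lt_top.1 hω).ne

theorem lintegral_exitTime_Ioo (h0 : 0 < γ) (h1 : γ ≤ 1) {α β x : ℤ} (hx : x ∈ Set.Icc α β) :
    ∫⁻ ω, (exitTime (Set.Ioo α β) ω : ℝ≥0∞) ∂(Q γ x) =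
      ENNReal.ofReal ((x - α) * (β - x) / γ) := by
  refine eq_ofReal_of_poisson h0 h1 (α := α) (β := β) (c := fun _ => 1)
    (E := fun x => ∫⁻ ω, (exitTime (Set.Ioo α β) ω : ℝ≥0∞) ∂(Q γ x))
    (g := fun x : ℤ => ((x : ℝ) - α) * (β - x) / γ) ?_ (by simp) ?_ ?_ ?_ ?_ hx
  · intro y _
    exact ((lintegral_exitTime_Ioo_le h0 h1 α β y).trans_lt ENNReal.ofReal_lt_top).ne
  · intro y hy
    simp_rw [← occ_one, ENNReal.ofReal_one]
    exact lintegral_occ_of_mem h0.le h1 _ hy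
  · intro y _
    push_cast
    field_simp
    ring
  · have := lintegral_eq_zero_of_start (γ := γ) (x := α) (U := Set.Ioo α β) (by simp)
      (F := fun ω => (exitTime (Set.Ioo α β) ω : ℝ≥0∞)) (fun ω hω => by simp [exitTime_eq_zero hω])
    simp [this]
  · have := lintegral_eq_zero_of_start (γ := γ) (x := β) (U := Set.Ioo α β) (by simp)
      (F := fun ω => (exitTime (Set.Ioo α β) ω : ℝ≥0∞)) (fun ω hω => by simp [exitTime_eq_zero hω])
    simp [this]

/-- This is the Green function of the interval: vanishing at both ends, affine on each side of z,
and with slope dropping by 2/γ at z. -/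
theorem lintegral_localTime_Ioo (h0 : 0 < γ) (h1 : γ ≤ 1) {α β x z : ℤ} (hx : x ∈ Set.Icc α β)
    (hz : z ∈ Set.Ioo α β) :
    ∫⁻ ω, localTime z (exitTime (Set.Ioo α β) ω) ω ∂(Q γ x) =
      ENNReal.ofReal (2 * ((min x z - α : ℤ) * (β - max x z : ℤ)) / (γ * (β - α))) := by
  have hαβ : (α : ℝ) < β := by exact_mod_cast hz.1.trans hz.2
  simp_rw [localTime_exitTime]
  refine eq_ofReal_of_poisson h0 h1 (α := α) (β := β) (c := fun y => if y = z then 1 else 0)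
    (E := fun x => ∫⁻ ω, occ (fun y => if y = z then 1 else 0) (Set.Ioo α β) ω ∂(Q γ x))
    (g := fun x : ℤ => 2 * ((min x z - α : ℤ) * (β - max x z : ℤ)) / (γ * (β - α)))
    ?_ (fun y _ => by split_ifs <;> norm_num) ?_ ?_ ?_ ?_ hx
  · intro y _
    refine ne_top_of_le_ne_top ?_ (lintegral_mono (g := fun ω => occ (fun _ => 1) (Set.Ioo α β) ω) ?_)
    · simp_rw [occ_one]
      exact ((lintegral_exitTime_Ioo_le h0 h1 α β y).trans_lt ENNReal.ofReal_lt_top).ne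
    · intro ω
      refine ENNReal.tsum_le_tsum fun m => ?_
      split_ifs with h2
      · dsimp only
        split_ifs <;> simp
      · rfl
  · intro y hy
    rw [lintegral_occ_of_mem h0.le h1 _ hy]
    congr 1
    split_ifs <;> simp
  · intro y _
    have hne : (β : ℝ) - α ≠ 0 := by linarith
    rcases lt_trichotomy y z with h | h | h
    · rw [if_neg h.ne, min_eq_left h.le, max_eq_right h.le, min_eq_left (by omega : y + 1 ≤ z),
        max_eq_right (by omega : y + 1 ≤ z), min_eq_left (by omega : y - 1 ≤ z),
        max_eq_right (by omega : y - 1 ≤ z)]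
      push_cast
      field_simp
      ring
    · rw [if_pos h, h, min_self, max_self, min_eq_right (by omega : z ≤ z + 1),
        max_eq_left (by omega : z ≤ z + 1), min_eq_left (by omega : z - 1 ≤ z),
        max_eq_right (by omega : z - 1 ≤ z)]
      push_cast
      field_simp
      ring
    · rw [if_neg h.ne', min_eq_right h.le, max_eq_left h.le, min_eq_right (by omega : z ≤ y + 1),
        max_eq_left (by omega : z ≤ y + 1), min_eq_right (by omega : z ≤ y - 1),
        max_eq_left (by omega : z ≤ y - 1)]
      push_cast
      field_simp
      ring
  · rw [lintegral_eq_zero_of_start (U := Set.Ioo α β) (by simp) fun ω hω => occ_eq_zero _ hω,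
      min_eq_left hz.1.le]
    simp
  · rw [lintegral_eq_zero_of_start (U := Set.Ioo α β) (by simp) fun ω hω => occ_eq_zero _ hω,
      max_eq_left hz.2.le]
    simp

theorem ae_exitPos_Ioo (h0 : 0 < γ) (h1 : γ ≤ 1) {α β x : ℤ} (hx : x ∈ Set.Icc α β) :
    ∀ᵐ ω ∂(Q γ x), exitPos (Set.Ioo α β) ω = α ∨ exitPos (Set.Ioo α β) ω = β := by
  filter_upwards [ae_start γ x, ae_nearestNeighbour h0.le h1 x, ae_exitTime_Ioo_ne_top h0 h1 α β x]
    with ω h2 h3 h4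
  exact exitPos_Ioo (by rwa [h2]) h3 h4

/-- Gambler's ruin: the expectation is harmonic in x, hence interpolates linearly between its
boundary values g α and g β. -/
theorem lintegral_exitPos_Ioo (h0 : 0 < γ) (h1 : γ ≤ 1) {α β x : ℤ} (hαβ : α < β)
    (hx : x ∈ Set.Icc α β) {g : ℤ → ℝ} (hα : 0 ≤ g α) (hβ : 0 ≤ g β) :
    ∫⁻ ω, ENNReal.ofReal (g (exitPos (Set.Ioo α β) ω)) ∂(Q γ x) =
      ENNReal.ofReal (((β - x) * g α + (x - α) * g β) / (β - α)) := by
  have hαβ' : (α : ℝ) < β := by exact_mod_cast hαβ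
  have hne : (β : ℝ) - α ≠ 0 := by linarith
  have hm : Measurable fun ω => ENNReal.ofReal (g (exitPos (Set.Ioo α β) ω)) :=
    (Measurable.of_discrete (f := fun y => ENNReal.ofReal (g y))).comp (measurable_exitPos _)
  have hbd : ∀ y, y ∉ Set.Ioo α β →
      ∫⁻ ω, ENNReal.ofReal (g (exitPos (Set.Ioo α β) ω)) ∂(Q γ y) = ENNReal.ofReal (g y) := by
    intro y hy
    have := isProbabilityMeasure_Q h0.le h1 y
    rw [lintegral_congr_ae (g := fun _ => ENNReal.ofReal (g y))]
    · simp
    · filter_upwards [ae_start γ y] with ω hω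
      rw [exitPos_eq_start (by rwa [hω]), hω]
  refine eq_ofReal_of_poisson h0 h1 (α := α) (β := β) (c := fun _ => 0)
    (E := fun x => ∫⁻ ω, ENNReal.ofReal (g (exitPos (Set.Ioo α β) ω)) ∂(Q γ x))
    (g := fun x : ℤ => ((β - x) * g α + (x - α) * g β) / (β - α)) ?_ (by simp) ?_ ?_ ?_ ?_ hx
  · intro y hy
    have := isProbabilityMeasure_Q h0.le h1 y
    refine ne_top_of_le_ne_top (b := ENNReal.ofReal (max (g α) (g β))) ENNReal.ofReal_ne_top ?_
    calc _ ≤ ∫⁻ _, ENNReal.ofReal (max (g α) (g β)) ∂(Q γ y) := by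
          refine lintegral_mono_ae ?_
          filter_upwards [ae_exitPos_Ioo h0 h1 hy] with ω hω
          apply ENNReal.ofReal_le_ofReal
          rcases hω with h | h <;> simp [h]
      _ = _ := by simp
  · intro y hy
    rw [lintegral_Q_eq_transOp h0.le h1 y hm
      (G := fun ω => ENNReal.ofReal (g (exitPos (Set.Ioo α β) ω)))]
    · simp
    · intro y'
      filter_upwards [ae_exitTime_Ioo_ne_top h0 h1 α β y'] with ω hω
      rw [exitPos_consPath_of_mem hy hω]
  · intro y _
    push_cast
    field_simp
    ring
  · rw [hbd α (by simp), ENNReal.toReal_ofReal hα]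
    field_simp
    ring
  · rw [hbd β (by simp), ENNReal.toReal_ofReal hβ]
    field_simp
    ring

/-- The maximum over the starting point of the mean exit time, (β - α)²/(4γ), is the uniform bound S
in `lintegral_occ_sq_le`. -/
theorem lintegral_exitTime_Ioo_sq_le (h0 : 0 < γ) (h1 : γ ≤ 1) (α β x : ℤ) :
    ∫⁻ ω, (exitTime (Set.Ioo α β) ω : ℝ≥0∞) ^ 2 ∂(Q γ x) ≤
      ENNReal.ofReal (2 * ((β - α) ^ 2 / (4 * γ)) ^ 2) := by
  have hS : ∀ y, ∫⁻ ω, occ (fun _ => 1) (Set.Ioo α β) ω ∂(Q γ y) ≤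
      ENNReal.ofReal ((β - α) ^ 2 / (4 * γ)) := by
    intro y
    simp_rw [occ_one]
    refine (lintegral_exitTime_Ioo_le h0 h1 α β y).trans (ENNReal.ofReal_le_ofReal ?_)
    rw [div_le_div_iff₀ h0 (by positivity)]
    nlinarith [mul_nonneg h0.le (sq_nonneg (2 * (y : ℝ) - α - β))]
  simp_rw [← occ_one]
  refine (lintegral_occ_sq_le h0.le h1 _ _ _ hS x).trans ?_
  have : (0 : ℝ) ≤ (β - α) ^ 2 / (4 * γ) := by positivity
  rw [ENNReal.ofReal_mul (by norm_num), ENNReal.ofReal_pow this,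
    pow_two (ENNReal.ofReal _), ← mul_assoc, ENNReal.ofReal_ofNat]
  gcongr
  exact hS x

theorem lintegral_localTime_Ioo_sq_le (h0 : 0 < γ) (h1 : γ ≤ 1) {α β z : ℤ}
    (hz : z ∈ Set.Ioo α β) (x : ℤ) :
    ∫⁻ ω, localTime z (exitTime (Set.Ioo α β) ω) ω ^ 2 ∂(Q γ x) ≤
      ENNReal.ofReal (2 * ((β - α) / (2 * γ)) ^ 2) := by
  have hαβ : (α : ℝ) < β := by exact_mod_cast hz.1.trans hz.2
  have hz1 : (α : ℝ) < z := by exact_mod_cast hz.1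
  have hz2 : (z : ℝ) < β := by exact_mod_cast hz.2
  have hS : ∀ y, ∫⁻ ω, occ (fun y => if y = z then 1 else 0) (Set.Ioo α β) ω ∂(Q γ y) ≤
      ENNReal.ofReal ((β - α) / (2 * γ)) := by
    intro y
    by_cases hy : y ∈ Set.Icc α β
    · simp_rw [← localTime_exitTime]
      rw [lintegral_localTime_Ioo h0 h1 hy hz]
      apply ENNReal.ofReal_le_ofReal
      rw [div_le_div_iff₀ (by nlinarith) (by positivity)]
      have hy1 : (α : ℝ) ≤ y := by exact_mod_cast hy.1
      have hy2 : (y : ℝ) ≤ β := by exact_mod_cast hy.2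
      -- By the arithmetic-geometric mean inequality the Green function is at most (β - α)/(2γ); p
      -- and q stand for the distances of the pair {y, z} to the two ends.
      have key : ∀ p q : ℝ, 0 ≤ p → 0 ≤ q → p + q ≤ β - α → 4 * (p * q) ≤ (β - α) * (β - α) := by
        intro p q hp hq hpq
        nlinarith [sq_nonneg (p - q)]
      have := key (min y z - α : ℤ) (β - max y z : ℤ) (by
          have : 0 ≤ min y z - α := by have := hy.1; have := hz.1; omega
          exact_mod_cast this) (by
          have : 0 ≤ β - max y z := by have := hy.2; have := hz.2; omega
          exact_mod_cast this) (by
          have : min y z - α + (β - max y z) ≤ β - α := by omega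
          exact_mod_cast this)
      nlinarith [mul_le_mul_of_nonneg_left this h0.le]
    · rw [lintegral_eq_zero_of_start (U := Set.Ioo α β) (fun h => hy ⟨h.1.le, h.2.le⟩)
        fun ω hω => occ_eq_zero _ hω]
      exact zero_le
  simp_rw [localTime_exitTime]
  refine (lintegral_occ_sq_le h0.le h1 _ _ _ hS x).trans ?_
  have : (0 : ℝ) ≤ (β - α) / (2 * γ) := div_nonneg (by linarith) (by linarith)
  rw [ENNReal.ofReal_mul (by norm_num), ENNReal.ofReal_pow this,
    pow_two (ENNReal.ofReal _), ← mul_assoc, ENNReal.ofReal_ofNat]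
  gcongr
  exact hS x

/-- The two means are (h - d)²/γ and (h² - d²)/γ, and (h - d)² + (h² - d²) = 2h(h - d). -/
theorem meanExcursion_eq (h0 : 0 < γ) (h1 : γ ≤ 1) {h d : ℕ} (hd : d ≤ h) :
    meanExcursion γ h d = 2 * h * (h - d) / γ := by
  have hd' : (d : ℝ) ≤ h := by exact_mod_cast hd
  unfold meanExcursion
  rw [lintegral_exitTime_Ioo h0 h1 (by constructor <;> simp <;> omega),
    lintegral_exitTime_Ioo h0 h1 (by constructor <;> simp <;> omega)]
  push_cast
  have n1 : (0 : ℝ) ≤ (0 - (-h + d)) * (h - d - 0) / γ :=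
    div_nonneg (mul_nonneg (by linarith) (by linarith)) h0.le
  have n2 : (0 : ℝ) ≤ (d - -h) * (h - d) / γ :=
    div_nonneg (mul_nonneg (by linarith [(Nat.cast_nonneg h : (0 : ℝ) ≤ h), (Nat.cast_nonneg d : (0 : ℝ) ≤ d)])
      (by linarith)) h0.le
  rw [← ENNReal.ofReal_add n1 n2, ENNReal.toReal_ofReal (by linarith)]
  field_simp
  ring

end

section

/-! ### Geometry of the grid -/

variable {L h d : ℕ} {zs : Fin L → ℤ}

theorem mem_setC_iff {y : ℤ} : y ∈ setC h d zs ↔ ∃ u ∈ grid h zs, y ∈ closedBlock d u := by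
  simp [setC]

theorem mem_setO_iff {y : ℤ} : y ∈ setO h zs ↔ ∃ u ∈ grid h zs, y ∈ openBlock h u := by
  simp [setO]

theorem mem_closedBlock_iff {y u : ℤ} : y ∈ closedBlock d u ↔ u - d ≤ y ∧ y ≤ u + d := Iff.rfl

theorem mem_grid_iff {y : ℤ} : y ∈ grid h zs ↔
    (∃ ℓ, zs ℓ = y) ∨ ((2 * (h : ℤ)) ∣ y ∧ ∀ ℓ, 2 * (h : ℤ) ≤ |y - zs ℓ|) := Iff.rfl

theorem two_mul_le_abs_sub_of_dvd {m x y : ℤ} (hx : m ∣ x) (hy : m ∣ y) (hne : x ≠ y) :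
    m ≤ |x - y| :=
  Int.le_of_dvd (abs_pos.2 (sub_ne_zero.2 hne)) ((dvd_abs _ _).2 (dvd_sub hx hy))

theorem grid_separated (hsep : Separated h zs) {u v : ℤ} (hu : u ∈ grid h zs) (hv : v ∈ grid h zs)
    (hne : u ≠ v) : 2 * (h : ℤ) ≤ |u - v| := by
  rcases mem_grid_iff.1 hu with ⟨ℓ, rfl⟩ | ⟨hu1, hu2⟩ <;>
    rcases mem_grid_iff.1 hv with ⟨ℓ', rfl⟩ | ⟨hv1, hv2⟩
  · have := hsep ℓ ℓ' fun e => hne (by rw [e])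
    linarith [(Nat.cast_nonneg h : (0 : ℤ) ≤ h)]
  · rw [abs_sub_comm]
    exact hv2 ℓ
  · exact hu2 ℓ'
  · exact two_mul_le_abs_sub_of_dvd hu1 hv1 hne

/-- Take the last multiple p of 2h before x. If p was removed from the grid, a special point lies
within 2h of it. Either that point is at most x and serves, or it lies to the right of x ≥ p, and
then p - 2h is far enough from it and from all the other special points. -/
theorem exists_grid_le (hh : 0 < h) (hsep : Separated h zs) (x : ℤ) :
    ∃ u ∈ grid h zs, x - 4 * h < u ∧ u ≤ x := by
  obtain ⟨p, hp, hp1, hp2⟩ : ∃ p : ℤ, 2 * (h : ℤ) ∣ p ∧ x - 2 * h < p ∧ p ≤ x := by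
    have h1 := Int.emod_nonneg x (b := 2 * (h : ℤ)) (by omega)
    have h2 := Int.emod_lt_of_pos x (b := 2 * (h : ℤ)) (by omega)
    have h3 := Int.mul_ediv_add_emod x (2 * (h : ℤ))
    exact ⟨2 * h * (x / (2 * h)), dvd_mul_right _ _, by linarith, by linarith⟩
  by_cases hg : p ∈ grid h zs
  · exact ⟨p, hg, by omega, hp2⟩
  · have : ∃ ℓ, |p - zs ℓ| < 2 * (h : ℤ) := by
      by_contra! hc
      exact hg (mem_grid_iff.2 (Or.inr ⟨hp, hc⟩))
    obtain ⟨ℓ, hℓ⟩ := this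
    rw [abs_lt] at hℓ
    by_cases hz : zs ℓ ≤ x
    · exact ⟨zs ℓ, mem_grid_iff.2 (Or.inl ⟨ℓ, rfl⟩), by omega, hz⟩
    · refine ⟨p - 2 * h, mem_grid_iff.2 (Or.inr ⟨dvd_sub hp dvd_rfl, fun ℓ' => ?_⟩), by omega,
        by omega⟩
      by_cases he : ℓ = ℓ'
      · subst he
        rw [le_abs]
        right
        omega
      · have := hsep ℓ ℓ' he
        rw [le_abs] at this ⊢
        omega

theorem exists_grid_ge (hh : 0 < h) (hsep : Separated h zs) (x : ℤ) :
    ∃ u ∈ grid h zs, x ≤ u ∧ u < x + 4 * h := by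
  have hsep' : Separated h fun ℓ => -zs ℓ := fun ℓ ℓ' hne => by
    have := hsep ℓ ℓ' hne
    rwa [show -zs ℓ - -zs ℓ' = -(zs ℓ - zs ℓ') by ring, abs_neg]
  obtain ⟨u, hu, h1, h2⟩ := exists_grid_le hh hsep' (-x)
  refine ⟨-u, ?_, by omega, by omega⟩
  rcases mem_grid_iff.1 hu with ⟨ℓ, hℓ⟩ | ⟨hu1, hu2⟩
  · exact mem_grid_iff.2 (Or.inl ⟨ℓ, by omega⟩)
  · refine mem_grid_iff.2 (Or.inr ⟨(dvd_neg).2 hu1, fun ℓ => ?_⟩)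
    have := hu2 ℓ
    rwa [show u - -zs ℓ = -(-u - zs ℓ) by ring, abs_neg] at this

/-- `u < v` are consecutive points of the grid. -/
def Consecutive {L : ℕ} (h : ℕ) (zs : Fin L → ℤ) (u v : ℤ) : Prop :=
  u ∈ grid h zs ∧ v ∈ grid h zs ∧ u < v ∧ ∀ w ∈ grid h zs, w ≤ u ∨ v ≤ w

theorem exists_consecutive (hh : 0 < h) (hsep : Separated h zs) (x : ℤ) :
    ∃ u v, Consecutive h zs u v ∧ u ≤ x ∧ x < v := by
  obtain ⟨u₀, hu₀, h1, h2⟩ := exists_grid_le hh hsep x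
  obtain ⟨v₀, hv₀, h3, h4⟩ := exists_grid_ge hh hsep (x + 1)
  obtain ⟨u, ⟨hu, hux⟩, humax⟩ := Int.exists_greatest_of_bdd (P := fun u => u ∈ grid h zs ∧ u ≤ x)
    ⟨x, fun z hz => hz.2⟩ ⟨u₀, hu₀, h2⟩
  obtain ⟨v, ⟨hv, hvx⟩, hvmin⟩ := Int.exists_least_of_bdd
    (P := fun v => v ∈ grid h zs ∧ x + 1 ≤ v) ⟨x + 1, fun z hz => hz.2⟩ ⟨v₀, hv₀, h3⟩
  refine ⟨u, v, ⟨hu, hv, by omega, fun w hw => ?_⟩, hux, by omega⟩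
  by_cases hwx : w ≤ x
  · exact Or.inl (humax w ⟨hw, hwx⟩)
  · exact Or.inr (hvmin w ⟨hw, by omega⟩)

namespace Consecutive

variable {u v : ℤ}

theorem two_mul_le (hc : Consecutive h zs u v) (hsep : Separated h zs) : u + 2 * h ≤ v := by
  have := grid_separated hsep hc.1 hc.2.1 hc.2.2.1.ne
  have := hc.2.2.1
  rw [abs_of_neg (by omega)] at *
  omega

theorem le_four_mul (hc : Consecutive h zs u v) (hh : 0 < h) (hsep : Separated h zs) :
    v ≤ u + 4 * h := by
  obtain ⟨w, hw, h1, h2⟩ := exists_grid_le hh hsep (v - 1)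
  have := hc.2.2.2 w hw
  omega

/-- If neither end is special, both are multiples of 2h, so a gap other than 2h has length at least
4h. The multiple u + 2h was then removed by a special point less than 2h away, which would lie
strictly between u and v. Irregular gaps thus occur only next to special points, which confines the
bias of the excursion durations. -/
theorem eq_or_star (hc : Consecutive h zs u v) (hh : 0 < h) (hsep : Separated h zs) :
    v = u + 2 * h ∨ ∃ ℓ, zs ℓ = u ∨ zs ℓ = v := by
  by_contra! hcon
  obtain ⟨h1, h2⟩ := hcon
  have hu := (mem_grid_iff.1 hc.1).resolve_left fun ⟨ℓ, hℓ⟩ => (h2 ℓ).1 hℓ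
  have hv := (mem_grid_iff.1 hc.2.1).resolve_left fun ⟨ℓ, hℓ⟩ => (h2 ℓ).2 hℓ
  have h3 := hc.two_mul_le hsep
  have h4 : 2 * (h : ℤ) ≤ |v - (u + 2 * h)| :=
    two_mul_le_abs_sub_of_dvd hv.1 (dvd_add hu.1 dvd_rfl) h1
  rw [abs_of_nonneg (by omega)] at h4
  have h5 : u + 2 * h ∉ grid h zs := fun hg => by
    have := hc.2.2.2 _ hg
    omega
  have : ∃ ℓ, |u + 2 * h - zs ℓ| < 2 * (h : ℤ) := by
    by_contra! hcc
    exact h5 (mem_grid_iff.2 (Or.inr ⟨dvd_add hu.1 dvd_rfl, hcc⟩))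
  obtain ⟨ℓ, hℓ⟩ := this
  rw [abs_lt] at hℓ
  have := hc.2.2.2 (zs ℓ) (mem_grid_iff.2 (Or.inl ⟨ℓ, rfl⟩))
  omega

theorem left_mem_setC (hc : Consecutive h zs u v) : u + d ∈ setC h d zs :=
  mem_setC_iff.2 ⟨u, hc.1, mem_closedBlock_iff.2 ⟨by omega, le_rfl⟩⟩

theorem right_mem_setC (hc : Consecutive h zs u v) : v - d ∈ setC h d zs :=
  mem_setC_iff.2 ⟨v, hc.2.1, mem_closedBlock_iff.2 ⟨le_rfl, by omega⟩⟩

theorem Ioo_subset_compl_setC (hc : Consecutive h zs u v) :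
    Set.Ioo (u + d) (v - d) ⊆ (setC h d zs)ᶜ := by
  rintro y ⟨hy1, hy2⟩ hy
  obtain ⟨w, hw, hwy⟩ := mem_setC_iff.1 hy
  rw [mem_closedBlock_iff] at hwy
  have := hc.2.2.2 w hw
  omega

end Consecutive

theorem exists_Ioo_of_notMem_setC (hh : 0 < h) (hsep : Separated h zs) {x : ℤ}
    (hx : x ∉ setC h d zs) :
    ∃ u v, Consecutive h zs u v ∧ x ∈ Set.Ioo (u + (d : ℤ)) (v - d) := by
  obtain ⟨u, v, hc, h1, h2⟩ := exists_consecutive hh hsep x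
  refine ⟨u, v, hc, ?_, ?_⟩
  · by_contra hcon
    exact hx (mem_setC_iff.2 ⟨u, hc.1, mem_closedBlock_iff.2 ⟨by omega, by omega⟩⟩)
  · by_contra hcon
    exact hx (mem_setC_iff.2 ⟨v, hc.2.1, mem_closedBlock_iff.2 ⟨by omega, by omega⟩⟩)

theorem Ioo_subset_setO {u : ℤ} (hu : u ∈ grid h zs) : Set.Ioo (u - h) (u + h) ⊆ setO h zs :=
  fun _ hy => mem_setO_iff.2 ⟨u, hu, hy⟩

theorem add_notMem_setO (hsep : Separated h zs) {u : ℤ} (hu : u ∈ grid h zs) :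
    u + h ∉ setO h zs := by
  intro hy
  obtain ⟨v, hv, h1, h2⟩ := mem_setO_iff.1 hy
  by_cases he : u = v
  · omega
  · have := grid_separated hsep hu hv he
    rw [le_abs] at this
    omega

theorem sub_notMem_setO (hsep : Separated h zs) {u : ℤ} (hu : u ∈ grid h zs) :
    u - h ∉ setO h zs := by
  intro hy
  obtain ⟨v, hv, h1, h2⟩ := mem_setO_iff.1 hy
  by_cases he : u = v
  · omega
  · have := grid_separated hsep hu hv he
    rw [le_abs] at this
    omega

/-- The points at distance `h` from the grid: the possible values of the walk at the departure
times. -/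
def departureSet {L : ℕ} (h : ℕ) (zs : Fin L → ℤ) : Set ℤ :=
  {x | ∃ u ∈ grid h zs, x = u - h ∨ x = u + h}

theorem exists_consecutive_of_mem_departureSet (hh : 0 < h) (hsep : Separated h zs) {x : ℤ}
    (hx : x ∈ departureSet h zs) :
    ∃ u v, Consecutive h zs u v ∧ u + h ≤ x ∧ x ≤ v - h := by
  obtain ⟨u, v, hc, h1, h2⟩ := exists_consecutive hh hsep x
  refine ⟨u, v, hc, ?_⟩
  obtain ⟨w, hw, hwx⟩ := hx
  have h3 := hc.2.2.2 w hw
  have h4 := hc.two_mul_le hsep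
  rcases hwx with rfl | rfl
  · by_cases he : w = v
    · omega
    · have := grid_separated hsep hw hc.2.1 he
      rw [le_abs] at this
      omega
  · by_cases he : w = u
    · omega
    · have := grid_separated hsep hw hc.1 he
      rw [le_abs] at this
      omega

end

section

variable {γ : ℝ}

/-! ### Additive functionals along successive shifts by a stopping time -/

/-- The shift by a random time. -/
def shiftBy (τ : (ℕ → ℤ) → ℕ∞) (ω : ℕ → ℤ) : ℕ → ℤ := shift (τ ω).toNat ω

/-- The sum of `F` along the first `k` iterated shifts by `τ`. -/
def iterSum {M : Type*} [AddCommMonoid M] (τ : (ℕ → ℤ) → ℕ∞) (F : (ℕ → ℤ) → M) (k : ℕ)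
    (ω : ℕ → ℤ) : M :=
  ∑ j ∈ Finset.range k, F ((shiftBy τ)^[j] ω)

variable {τ : (ℕ → ℤ) → ℕ∞}

theorem iterSum_succ {M : Type*} [AddCommMonoid M] (F : (ℕ → ℤ) → M) (k : ℕ) (ω : ℕ → ℤ) :
    iterSum τ F (k + 1) ω = F ω + iterSum τ F k (shiftBy τ ω) := by
  simp [iterSum, Finset.sum_range_succ', add_comm]

theorem shiftBy_zero_apply (ω : ℕ → ℤ) : shiftBy τ ω 0 = ω (τ ω).toNat := rfl

theorem measurable_shiftBy (hτ : Measurable τ) : Measurable (shiftBy τ) :=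
  measurable_shift_of (Measurable.of_discrete.comp hτ)

theorem measurable_shiftBy_iterate (hτ : Measurable τ) (j : ℕ) : Measurable ((shiftBy τ)^[j]) :=
  (measurable_shiftBy hτ).iterate j

theorem measurable_comp_iterate {M : Type*} [MeasurableSpace M] (hτ : Measurable τ)
    {F : (ℕ → ℤ) → M} (hF : Measurable F) (j : ℕ) : Measurable fun ω => F ((shiftBy τ)^[j] ω) :=
  hF.comp (measurable_shiftBy_iterate hτ j)

theorem measurable_iterSum {M : Type*} [AddCommMonoid M] [MeasurableSpace M] [MeasurableAdd₂ M]
    (hτ : Measurable τ) {F : (ℕ → ℤ) → M} (hF : Measurable F) (k : ℕ) :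
    Measurable (iterSum τ F k) :=
  Finset.measurable_sum _ fun j _ => measurable_comp_iterate hτ hF j

/-- `τ` is a measurable stopping time, finite almost surely under every `Q^γ_x`. -/
structure GoodTime (γ : ℝ) (τ : (ℕ → ℤ) → ℕ∞) : Prop where
  measurable : Measurable τ
  localAt : LocalAt τ fun _ => ()
  ae_ne_top : ∀ x, ∀ᵐ ω ∂(Q γ x), τ ω ≠ ⊤

theorem lintegral_shiftBy (h0 : 0 ≤ γ) (h1 : γ ≤ 1) (hτ : GoodTime γ τ) (x : ℤ)
    {F : (ℕ → ℤ) → ℝ≥0∞} (hF : Measurable F) :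
    ∫⁻ ω, F (shiftBy τ ω) ∂(Q γ x) = ∫⁻ ω, ∫⁻ ω', F ω' ∂(Q γ (shiftBy τ ω 0)) ∂(Q γ x) :=
  lintegral_shift_stopping h0 h1 x hτ.measurable (hτ.ae_ne_top x) (Φ := fun _ ω' => F ω')
    (hF.comp measurable_snd) fun ω₁ ω₂ n h2 h3 => ⟨(hτ.localAt ω₁ ω₂ n h2 h3).1, rfl⟩

theorem measurable_lintegral_shiftBy (hτ : Measurable τ) (F : ℤ → ℝ≥0∞) (j : ℕ) :
    Measurable fun ω => F ((shiftBy τ)^[j] ω 0) :=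
  Measurable.of_discrete.comp ((measurable_pi_apply 0).comp (measurable_shiftBy_iterate hτ j))

theorem lintegral_shiftBy_iterate (h0 : 0 ≤ γ) (h1 : γ ≤ 1) (hτ : GoodTime γ τ) (j : ℕ) (x : ℤ)
    {F : (ℕ → ℤ) → ℝ≥0∞} (hF : Measurable F) :
    ∫⁻ ω, F ((shiftBy τ)^[j] ω) ∂(Q γ x) =
      ∫⁻ ω, ∫⁻ ω', F ω' ∂(Q γ ((shiftBy τ)^[j] ω 0)) ∂(Q γ x) := by
  induction j generalizing x with
  | zero =>
    have := isProbabilityMeasure_Q h0 h1 x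
    rw [lintegral_congr_ae (g := fun _ => ∫⁻ ω', F ω' ∂(Q γ x))
      (f := fun ω => ∫⁻ ω', F ω' ∂(Q γ ((shiftBy τ)^[0] ω 0)))]
    · simp
    · filter_upwards [ae_start γ x] with ω hω
      simp [hω]
  | succ j ih =>
    simp only [Function.iterate_succ_apply]
    rw [lintegral_shiftBy h0 h1 hτ x (measurable_comp_iterate hτ.measurable hF j),
      lintegral_shiftBy h0 h1 hτ x (F := fun ω => ∫⁻ ω', F ω' ∂(Q γ ((shiftBy τ)^[j] ω 0)))
      (measurable_lintegral_shiftBy hτ.measurable (fun y => ∫⁻ ω', F ω' ∂(Q γ y)) j)]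
    exact lintegral_congr fun ω => ih _

/-- Each summand can be exchanged for its mean given the start of its excursion. Bounds on one
excursion, expressed through its visit probability, thereby pass to sums and turn into bounds by
expected numbers of visits. -/
theorem lintegral_iterSum (h0 : 0 ≤ γ) (h1 : γ ≤ 1) (hτ : GoodTime γ τ) (k : ℕ) (x : ℤ)
    {F : (ℕ → ℤ) → ℝ≥0∞} (hF : Measurable F) :
    ∫⁻ ω, iterSum τ F k ω ∂(Q γ x) =
      ∫⁻ ω, iterSum τ (fun ω => ∫⁻ ω', F ω' ∂(Q γ (ω 0))) k ω ∂(Q γ x) := by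
  unfold iterSum
  rw [lintegral_finsetSum _ fun j _ => measurable_comp_iterate hτ.measurable hF j,
    lintegral_finsetSum _ fun j _ =>
      measurable_lintegral_shiftBy hτ.measurable (fun y => ∫⁻ ω', F ω' ∂(Q γ y)) j]
  exact Finset.sum_congr rfl fun j _ => lintegral_shiftBy_iterate h0 h1 hτ j x hF

theorem lintegral_iterSum_succ (h0 : 0 ≤ γ) (h1 : γ ≤ 1) (hτ : GoodTime γ τ) (k : ℕ) (x : ℤ)
    {F : (ℕ → ℤ) → ℝ≥0∞} (hF : Measurable F) :
    ∫⁻ ω, iterSum τ F (k + 1) ω ∂(Q γ x) = ∫⁻ ω, F ω ∂(Q γ x) +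
      ∫⁻ ω, ∫⁻ ω', iterSum τ F k ω' ∂(Q γ (shiftBy τ ω 0)) ∂(Q γ x) := by
  simp_rw [iterSum_succ]
  rw [lintegral_add_left hF,
    lintegral_shiftBy h0 h1 hτ x (measurable_iterSum hτ.measurable hF k)]

theorem ae_forall_shiftBy_iterate (h0 : 0 ≤ γ) (h1 : γ ≤ 1) (hτ : GoodTime γ τ)
    {P : (ℕ → ℤ) → Prop} (hP : MeasurableSet {ω | P ω}) (h : ∀ x, ∀ᵐ ω ∂(Q γ x), P ω) (x : ℤ) :
    ∀ᵐ ω ∂(Q γ x), ∀ j, P ((shiftBy τ)^[j] ω) := by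
  rw [ae_all_iff]
  intro j
  have hm : Measurable ({ω | P ω}ᶜ.indicator (fun _ => (1 : ℝ≥0∞))) :=
    measurable_const.indicator hP.compl
  have key := lintegral_shiftBy_iterate h0 h1 hτ j x hm
  have e : ∀ y, ∫⁻ ω', {ω | P ω}ᶜ.indicator (fun _ => (1 : ℝ≥0∞)) ω' ∂(Q γ y) = 0 := by
    intro y
    rw [lintegral_indicator hP.compl]
    simp only [lintegral_const, one_mul, Measure.restrict_apply_univ]
    exact ae_iff.1 (h y)
  simp only [e, lintegral_zero] at key
  rw [lintegral_eq_zero_iff (measurable_comp_iterate hτ.measurable hm j)] at key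
  filter_upwards [key] with ω hω
  by_contra hc
  simp [hc] at hω

/-- Orthogonality of the increments of a centred additive functional. -/
theorem lintegral_sq_iterSum (h0 : 0 ≤ γ) (h1 : γ ≤ 1) (hτ : GoodTime γ τ)
    {ψ : (ℕ → ℤ) → ℝ} (hm : Measurable ψ) (hloc : LocalAt τ ψ)
    (hψ : ∀ (y : ℤ) (c : ℝ), ∫⁻ ω, ENNReal.ofReal ((c + ψ ω) ^ 2) ∂(Q γ y) =
      ENNReal.ofReal (c ^ 2) + ∫⁻ ω, ENNReal.ofReal (ψ ω ^ 2) ∂(Q γ y)) (k : ℕ) (x : ℤ) (c : ℝ) :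
    ∫⁻ ω, ENNReal.ofReal ((c + iterSum τ ψ k ω) ^ 2) ∂(Q γ x) =
      ENNReal.ofReal (c ^ 2) +
        ∫⁻ ω, iterSum τ (fun ω => ENNReal.ofReal (ψ ω ^ 2)) k ω ∂(Q γ x) := by
  have := isProbabilityMeasure_Q h0 h1
  induction k generalizing x c with
  | zero => simp [iterSum]
  | succ k ih =>
    have hm2 : Measurable fun ω => ENNReal.ofReal (ψ ω ^ 2) := by fun_prop
    have hS := measurable_iterSum hτ.measurable hm k
    rw [lintegral_iterSum_succ h0 h1 hτ k x hm2]
    simp_rw [iterSum_succ]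
    -- At time τ the value c + ψ is frozen and plays the role of the constant for the remaining k
    -- terms, hence the induction over arbitrary c. The hypothesis `hψ` expresses that the cross
    -- term 2c E[ψ] vanishes.
    have e := lintegral_shift_stopping h0 h1 x hτ.measurable (hτ.ae_ne_top x)
      (Φ := fun ω ω' => ENNReal.ofReal ((c + (ψ ω + iterSum τ ψ k ω')) ^ 2))
      (by unfold Function.uncurry; fun_prop)
      (fun ω₁ ω₂ n h2 h3 => ⟨(hloc ω₁ ω₂ n h2 h3).1, by
        simp only [(hloc ω₁ ω₂ n h2 h3).2]⟩)
    refine e.trans ?_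
    simp_rw [← add_assoc, ih]
    rw [lintegral_add_left (by fun_prop), hψ x c]
    rfl

/-- Subtracting the mean makes an additive functional centred. -/
theorem centred_sub_mean (h0 : 0 ≤ γ) (h1 : γ ≤ 1) {φ : (ℕ → ℤ) → ℝ} (hm : Measurable φ)
    (hfin : ∀ y, ∫⁻ ω, ENNReal.ofReal (φ ω ^ 2) ∂(Q γ y) ≠ ⊤) (y : ℤ) (c : ℝ) :
    ∫⁻ ω, ENNReal.ofReal ((c + (φ ω - ∫ ω', φ ω' ∂(Q γ (ω 0)))) ^ 2) ∂(Q γ y) =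
      ENNReal.ofReal (c ^ 2) +
        ∫⁻ ω, ENNReal.ofReal ((φ ω - ∫ ω', φ ω' ∂(Q γ (ω 0))) ^ 2) ∂(Q γ y) ∧
    ∫⁻ ω, ENNReal.ofReal ((φ ω - ∫ ω', φ ω' ∂(Q γ (ω 0))) ^ 2) ∂(Q γ y) ≤
      ∫⁻ ω, ENNReal.ofReal (φ ω ^ 2) ∂(Q γ y) := by
  have := isProbabilityMeasure_Q h0 h1 y
  set b := ∫ ω', φ ω' ∂(Q γ y) with hb
  have hsq : Integrable (fun ω => φ ω ^ 2) (Q γ y) := by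
    refine ⟨(hm.pow_const 2).aestronglyMeasurable, ?_⟩
    rw [hasFiniteIntegral_iff_ofReal (Eventually.of_forall fun ω => sq_nonneg _)]
    exact (hfin y).lt_top
  have hint : Integrable φ (Q γ y) :=
    ((memLp_two_iff_integrable_sq hm.aestronglyMeasurable).2 hsq).integrable (by norm_num)
  have key : ∀ c : ℝ, ∫⁻ ω, ENNReal.ofReal ((c + (φ ω - ∫ ω', φ ω' ∂(Q γ (ω 0)))) ^ 2) ∂(Q γ y) =
      ENNReal.ofReal (c ^ 2 + (∫ ω, φ ω ^ 2 ∂(Q γ y) - b ^ 2)) := by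
    intro c
    have e1 : ∫⁻ ω, ENNReal.ofReal ((c + (φ ω - ∫ ω', φ ω' ∂(Q γ (ω 0)))) ^ 2) ∂(Q γ y) =
        ∫⁻ ω, ENNReal.ofReal ((c - b) ^ 2 + 2 * (c - b) * φ ω + φ ω ^ 2) ∂(Q γ y) := by
      refine lintegral_congr_ae ?_
      filter_upwards [ae_start γ y] with ω hω
      rw [hω]
      congr 1
      ring
    have i1 : Integrable (fun ω => (c - b) ^ 2 + 2 * (c - b) * φ ω) (Q γ y) :=
      (integrable_const _).add (hint.const_mul _)
    have i2 : Integrable (fun ω => (c - b) ^ 2 + 2 * (c - b) * φ ω + φ ω ^ 2) (Q γ y) :=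
      i1.add hsq
    rw [e1, ← ofReal_integral_eq_lintegral_ofReal i2
      (Eventually.of_forall fun ω => by
        have : (c - b) ^ 2 + 2 * (c - b) * φ ω + φ ω ^ 2 = (c - b + φ ω) ^ 2 := by ring
        simp only [Pi.zero_apply, this]
        positivity)]
    rw [integral_add i1 hsq, integral_add (integrable_const _) (hint.const_mul _),
      integral_const_mul, ← hb]
    simp only [integral_const, probReal_univ, one_smul]
    congr 1
    ring
  have hz := key 0
  simp only [zero_add, ne_eq, OfNat.ofNat_ne_zero, not_false_eq_true, zero_pow] at hz
  have hnn : 0 ≤ ∫ ω, φ ω ^ 2 ∂(Q γ y) - b ^ 2 := by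
    have h2 : 0 ≤ ∫ ω, (φ ω - b) ^ 2 ∂(Q γ y) := integral_nonneg fun ω => sq_nonneg _
    have e : ∀ ω, (φ ω - b) ^ 2 = φ ω ^ 2 - (2 * b * φ ω - b ^ 2) := fun ω => by ring
    simp_rw [e] at h2
    have i1 : Integrable (fun ω => 2 * b * φ ω - b ^ 2) (Q γ y) :=
      (hint.const_mul _).sub (integrable_const _)
    rw [integral_sub hsq i1,
      integral_sub (hint.const_mul _) (integrable_const _), integral_const_mul, ← hb] at h2
    simp only [integral_const, probReal_univ, one_smul] at h2
    linarith
  refine ⟨?_, ?_⟩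
  · rw [key c, hz, ENNReal.ofReal_add (sq_nonneg c) hnn]
  · rw [hz, ← ofReal_integral_eq_lintegral_ofReal hsq (Eventually.of_forall fun ω => sq_nonneg _)]
    exact ENNReal.ofReal_le_ofReal (by nlinarith [sq_nonneg b])

theorem lintegral_le_sqrt {Ω : Type*} [MeasurableSpace Ω] (μ : Measure Ω) [IsProbabilityMeasure μ]
    {f : Ω → ℝ≥0∞} (hf : Measurable f) :
    ∫⁻ ω, f ω ∂μ ≤ (∫⁻ ω, f ω ^ 2 ∂μ) ^ (1 / 2 : ℝ) := by
  have := ENNReal.lintegral_mul_le_Lp_mul_Lq μ (Real.HolderConjugate.two_two) hf.aemeasurable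
    (aemeasurable_const (b := (1 : ℝ≥0∞)))
  simpa using this

/-- The first moment bound for additive functionals. -/
theorem lintegral_abs_iterSum_le (h0 : 0 ≤ γ) (h1 : γ ≤ 1) (hτ : GoodTime γ τ)
    {φ : (ℕ → ℤ) → ℝ} (hm : Measurable φ) (hloc : LocalAt τ φ)
    (hfin : ∀ y, ∫⁻ ω, ENNReal.ofReal (φ ω ^ 2) ∂(Q γ y) ≠ ⊤) (k : ℕ) (x : ℤ) :
    ∫⁻ ω, ENNReal.ofReal |iterSum τ φ k ω| ∂(Q γ x) ≤
      (∫⁻ ω, iterSum τ (fun ω => ∫⁻ ω', ENNReal.ofReal (φ ω' ^ 2) ∂(Q γ (ω 0))) k ω ∂(Q γ x)) ^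
          (1 / 2 : ℝ) +
        ∫⁻ ω, iterSum τ (fun ω => ENNReal.ofReal |∫ ω', φ ω' ∂(Q γ (ω 0))|) k ω ∂(Q γ x) := by
  have := isProbabilityMeasure_Q h0 h1 x
  have hmean : Measurable fun ω : ℕ → ℤ => ∫ ω', φ ω' ∂(Q γ (ω 0)) :=
    (Measurable.of_discrete (f := fun y => ∫ ω', φ ω' ∂(Q γ y))).comp (measurable_pi_apply 0)
  -- Doob decomposition: ψ is centred under every starting law and gives the square-root term by
  -- orthogonality; the subtracted means give the second term by the triangle inequality.
  set ψ : (ℕ → ℤ) → ℝ := fun ω => φ ω - ∫ ω', φ ω' ∂(Q γ (ω 0))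
  have hψm : Measurable ψ := hm.sub hmean
  have hψloc : LocalAt τ ψ := fun ω₁ ω₂ n h2 h3 => by
    refine ⟨(hloc ω₁ ω₂ n h2 h3).1, ?_⟩
    simp only [ψ]
    rw [(hloc ω₁ ω₂ n h2 h3).2, h3 0 (Nat.zero_le n)]
  have hcen := centred_sub_mean h0 h1 hm hfin
  have hSm := measurable_iterSum hτ.measurable hψm k
  have hsq : ∫⁻ ω, ENNReal.ofReal (iterSum τ ψ k ω ^ 2) ∂(Q γ x) ≤
      ∫⁻ ω, iterSum τ (fun ω => ∫⁻ ω', ENNReal.ofReal (φ ω' ^ 2) ∂(Q γ (ω 0))) k ω ∂(Q γ x) := by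
    have e := lintegral_sq_iterSum h0 h1 hτ hψm hψloc (fun y c => (hcen y c).1) k x 0
    simp only [zero_add, ne_eq, OfNat.ofNat_ne_zero, not_false_eq_true, zero_pow,
      ENNReal.ofReal_zero] at e
    rw [e, lintegral_iterSum h0 h1 hτ k x (by fun_prop)]
    exact lintegral_mono fun ω => Finset.sum_le_sum fun j _ => (hcen _ 0).2
  have habs : ∀ ω, ENNReal.ofReal |iterSum τ φ k ω| ≤ ENNReal.ofReal |iterSum τ ψ k ω| +
      iterSum τ (fun ω => ENNReal.ofReal |∫ ω', φ ω' ∂(Q γ (ω 0))|) k ω := by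
    intro ω
    have e1 : iterSum τ φ k ω = iterSum τ ψ k ω +
        iterSum τ (fun ω => ∫ ω', φ ω' ∂(Q γ (ω 0))) k ω := by
      simp only [iterSum, ψ, ← Finset.sum_add_distrib, sub_add_cancel]
    have e2 : iterSum τ (fun ω => ENNReal.ofReal |∫ ω', φ ω' ∂(Q γ (ω 0))|) k ω =
        ENNReal.ofReal (iterSum τ (fun ω => |∫ ω', φ ω' ∂(Q γ (ω 0))|) k ω) := by
      simp only [iterSum]
      rw [ENNReal.ofReal_sum_of_nonneg fun j _ => abs_nonneg _]
    have hn : 0 ≤ iterSum τ (fun ω => |∫ ω', φ ω' ∂(Q γ (ω 0))|) k ω :=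
      Finset.sum_nonneg fun j _ => abs_nonneg _
    rw [e2, ← ENNReal.ofReal_add (abs_nonneg _) hn, e1]
    refine ENNReal.ofReal_le_ofReal ((abs_add_le _ _).trans ?_)
    gcongr
    exact Finset.abs_sum_le_sum_abs _ _
  refine (lintegral_mono habs).trans ?_
  rw [lintegral_add_left (by fun_prop)]
  gcongr
  refine (lintegral_le_sqrt (Q γ x) (by fun_prop)).trans ?_
  refine ENNReal.rpow_le_rpow (le_of_eq_of_le (lintegral_congr fun ω => ?_) hsq) (by norm_num)
  rw [← ENNReal.ofReal_pow (abs_nonneg _), sq_abs]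

end

section

variable {γ : ℝ} {L h d : ℕ} {zs : Fin L → ℤ}

/-! ### A single excursion: pathwise facts -/

/-- The hitting time of `C`. -/
def hitTime {L : ℕ} (h d : ℕ) (zs : Fin L → ℤ) : (ℕ → ℤ) → ℕ∞ := entranceTime (setC h d zs)

/-- The position at the hitting time of `C`. -/
def hitPos {L : ℕ} (h d : ℕ) (zs : Fin L → ℤ) (ω : ℕ → ℤ) : ℤ := ω (hitTime h d zs ω).toNat

/-- The duration of an excursion: hit `C`, then leave `O`. -/
def excTime {L : ℕ} (h d : ℕ) (zs : Fin L → ℤ) : (ℕ → ℤ) → ℕ∞ :=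
  afterTime (hitTime h d zs) (exitTime (setO h zs))

theorem hitTime_eq : hitTime h d zs = exitTime (setC h d zs)ᶜ := entranceTime_eq_exitTime _

theorem hitPos_eq : hitPos h d zs = exitPos (setC h d zs)ᶜ := by
  funext ω
  simp [hitPos, exitPos, hitTime_eq]

theorem excTime_apply (ω : ℕ → ℤ) : excTime h d zs ω =
    hitTime h d zs ω + exitTime (setO h zs) (shiftBy (hitTime h d zs) ω) := rfl

theorem measurable_hitTime : Measurable (hitTime h d zs) := by
  rw [hitTime_eq]
  exact measurable_exitTime _

theorem measurable_hitPos : Measurable (hitPos h d zs) :=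
  measurable_apply_toNat measurable_hitTime

theorem measurable_excTime : Measurable (excTime h d zs) :=
  (Measurable.of_discrete (f := fun p : ℕ∞ × ℕ∞ => p.1 + p.2)).comp
    (measurable_hitTime.prodMk
      ((measurable_exitTime _).comp (measurable_shiftBy measurable_hitTime)))

theorem localAt_exitTime (U : Set ℤ) : LocalAt (exitTime U) fun _ => () := by
  intro ω₁ ω₂ n h1 h2
  rw [exitTime_eq_iff] at h1 ⊢
  refine ⟨⟨by rw [← h2 n le_rfl]; exact h1.1, fun i hi => ?_⟩, rfl⟩
  rw [← h2 i hi.le]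
  exact h1.2 i hi

theorem excTime_local {ω₁ ω₂ : ℕ → ℤ} {n : ℕ} (hn : excTime h d zs ω₁ = n)
    (hω : ∀ i ≤ n, ω₁ i = ω₂ i) :
    excTime h d zs ω₂ = n ∧ ∃ m ≤ n, hitTime h d zs ω₁ = m ∧ hitTime h d zs ω₂ = m := by
  rw [excTime_apply] at hn
  have hs : hitTime h d zs ω₁ ≠ ⊤ := fun ht => by simp [ht] at hn
  obtain ⟨m, hm⟩ := ENat.ne_top_iff_exists.1 hs
  have ht : exitTime (setO h zs) (shiftBy (hitTime h d zs) ω₁) ≠ ⊤ := fun ht => by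
    simp [ht] at hn
  obtain ⟨k, hk⟩ := ENat.ne_top_iff_exists.1 ht
  have hmk : m + k = n := by
    rw [← hm, ← hk] at hn
    exact_mod_cast hn
  have hm2 : hitTime h d zs ω₂ = m := by
    rw [hitTime_eq] at hm ⊢
    exact (localAt_exitTime _ ω₁ ω₂ m hm.symm fun i hi => hω i (by omega)).1
  have hk2 : exitTime (setO h zs) (shiftBy (hitTime h d zs) ω₂) = k := by
    refine (localAt_exitTime _ _ _ k hk.symm fun i hi => ?_).1
    simp only [shiftBy, ← hm, hm2, shift, ENat.toNat_natCast]
    exact hω _ (by omega)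
  refine ⟨?_, m, by omega, hm.symm, hm2⟩
  rw [excTime_apply, hm2, hk2]
  exact_mod_cast hmk

theorem localAt_excTime : LocalAt (excTime h d zs) (excTime h d zs) := fun _ _ _ h1 h2 =>
  ⟨(excTime_local h1 h2).1, h1.trans (excTime_local h1 h2).1.symm⟩

theorem localAt_hitPos : LocalAt (excTime h d zs) (hitPos h d zs) := fun ω₁ ω₂ n h1 h2 => by
  obtain ⟨h3, m, hmn, hm1, hm2⟩ := excTime_local h1 h2
  refine ⟨h3, ?_⟩
  simp only [hitPos, hm1, hm2, ENat.toNat_natCast]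
  exact h2 m hmn

theorem localAt_shiftBy_zero :
    LocalAt (excTime h d zs) (fun ω => shiftBy (excTime h d zs) ω 0) := fun ω₁ ω₂ n h1 h2 => by
  obtain ⟨h3, -⟩ := excTime_local h1 h2
  refine ⟨h3, ?_⟩
  simp only [shiftBy_zero_apply, h1, h3, ENat.toNat_natCast]
  exact h2 n le_rfl

theorem localTime_congr {z : ℤ} {n : ℕ} {ω₁ ω₂ : ℕ → ℤ} (hω : ∀ i < n, ω₁ i = ω₂ i) :
    localTime z n ω₁ = localTime z n ω₂ := by
  unfold localTime
  congr 1
  funext m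
  by_cases hm : m < n
  · rw [hω m hm]
  · simp [hm]

theorem localAt_localTime (z : ℤ) :
    LocalAt (excTime h d zs) (fun ω => localTime z (excTime h d zs ω) ω) := fun ω₁ ω₂ n h1 h2 => by
  obtain ⟨h3, -⟩ := excTime_local h1 h2
  refine ⟨h3, ?_⟩
  simp only [h1, h3]
  exact localTime_congr fun i hi => h2 i hi.le

theorem LocalAt.comp {A B : Type*} {τ : (ℕ → ℤ) → ℕ∞} {ψ : (ℕ → ℤ) → A} (hψ : LocalAt τ ψ)
    (f : A → B) : LocalAt τ fun ω => f (ψ ω) := fun ω₁ ω₂ n h1 h2 =>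
  ⟨(hψ ω₁ ω₂ n h1 h2).1, by simp only [(hψ ω₁ ω₂ n h1 h2).2]⟩

theorem LocalAt.prodMk {A B : Type*} {τ : (ℕ → ℤ) → ℕ∞} {ψ : (ℕ → ℤ) → A} {φ : (ℕ → ℤ) → B}
    (hψ : LocalAt τ ψ) (hφ : LocalAt τ φ) : LocalAt τ fun ω => (ψ ω, φ ω) := fun ω₁ ω₂ n h1 h2 =>
  ⟨(hψ ω₁ ω₂ n h1 h2).1, by
    simp only [(hψ ω₁ ω₂ n h1 h2).2, (hφ ω₁ ω₂ n h1 h2).2]⟩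

theorem localTime_add (z : ℤ) (n : ℕ) (t : ℕ∞) (ω : ℕ → ℤ) :
    localTime z (n + t) ω = localTime z n ω + localTime z t (shift n ω) := by
  unfold localTime
  rw [← ENNReal.summable.sum_add_tsum_nat_add' (f := fun m : ℕ =>
      if (m : ℕ∞) < n + t ∧ ω m = z then (1 : ℝ≥0∞) else 0) (k := n),
    tsum_eq_sum (s := Finset.range n)
      (f := fun m : ℕ => if (m : ℕ∞) < n ∧ ω m = z then (1 : ℝ≥0∞) else 0)]
  · congr 1
    · refine Finset.sum_congr rfl fun m hm => ?_
      have h1 : (m : ℕ∞) < n := by exact_mod_cast Finset.mem_range.1 hm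
      have h2 : (m : ℕ∞) < n + t := lt_of_lt_of_le h1 le_self_add
      simp [h1, h2]
    · congr 1
      funext m
      have h1 : ((m + n : ℕ) : ℕ∞) < n + t ↔ (m : ℕ∞) < t := by
        rw [Nat.cast_add, add_comm, ENat.add_lt_add_iff_left (ENat.natCast_ne_top n)]
      refine if_congr (and_congr h1 ?_) rfl rfl
      rw [shift, add_comm]
  · intro m hm
    have : ¬ (m < n) := by simpa using hm
    simp [this]

theorem measurable_localTime (z : ℤ) {τ : (ℕ → ℤ) → ℕ∞} (hτ : Measurable τ) :
    Measurable fun ω => localTime z (τ ω) ω := by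
  unfold localTime
  refine Measurable.tsum fun m => Measurable.ite ?_ measurable_const measurable_const
  have h1 : MeasurableSet {ω | (m : ℕ∞) < τ ω} :=
    hτ (MeasurableSet.of_discrete (s := Set.Ioi (m : ℕ∞)))
  exact h1.inter (measurableSet_eq_fun (measurable_pi_apply m) measurable_const)

theorem localTime_eq_zero {z : ℤ} {n : ℕ∞} {ω : ℕ → ℤ} (hz : ∀ m : ℕ, (m : ℕ∞) < n → ω m ≠ z) :
    localTime z n ω = 0 := by
  unfold localTime
  rw [ENNReal.tsum_eq_zero]
  intro m
  rw [if_neg]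
  exact fun hm => hz m hm.1 hm.2

/-- A point of C is not visited before C is hit, so only the second phase contributes. -/
theorem localTime_excTime {z : ℤ} (hz : z ∈ setC h d zs) {ω : ℕ → ℤ}
    (hω : hitTime h d zs ω ≠ ⊤) :
    localTime z (excTime h d zs ω) ω =
      localTime z (exitTime (setO h zs) (shiftBy (hitTime h d zs) ω))
        (shiftBy (hitTime h d zs) ω) := by
  obtain ⟨m, hm⟩ := ENat.ne_top_iff_exists.1 hω
  rw [excTime_apply, ← hm, localTime_add, localTime_eq_zero, zero_add]
  · simp [shiftBy, ← hm]
  · intro i hi he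
    rw [hm, hitTime_eq, lt_exitTime_iff] at hi
    exact hi i le_rfl (by rwa [he])

theorem shiftBy_excTime_zero {ω : ℕ → ℤ} (hω : excTime h d zs ω ≠ ⊤) :
    shiftBy (excTime h d zs) ω 0 = exitPos (setO h zs) (shiftBy (hitTime h d zs) ω) := by
  rw [excTime_apply] at hω
  have h1 : hitTime h d zs ω ≠ ⊤ := fun ht => by simp [ht] at hω
  have h2 : exitTime (setO h zs) (shiftBy (hitTime h d zs) ω) ≠ ⊤ := fun ht => by simp [ht] at hω
  rw [shiftBy_zero_apply, excTime_apply, ENat.toNat_add h1 h2]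
  rfl

/-! ### The two phases of an excursion -/

/-- From outside C the interval is the gap between two neighbouring blocks. From inside C it
degenerates to the empty interval with both ends at x, so that the same statement covers a hitting
time equal to 0. -/
theorem exists_Ioo_hitTime (h0 : 0 < γ) (h1 : γ ≤ 1) (hd : 20 * (d + 1) < h)
    (hsep : Separated h zs) (x : ℤ) :
    ∃ α β, α ≤ x ∧ x ≤ β ∧ α ∈ setC h d zs ∧ β ∈ setC h d zs ∧ β ≤ α + 4 * h ∧
      ∀ᵐ ω ∂(Q γ x), hitTime h d zs ω = exitTime (Set.Ioo α β) ω := by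
  by_cases hx : x ∈ setC h d zs
  · refine ⟨x, x, le_rfl, le_rfl, hx, hx, by omega, ?_⟩
    filter_upwards [ae_start γ x] with ω hω
    rw [hitTime_eq, exitTime_eq_zero (by simpa [hω] using hx), exitTime_eq_zero (by simp)]
  · obtain ⟨u, v, hc, hxu, hxv⟩ := exists_Ioo_of_notMem_setC (by omega) hsep hx
    have h4 := hc.le_four_mul (by omega) hsep
    refine ⟨u + d, v - d, hxu.le, hxv.le, hc.left_mem_setC, hc.right_mem_setC, by omega, ?_⟩
    filter_upwards [ae_start γ x, ae_nearestNeighbour h0.le h1 x,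
      ae_exitTime_Ioo_ne_top h0 h1 (u + d) (v - d) x] with ω h2 h3 h5
    rw [hitTime_eq]
    exact exitTime_eq_of_Ioo_subset hc.Ioo_subset_compl_setC (by simpa using hc.left_mem_setC)
      (by simpa using hc.right_mem_setC) (by rw [h2]; exact ⟨hxu.le, hxv.le⟩) h3 h5

theorem ae_hitTime_eq_of_consecutive (h0 : 0 < γ) (h1 : γ ≤ 1) {u v x : ℤ}
    (hc : Consecutive h zs u v) (hx : x ∈ Set.Icc (u + (d : ℤ)) (v - d)) :
    ∀ᵐ ω ∂(Q γ x), hitTime h d zs ω = exitTime (Set.Ioo (u + (d : ℤ)) (v - d)) ω := by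
  filter_upwards [ae_start γ x, ae_nearestNeighbour h0.le h1 x,
    ae_exitTime_Ioo_ne_top h0 h1 (u + d) (v - d) x] with ω h2 h3 h5
  rw [hitTime_eq]
  exact exitTime_eq_of_Ioo_subset hc.Ioo_subset_compl_setC (by simpa using hc.left_mem_setC)
    (by simpa using hc.right_mem_setC) (by rwa [h2]) h3 h5

theorem ae_exitTime_setO (h0 : 0 < γ) (h1 : γ ≤ 1) (hd : 20 * (d + 1) < h)
    (hsep : Separated h zs) {u y : ℤ} (hu : u ∈ grid h zs) (hy : y ∈ closedBlock d u) :
    ∀ᵐ ω ∂(Q γ y), exitTime (setO h zs) ω = exitTime (Set.Ioo (u - (h : ℤ)) (u + h)) ω := by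
  rw [mem_closedBlock_iff] at hy
  filter_upwards [ae_start γ y, ae_nearestNeighbour h0.le h1 y,
    ae_exitTime_Ioo_ne_top h0 h1 (u - h) (u + h) y] with ω h2 h3 h5
  exact exitTime_eq_of_Ioo_subset (Ioo_subset_setO hu) (sub_notMem_setO hsep hu)
    (add_notMem_setO hsep hu) (by rw [h2]; constructor <;> omega) h3 h5

theorem goodTime_hitTime (h0 : 0 < γ) (h1 : γ ≤ 1) (hd : 20 * (d + 1) < h)
    (hsep : Separated h zs) : GoodTime γ (hitTime h d zs) where
  measurable := measurable_hitTime
  localAt := by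
    rw [hitTime_eq]
    exact localAt_exitTime _
  ae_ne_top x := by
    obtain ⟨α, β, -, -, -, -, -, hae⟩ := exists_Ioo_hitTime h0 h1 hd hsep x
    filter_upwards [hae, ae_exitTime_Ioo_ne_top h0 h1 α β x] with ω h2 h3
    rwa [h2]

theorem ae_hitPos_mem (h0 : 0 < γ) (h1 : γ ≤ 1) (hd : 20 * (d + 1) < h)
    (hsep : Separated h zs) (x : ℤ) : ∀ᵐ ω ∂(Q γ x), hitPos h d zs ω ∈ setC h d zs := by
  filter_upwards [(goodTime_hitTime h0 h1 hd hsep).ae_ne_top x] with ω hω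
  rw [hitPos_eq]
  rw [hitTime_eq] at hω
  simpa using exitPos_notMem hω

theorem lintegral_shiftBy_hitTime (h0 : 0 < γ) (h1 : γ ≤ 1) (hd : 20 * (d + 1) < h)
    (hsep : Separated h zs) (x : ℤ) {F : (ℕ → ℤ) → ℝ≥0∞} (hF : Measurable F) :
    ∫⁻ ω, F (shiftBy (hitTime h d zs) ω) ∂(Q γ x) =
      ∫⁻ ω, ∫⁻ ω', F ω' ∂(Q γ (hitPos h d zs ω)) ∂(Q γ x) :=
  lintegral_shiftBy h0.le h1 (goodTime_hitTime h0 h1 hd hsep) x hF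

/-- Transfers almost sure properties of walks started in C to the second phase. The property may
refer to the starting point, which is read off as the value at time 0; the strong Markov property is
applied to the indicator of failure. -/
theorem ae_shiftBy_hitTime (h0 : 0 < γ) (h1 : γ ≤ 1) (hd : 20 * (d + 1) < h)
    (hsep : Separated h zs) {P : ℤ → (ℕ → ℤ) → Prop} (hP : ∀ y, MeasurableSet {ω | P y ω})
    (hy : ∀ y ∈ setC h d zs, ∀ᵐ ω ∂(Q γ y), P y ω) (x : ℤ) :
    ∀ᵐ ω ∂(Q γ x), P (hitPos h d zs ω) (shiftBy (hitTime h d zs) ω) := by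
  have hP' : MeasurableSet {ω : ℕ → ℤ | P (ω 0) ω} := by
    have : {ω : ℕ → ℤ | P (ω 0) ω} = ⋃ y, ({ω | ω 0 = y} ∩ {ω | P y ω}) := by
      ext ω; simp
    rw [this]
    exact MeasurableSet.iUnion fun y =>
      (measurableSet_eq_fun (measurable_pi_apply 0) measurable_const).inter (hP y)
  have hm : Measurable ({ω : ℕ → ℤ | P (ω 0) ω}ᶜ.indicator (fun _ => (1 : ℝ≥0∞))) :=
    measurable_const.indicator hP'.compl
  have key := lintegral_shiftBy_hitTime h0 h1 hd hsep x hm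
  have e : ∀ᵐ ω ∂(Q γ x), ∫⁻ ω', {ω : ℕ → ℤ | P (ω 0) ω}ᶜ.indicator (fun _ => (1 : ℝ≥0∞)) ω'
      ∂(Q γ (hitPos h d zs ω)) = 0 := by
    filter_upwards [ae_hitPos_mem h0 h1 hd hsep x] with ω hω
    rw [lintegral_indicator hP'.compl]
    simp only [lintegral_const, one_mul, Measure.restrict_apply_univ]
    have : ∀ᵐ ω' ∂(Q γ (hitPos h d zs ω)), P (ω' 0) ω' := by
      filter_upwards [hy _ hω, ae_start γ (hitPos h d zs ω)] with ω' h2 h3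
      rwa [h3]
    exact ae_iff.1 this
  have hm' : Measurable fun ω => {ω : ℕ → ℤ | P (ω 0) ω}ᶜ.indicator (fun _ => (1 : ℝ≥0∞))
      (shiftBy (hitTime h d zs) ω) := hm.comp (measurable_shiftBy measurable_hitTime)
  rw [lintegral_congr_ae e, lintegral_zero, lintegral_eq_zero_iff hm'] at key
  filter_upwards [key] with ω hω
  by_contra hc
  have hc' : ¬ P (shiftBy (hitTime h d zs) ω 0) (shiftBy (hitTime h d zs) ω) := hc
  simp [hc'] at hω

theorem goodTime_excTime (h0 : 0 < γ) (h1 : γ ≤ 1) (hd : 20 * (d + 1) < h)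
    (hsep : Separated h zs) : GoodTime γ (excTime h d zs) where
  measurable := measurable_excTime
  localAt := fun _ _ _ h2 h3 => ⟨(excTime_local h2 h3).1, rfl⟩
  ae_ne_top x := by
    filter_upwards [(goodTime_hitTime h0 h1 hd hsep).ae_ne_top x,
      ae_shiftBy_hitTime h0 h1 hd hsep (P := fun _ ω => exitTime (setO h zs) ω ≠ ⊤)
      (fun _ => (measurable_exitTime _ (MeasurableSet.singleton ⊤)).compl) (fun y hy => by
        obtain ⟨u, hu, hyu⟩ := mem_setC_iff.1 hy
        filter_upwards [ae_exitTime_setO h0 h1 hd hsep hu hyu,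
          ae_exitTime_Ioo_ne_top h0 h1 (u - h) (u + h) y] with ω h2 h3
        rwa [h2]) x] with ω h2 h3
    rw [excTime_apply]
    simp [h2, h3]

end

section

variable {γ : ℝ} {L h d : ℕ} {zs : Fin L → ℤ}

/-! ### A single excursion: duration -/

theorem ENNReal_add_sq_le (a b : ℝ≥0∞) : (a + b) ^ 2 ≤ 4 * a ^ 2 + 4 * b ^ 2 := by
  rcases le_total a b with hab | hab
  · calc (a + b) ^ 2 ≤ (b + b) ^ 2 := by gcongr
      _ = 4 * b ^ 2 := by ring
      _ ≤ _ := le_add_self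
  · calc (a + b) ^ 2 ≤ (a + a) ^ 2 := by gcongr
      _ = 4 * a ^ 2 := by ring
      _ ≤ _ := le_self_add

theorem lintegral_hitTime_le (h0 : 0 < γ) (h1 : γ ≤ 1) (hd : 20 * (d + 1) < h)
    (hsep : Separated h zs) (x : ℤ) :
    ∫⁻ ω, (hitTime h d zs ω : ℝ≥0∞) ∂(Q γ x) ≤ ENNReal.ofReal (4 * (h ^ 2 / γ)) := by
  obtain ⟨α, β, hα, hβ, -, -, hαβ, hae⟩ := exists_Ioo_hitTime h0 h1 hd hsep x
  have e : ∫⁻ ω, (hitTime h d zs ω : ℝ≥0∞) ∂(Q γ x) =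
      ∫⁻ ω, (exitTime (Set.Ioo α β) ω : ℝ≥0∞) ∂(Q γ x) :=
    lintegral_congr_ae (by filter_upwards [hae] with ω hω; rw [hω])
  rw [e]
  refine (lintegral_exitTime_Ioo_le h0 h1 α β x).trans (ENNReal.ofReal_le_ofReal ?_)
  rw [← mul_div_assoc]
  refine div_le_div_of_nonneg_right ?_ h0.le
  have a1 : (α : ℝ) ≤ x := by exact_mod_cast hα
  have a2 : (x : ℝ) ≤ β := by exact_mod_cast hβ
  have a3 : (β : ℝ) ≤ α + 4 * h := by exact_mod_cast hαβ
  nlinarith [sq_nonneg (2 * (x : ℝ) - α - β), mul_nonneg (sub_nonneg.2 a1) (sub_nonneg.2 a2)]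

theorem lintegral_hitTime_sq_le (h0 : 0 < γ) (h1 : γ ≤ 1) (hd : 20 * (d + 1) < h)
    (hsep : Separated h zs) (x : ℤ) :
    ∫⁻ ω, (hitTime h d zs ω : ℝ≥0∞) ^ 2 ∂(Q γ x) ≤ ENNReal.ofReal (32 * (h ^ 2 / γ) ^ 2) := by
  obtain ⟨α, β, hα, hβ, -, -, hαβ, hae⟩ := exists_Ioo_hitTime h0 h1 hd hsep x
  have e : ∫⁻ ω, (hitTime h d zs ω : ℝ≥0∞) ^ 2 ∂(Q γ x) =
      ∫⁻ ω, (exitTime (Set.Ioo α β) ω : ℝ≥0∞) ^ 2 ∂(Q γ x) :=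
    lintegral_congr_ae (by filter_upwards [hae] with ω hω; rw [hω])
  rw [e]
  refine (lintegral_exitTime_Ioo_sq_le h0 h1 α β x).trans (ENNReal.ofReal_le_ofReal ?_)
  have a1 : (0 : ℝ) ≤ β - α := by
    have : α ≤ β := hα.trans hβ
    have : (α : ℝ) ≤ β := by exact_mod_cast this
    linarith
  have a3 : (β : ℝ) - α ≤ 4 * h := by
    have : (β : ℝ) ≤ α + 4 * h := by exact_mod_cast hαβ
    linarith
  calc 2 * (((β : ℝ) - α) ^ 2 / (4 * γ)) ^ 2 ≤ 2 * ((4 * h) ^ 2 / (4 * γ)) ^ 2 := by gcongr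
    _ = 32 * (h ^ 2 / γ) ^ 2 := by field_simp; ring

theorem lintegral_exitTime_setO (h0 : 0 < γ) (h1 : γ ≤ 1) (hd : 20 * (d + 1) < h)
    (hsep : Separated h zs) {u y : ℤ} (hu : u ∈ grid h zs) (hy : y ∈ closedBlock d u) :
    ∫⁻ ω, (exitTime (setO h zs) ω : ℝ≥0∞) ∂(Q γ y) =
      ENNReal.ofReal ((h ^ 2 - (y - u) ^ 2) / γ) := by
  have hy' := mem_closedBlock_iff.1 hy
  have e : ∫⁻ ω, (exitTime (setO h zs) ω : ℝ≥0∞) ∂(Q γ y) =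
      ∫⁻ ω, (exitTime (Set.Ioo (u - (h : ℤ)) (u + h)) ω : ℝ≥0∞) ∂(Q γ y) :=
    lintegral_congr_ae (by
      filter_upwards [ae_exitTime_setO h0 h1 hd hsep hu hy] with ω hω; rw [hω])
  rw [e, lintegral_exitTime_Ioo h0 h1 (by constructor <;> omega)]
  congr 1
  push_cast
  ring

theorem lintegral_exitTime_setO_sq_le (h0 : 0 < γ) (h1 : γ ≤ 1) (hd : 20 * (d + 1) < h)
    (hsep : Separated h zs) {y : ℤ} (hy : y ∈ setC h d zs) :
    ∫⁻ ω, (exitTime (setO h zs) ω : ℝ≥0∞) ^ 2 ∂(Q γ y) ≤ ENNReal.ofReal (2 * (h ^ 2 / γ) ^ 2) := by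
  obtain ⟨u, hu, hyu⟩ := mem_setC_iff.1 hy
  have e : ∫⁻ ω, (exitTime (setO h zs) ω : ℝ≥0∞) ^ 2 ∂(Q γ y) =
      ∫⁻ ω, (exitTime (Set.Ioo (u - (h : ℤ)) (u + h)) ω : ℝ≥0∞) ^ 2 ∂(Q γ y) :=
    lintegral_congr_ae (by
      filter_upwards [ae_exitTime_setO h0 h1 hd hsep hu hyu] with ω hω; rw [hω])
  rw [e]
  refine (lintegral_exitTime_Ioo_sq_le h0 h1 _ _ y).trans (ENNReal.ofReal_le_ofReal ?_)
  push_cast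
  apply le_of_eq
  field_simp
  ring

theorem measurable_toENNReal {τ : (ℕ → ℤ) → ℕ∞} (hτ : Measurable τ) :
    Measurable fun ω => (τ ω : ℝ≥0∞) := Measurable.of_discrete.comp hτ

theorem lintegral_excTime (h0 : 0 < γ) (h1 : γ ≤ 1) (hd : 20 * (d + 1) < h)
    (hsep : Separated h zs) (x : ℤ) :
    ∫⁻ ω, (excTime h d zs ω : ℝ≥0∞) ∂(Q γ x) = ∫⁻ ω, (hitTime h d zs ω : ℝ≥0∞) ∂(Q γ x) +
      ∫⁻ ω, ∫⁻ ω', (exitTime (setO h zs) ω' : ℝ≥0∞) ∂(Q γ (hitPos h d zs ω)) ∂(Q γ x) := by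
  simp_rw [excTime_apply, ENat.toENNReal_add]
  rw [lintegral_add_left (measurable_toENNReal measurable_hitTime),
    lintegral_shiftBy_hitTime h0 h1 hd hsep x (measurable_toENNReal (measurable_exitTime _))]

theorem lintegral_excTime_le (h0 : 0 < γ) (h1 : γ ≤ 1) (hd : 20 * (d + 1) < h)
    (hsep : Separated h zs) (x : ℤ) :
    ∫⁻ ω, (excTime h d zs ω : ℝ≥0∞) ∂(Q γ x) ≤ ENNReal.ofReal (5 * (h ^ 2 / γ)) := by
  have := isProbabilityMeasure_Q h0.le h1 x
  rw [lintegral_excTime h0 h1 hd hsep x,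
    show 5 * ((h : ℝ) ^ 2 / γ) = 4 * (h ^ 2 / γ) + h ^ 2 / γ by ring,
    ENNReal.ofReal_add (by positivity) (by positivity)]
  gcongr
  · exact lintegral_hitTime_le h0 h1 hd hsep x
  · calc _ ≤ ∫⁻ _, ENNReal.ofReal (h ^ 2 / γ) ∂(Q γ x) := by
          refine lintegral_mono_ae ?_
          filter_upwards [ae_hitPos_mem h0 h1 hd hsep x] with ω hω
          obtain ⟨u, hu, hyu⟩ := mem_setC_iff.1 hω
          rw [lintegral_exitTime_setO h0 h1 hd hsep hu hyu]
          apply ENNReal.ofReal_le_ofReal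
          gcongr
          nlinarith [sq_nonneg ((hitPos h d zs ω : ℝ) - u)]
      _ = _ := by simp

theorem lintegral_excTime_sq_le (h0 : 0 < γ) (h1 : γ ≤ 1) (hd : 20 * (d + 1) < h)
    (hsep : Separated h zs) (x : ℤ) :
    ∫⁻ ω, (excTime h d zs ω : ℝ≥0∞) ^ 2 ∂(Q γ x) ≤ ENNReal.ofReal (136 * (h ^ 2 / γ) ^ 2) := by
  have := isProbabilityMeasure_Q h0.le h1 x
  have m1 := (measurable_toENNReal (measurable_hitTime (h := h) (d := d) (zs := zs))).pow_const 2
  have m2 := (measurable_toENNReal (measurable_exitTime (setO h zs))).pow_const 2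
  have m3 : Measurable fun ω =>
      (exitTime (setO h zs) (shiftBy (hitTime h d zs) ω) : ℝ≥0∞) ^ 2 :=
    m2.comp (measurable_shiftBy measurable_hitTime)
  calc ∫⁻ ω, (excTime h d zs ω : ℝ≥0∞) ^ 2 ∂(Q γ x)
      ≤ ∫⁻ ω, (4 * (hitTime h d zs ω : ℝ≥0∞) ^ 2 +
        4 * (exitTime (setO h zs) (shiftBy (hitTime h d zs) ω) : ℝ≥0∞) ^ 2) ∂(Q γ x) := by
        refine lintegral_mono fun ω => ?_
        rw [excTime_apply, ENat.toENNReal_add]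
        exact ENNReal_add_sq_le _ _
    _ = 4 * ∫⁻ ω, (hitTime h d zs ω : ℝ≥0∞) ^ 2 ∂(Q γ x) + 4 * ∫⁻ ω, ∫⁻ ω',
        (exitTime (setO h zs) ω' : ℝ≥0∞) ^ 2 ∂(Q γ (hitPos h d zs ω)) ∂(Q γ x) := by
        rw [lintegral_add_left (m1.const_mul _), lintegral_const_mul _ m1,
          lintegral_const_mul _ m3,
          lintegral_shiftBy_hitTime h0 h1 hd hsep x m2]
    _ ≤ 4 * ENNReal.ofReal (32 * (h ^ 2 / γ) ^ 2) + 4 * ENNReal.ofReal (2 * (h ^ 2 / γ) ^ 2) := by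
        gcongr
        · exact lintegral_hitTime_sq_le h0 h1 hd hsep x
        · calc _ ≤ ∫⁻ _, ENNReal.ofReal (2 * (h ^ 2 / γ) ^ 2) ∂(Q γ x) := by
                refine lintegral_mono_ae ?_
                filter_upwards [ae_hitPos_mem h0 h1 hd hsep x] with ω hω
                exact lintegral_exitTime_setO_sq_le h0 h1 hd hsep hω
            _ = _ := by simp
    _ = ENNReal.ofReal (136 * (h ^ 2 / γ) ^ 2) := by
        have e4 : (4 : ℝ≥0∞) = ENNReal.ofReal 4 := by simp
        rw [e4, ← ENNReal.ofReal_mul (by norm_num), ← ENNReal.ofReal_mul (by norm_num),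
          ← ENNReal.ofReal_add (by positivity) (by positivity)]
        congr 1
        ring

/-- The indicator that `C` is hit in the component `u + [-d, d]`. -/
def visit {L : ℕ} (h d : ℕ) (zs : Fin L → ℤ) (u : ℤ) (ω : ℕ → ℤ) : ℝ≥0∞ :=
  (closedBlock d u).indicator (fun _ => 1) (hitPos h d zs ω)

theorem measurable_visit (u : ℤ) : Measurable (visit h d zs u) :=
  (Measurable.of_discrete (f := (closedBlock d u).indicator fun _ => (1 : ℝ≥0∞))).comp
    measurable_hitPos

theorem visit_le_one (u : ℤ) (ω : ℕ → ℤ) : visit h d zs u ω ≤ 1 :=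
  Set.indicator_le_self' (fun _ _ => zero_le) _ |>.trans (by simp)

theorem ae_hitPos_of_consecutive (h0 : 0 < γ) (h1 : γ ≤ 1) {u v x : ℤ}
    (hc : Consecutive h zs u v) (hx : x ∈ Set.Icc (u + (d : ℤ)) (v - d)) :
    ∀ᵐ ω ∂(Q γ x), hitPos h d zs ω = exitPos (Set.Ioo (u + (d : ℤ)) (v - d)) ω ∧
      (hitPos h d zs ω = u + d ∨ hitPos h d zs ω = v - d) := by
  filter_upwards [ae_hitTime_eq_of_consecutive h0 h1 hc hx, ae_exitPos_Ioo h0 h1 hx] with ω h2 h3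
  have e : hitPos h d zs ω = exitPos (Set.Ioo (u + (d : ℤ)) (v - d)) ω := by
    simp only [hitPos, h2, exitPos]
  rw [e]
  exact ⟨rfl, h3⟩

/-- The midpoint is at distance h - d from both blocks, and whichever one is hit, the walk enters it
at offset d from its centre. The mean duration is therefore (h - d)²/γ + (h² - d²)/γ, exactly t_N.
-/
theorem lintegral_excTime_of_regular (h0 : 0 < γ) (h1 : γ ≤ 1) (hd : 20 * (d + 1) < h)
    (hsep : Separated h zs) {u : ℤ} (hc : Consecutive h zs u (u + 2 * h)) :
    ∫⁻ ω, (excTime h d zs ω : ℝ≥0∞) ∂(Q γ (u + h)) = ENNReal.ofReal (meanExcursion γ h d) := by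
  have := isProbabilityMeasure_Q h0.le h1 (u + h)
  have hdh : (d : ℝ) ≤ h := by
    have : d ≤ h := by omega
    exact_mod_cast this
  have hx : u + (h : ℤ) ∈ Set.Icc (u + (d : ℤ)) (u + 2 * h - d) := by constructor <;> omega
  have e1 : ∫⁻ ω, (hitTime h d zs ω : ℝ≥0∞) ∂(Q γ (u + h)) =
      ENNReal.ofReal ((h - d) ^ 2 / γ) := by
    rw [lintegral_congr_ae (g := fun ω =>
      (exitTime (Set.Ioo (u + (d : ℤ)) (u + 2 * h - d)) ω : ℝ≥0∞))]
    · rw [lintegral_exitTime_Ioo h0 h1 hx]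
      congr 1
      push_cast
      ring
    · filter_upwards [ae_hitTime_eq_of_consecutive h0 h1 hc hx] with ω hω
      rw [hω]
  have e2 : ∫⁻ ω, ∫⁻ ω', (exitTime (setO h zs) ω' : ℝ≥0∞) ∂(Q γ (hitPos h d zs ω)) ∂(Q γ (u + h)) =
      ENNReal.ofReal ((h ^ 2 - d ^ 2) / γ) := by
    rw [lintegral_congr_ae (g := fun _ => ENNReal.ofReal ((h ^ 2 - d ^ 2) / γ))]
    · simp
    · filter_upwards [ae_hitPos_of_consecutive h0 h1 hc hx] with ω hω
      rcases hω.2 with h2 | h2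
      · rw [h2, lintegral_exitTime_setO h0 h1 hd hsep hc.1
          (mem_closedBlock_iff.2 ⟨by omega, by omega⟩)]
        congr 1
        push_cast
        ring
      · rw [h2, lintegral_exitTime_setO h0 h1 hd hsep hc.2.1
          (mem_closedBlock_iff.2 ⟨by omega, by omega⟩)]
        congr 1
        push_cast
        ring
  rw [lintegral_excTime h0 h1 hd hsep, e1, e2, meanExcursion_eq h0 h1 (by omega),
    ← ENNReal.ofReal_add (by positivity) (div_nonneg (by nlinarith) h0.le)]
  congr 1
  field_simp
  ring

/-- Gambler's ruin in a gap of length at most 4h, started at distance at least h from both ends: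
each side is hit with probability at least (h - d)/(4h - 2d), which is at least 1/5 since d is small
against h. -/
theorem le_lintegral_visit_of_consecutive (h0 : 0 < γ) (h1 : γ ≤ 1) (hd : 20 * (d + 1) < h)
    (hsep : Separated h zs) {u v w x : ℤ} (hc : Consecutive h zs u v) (hx1 : u + h ≤ x)
    (hx2 : x ≤ v - h) (hw : w = u ∨ w = v) :
    ENNReal.ofReal (1 / 5) ≤ ∫⁻ ω, visit h d zs w ω ∂(Q γ x) := by
  classical
  have hx : x ∈ Set.Icc (u + (d : ℤ)) (v - d) := by constructor <;> omega
  have h4 := hc.le_four_mul (by omega) hsep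
  have r1 : (u : ℝ) + h ≤ x := by exact_mod_cast hx1
  have r2 : (x : ℝ) ≤ v - h := by exact_mod_cast hx2
  have r3 : (v : ℝ) ≤ u + 4 * h := by exact_mod_cast h4
  have r4 : 20 * ((d : ℝ) + 1) < h := by exact_mod_cast hd
  have r5 : (0 : ℝ) ≤ d := Nat.cast_nonneg d
  obtain ⟨c, hcc, hcw⟩ : ∃ c, (c = u + (d : ℤ) ∨ c = v - d) ∧ c ∈ closedBlock d w ∧
      (1 / 5 : ℝ) ≤ (((v - d : ℤ) - x) * (if u + (d : ℤ) = c then 1 else 0) +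
        (x - (u + d : ℤ)) * (if v - (d : ℤ) = c then 1 else 0)) / ((v - d : ℤ) - (u + d : ℤ)) := by
    rcases hw with rfl | rfl
    · refine ⟨w + d, Or.inl rfl, mem_closedBlock_iff.2 ⟨by omega, by omega⟩, ?_⟩
      rw [if_pos rfl, if_neg (by omega)]
      push_cast
      rw [div_le_div_iff₀ (by norm_num) (by linarith)]
      linarith
    · refine ⟨w - d, Or.inr rfl, mem_closedBlock_iff.2 ⟨by omega, by omega⟩, ?_⟩
      rw [if_pos rfl, if_neg (by omega)]
      push_cast
      rw [div_le_div_iff₀ (by norm_num) (by linarith)]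
      linarith
  refine (ENNReal.ofReal_le_ofReal hcw.2).trans ?_
  rw [← lintegral_exitPos_Ioo h0 h1 (by omega) hx (g := fun y => if y = c then (1 : ℝ) else 0)
    (by split_ifs <;> norm_num) (by split_ifs <;> norm_num)]
  refine lintegral_mono_ae ?_
  filter_upwards [ae_hitPos_of_consecutive h0 h1 hc hx] with ω hω
  rw [← hω.1]
  split_ifs with h6
  · simp [visit, h6, hcw.1]
  · simp

/-- The duration of an excursion, as a real number. -/
def excReal {L : ℕ} (h d : ℕ) (zs : Fin L → ℤ) (ω : ℕ → ℤ) : ℝ :=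
  (excTime h d zs ω : ℝ≥0∞).toReal

theorem measurable_excReal : Measurable (excReal h d zs) :=
  (measurable_toENNReal measurable_excTime).ennreal_toReal

theorem integral_excReal_sub (h0 : 0 < γ) (h1 : γ ≤ 1) (hd : 20 * (d + 1) < h)
    (hsep : Separated h zs) (t : ℝ) (x : ℤ) :
    ∫ ω, (excReal h d zs ω - t) ∂(Q γ x) =
      (∫⁻ ω, (excTime h d zs ω : ℝ≥0∞) ∂(Q γ x)).toReal - t := by
  have := isProbabilityMeasure_Q h0.le h1 x
  have hm := measurable_toENNReal (measurable_excTime (h := h) (d := d) (zs := zs))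
  have hfin : ∫⁻ ω, (excTime h d zs ω : ℝ≥0∞) ∂(Q γ x) ≠ ⊤ :=
    ((lintegral_excTime_le h0 h1 hd hsep x).trans_lt ENNReal.ofReal_lt_top).ne
  have hint : Integrable (excReal h d zs) (Q γ x) :=
    integrable_toReal_of_lintegral_ne_top hm.aemeasurable hfin
  rw [integral_sub hint (integrable_const _)]
  unfold excReal
  rw [integral_toReal hm.aemeasurable (ae_lt_top hm hfin)]
  simp

theorem meanExcursion_nonneg (γ : ℝ) (h d : ℕ) :
    0 ≤ meanExcursion γ h d := ENNReal.toReal_nonneg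

theorem meanExcursion_le (h0 : 0 < γ) (h1 : γ ≤ 1) (hd : 20 * (d + 1) < h) :
    meanExcursion γ h d ≤ 2 * (h ^ 2 / γ) := by
  rw [meanExcursion_eq h0 h1 (by omega), ← mul_div_assoc]
  refine div_le_div_of_nonneg_right ?_ h0.le
  nlinarith [(Nat.cast_nonneg d : (0 : ℝ) ≤ d), (Nat.cast_nonneg h : (0 : ℝ) ≤ h)]

theorem le_meanExcursion (h0 : 0 < γ) (h1 : γ ≤ 1) (hd : 20 * (d + 1) < h) :
    h ^ 2 / γ ≤ meanExcursion γ h d := by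
  have r4 : 20 * ((d : ℝ) + 1) < h := by exact_mod_cast hd
  rw [meanExcursion_eq h0 h1 (by omega)]
  gcongr
  nlinarith [(Nat.cast_nonneg d : (0 : ℝ) ≤ d), (Nat.cast_nonneg h : (0 : ℝ) ≤ h)]

theorem abs_integral_excReal_sub_le (h0 : 0 < γ) (h1 : γ ≤ 1) (hd : 20 * (d + 1) < h)
    (hsep : Separated h zs) (x : ℤ) :
    |∫ ω, (excReal h d zs ω - meanExcursion γ h d) ∂(Q γ x)| ≤ 5 * (h ^ 2 / γ) := by
  rw [integral_excReal_sub h0 h1 hd hsep]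
  have h2 := ENNReal.toReal_le_of_le_ofReal (by positivity) (lintegral_excTime_le h0 h1 hd hsep x)
  have h3 : 0 ≤ (∫⁻ ω, (excTime h d zs ω : ℝ≥0∞) ∂(Q γ x)).toReal := ENNReal.toReal_nonneg
  have h4 := meanExcursion_le h0 h1 hd
  have h5 := meanExcursion_nonneg γ h d
  have h6 : 0 ≤ (h : ℝ) ^ 2 / γ := by positivity
  rw [abs_le]
  constructor <;> linarith

/-- In a regular gap the bias is 0. Otherwise an end of the gap is special and is visited with
probability at least 1/5, so the crude bound 5h²/γ = 25(h²/γ)/5 is paid for by that visit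
probability. Summed over excursions, the bias is governed by the number of visits to special blocks.
-/
theorem abs_integral_excReal_sub_le_of_mem (h0 : 0 < γ) (h1 : γ ≤ 1) (hd : 20 * (d + 1) < h)
    (hsep : Separated h zs) {x : ℤ} (hx : x ∈ departureSet h zs) :
    ENNReal.ofReal |∫ ω, (excReal h d zs ω - meanExcursion γ h d) ∂(Q γ x)| ≤
      ENNReal.ofReal (25 * (h ^ 2 / γ)) * ∑ ℓ, ∫⁻ ω, visit h d zs (zs ℓ) ω ∂(Q γ x) := by
  obtain ⟨u, v, hc, hx1, hx2⟩ := exists_consecutive_of_mem_departureSet (by omega) hsep hx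
  rcases hc.eq_or_star (by omega) hsep with rfl | ⟨ℓ, hℓ⟩
  · have hxe : x = u + h := by omega
    subst hxe
    rw [integral_excReal_sub h0 h1 hd hsep, lintegral_excTime_of_regular h0 h1 hd hsep hc,
      ENNReal.toReal_ofReal (meanExcursion_nonneg γ h d)]
    simp
  · have h2 := le_lintegral_visit_of_consecutive h0 h1 hd hsep hc hx1 hx2 hℓ
    calc _ ≤ ENNReal.ofReal (5 * (h ^ 2 / γ)) :=
          ENNReal.ofReal_le_ofReal (abs_integral_excReal_sub_le h0 h1 hd hsep x)
      _ = ENNReal.ofReal (25 * (h ^ 2 / γ)) * ENNReal.ofReal (1 / 5) := by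
          rw [← ENNReal.ofReal_mul (by positivity)]
          congr 1
          ring
      _ ≤ ENNReal.ofReal (25 * (h ^ 2 / γ)) * ∫⁻ ω, visit h d zs (zs ℓ) ω ∂(Q γ x) := by gcongr
      _ ≤ _ := by
          gcongr
          exact Finset.single_le_sum (f := fun ℓ => ∫⁻ ω, visit h d zs (zs ℓ) ω ∂(Q γ x))
            (fun _ _ => zero_le) (Finset.mem_univ ℓ)

theorem lintegral_excReal_sub_sq_le (h0 : 0 < γ) (h1 : γ ≤ 1) (hd : 20 * (d + 1) < h)
    (hsep : Separated h zs) (x : ℤ) :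
    ∫⁻ ω, ENNReal.ofReal ((excReal h d zs ω - meanExcursion γ h d) ^ 2) ∂(Q γ x) ≤
      ENNReal.ofReal (140 * (h ^ 2 / γ) ^ 2) := by
  have := isProbabilityMeasure_Q h0.le h1 x
  have h4 := meanExcursion_le h0 h1 hd
  have h5 := meanExcursion_nonneg γ h d
  have hm := measurable_toENNReal (measurable_excTime (h := h) (d := d) (zs := zs))
  calc _ ≤ ∫⁻ ω, ((excTime h d zs ω : ℝ≥0∞) ^ 2 + ENNReal.ofReal (meanExcursion γ h d ^ 2))
        ∂(Q γ x) := by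
        refine lintegral_mono fun ω => ?_
        have e : ENNReal.ofReal (excReal h d zs ω ^ 2) ≤ (excTime h d zs ω : ℝ≥0∞) ^ 2 := by
          rw [excReal, ENNReal.ofReal_pow ENNReal.toReal_nonneg]
          gcongr
          exact ENNReal.ofReal_toReal_le
        refine le_trans ?_ (add_le_add_left e _)
        rw [← ENNReal.ofReal_add (by positivity) (by positivity)]
        -- The cross term -2 · duration · t_N is nonpositive and is dropped.
        apply ENNReal.ofReal_le_ofReal
        have : 0 ≤ excReal h d zs ω := ENNReal.toReal_nonneg
        nlinarith [mul_nonneg this h5]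
    _ = ∫⁻ ω, (excTime h d zs ω : ℝ≥0∞) ^ 2 ∂(Q γ x) +
        ENNReal.ofReal (meanExcursion γ h d ^ 2) := by
        rw [lintegral_add_left (hm.pow_const 2)]
        simp
    _ ≤ ENNReal.ofReal (136 * (h ^ 2 / γ) ^ 2) + ENNReal.ofReal ((2 * (h ^ 2 / γ)) ^ 2) := by
        gcongr
        exact lintegral_excTime_sq_le h0 h1 hd hsep x
    _ = _ := by
        rw [← ENNReal.ofReal_add (by positivity) (by positivity)]
        congr 1
        ring

end

section

variable {γ : ℝ} {L h d : ℕ} {zs : Fin L → ℤ}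

/-! ### A single excursion: displacement -/

theorem lintegral_exitPos_sub (h0 : 0 < γ) (h1 : γ ≤ 1) {α β x c : ℤ} (hα : α ≤ x) (hβ : x ≤ β)
    (hc : c ≤ α) :
    ∫⁻ ω, ENNReal.ofReal (exitPos (Set.Ioo α β) ω - c) ∂(Q γ x) = ENNReal.ofReal (x - c) := by
  rcases (hα.trans hβ).eq_or_lt with rfl | hαβ
  · have := isProbabilityMeasure_Q h0.le h1 x
    rw [lintegral_congr_ae (g := fun _ => ENNReal.ofReal (x - c))]
    · simp
    · filter_upwards [ae_start γ x] with ω hω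
      rw [exitPos_eq_start (by simp), hω]
  · have r1 : (c : ℝ) ≤ α := by exact_mod_cast hc
    have r2 : (α : ℝ) < β := by exact_mod_cast hαβ
    have e := lintegral_exitPos_Ioo h0 h1 hαβ ⟨hα, hβ⟩ (g := fun y : ℤ => (y : ℝ) - c)
      (by linarith) (by linarith)
    rw [e]
    congr 1
    have : (β : ℝ) - α ≠ 0 := by linarith
    field_simp
    ring

/-- Jensen's inequality for the convex function |· - v|, since the walk stopped on leaving the
interval keeps its mean. -/
theorem le_lintegral_abs_exitPos (h0 : 0 < γ) (h1 : γ ≤ 1) {α β x : ℤ} (hα : α ≤ x) (hβ : x ≤ β)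
    (v : ℤ) :
    ENNReal.ofReal |(x : ℝ) - v| ≤
      ∫⁻ ω, ENNReal.ofReal |(exitPos (Set.Ioo α β) ω : ℝ) - v| ∂(Q γ x) := by
  rcases (hα.trans hβ).eq_or_lt with rfl | hαβ
  · have := isProbabilityMeasure_Q h0.le h1 x
    rw [lintegral_congr_ae (g := fun _ => ENNReal.ofReal |(x : ℝ) - v|)]
    · simp
    · filter_upwards [ae_start γ x] with ω hω
      rw [exitPos_eq_start (by simp), hω]
  · have r1 : (α : ℝ) ≤ x := by exact_mod_cast hα
    have r2 : (α : ℝ) < β := by exact_mod_cast hαβ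
    have r3 : (x : ℝ) ≤ β := by exact_mod_cast hβ
    have e := lintegral_exitPos_Ioo h0 h1 hαβ ⟨hα, hβ⟩ (g := fun y : ℤ => |(y : ℝ) - v|)
      (abs_nonneg _) (abs_nonneg _)
    rw [e]
    apply ENNReal.ofReal_le_ofReal
    rw [le_div_iff₀ (by linarith)]
    have k1 : ((x : ℝ) - v) * (β - α) = (β - x) * (α - v) + (x - α) * (β - v) := by ring
    calc |(x : ℝ) - v| * (β - α) = |((x : ℝ) - v) * (β - α)| := by
          rw [abs_mul, abs_of_pos (by linarith : (0 : ℝ) < β - α)]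
      _ ≤ |((β : ℝ) - x) * (α - v)| + |((x : ℝ) - α) * (β - v)| := by
          rw [k1]
          exact abs_add_le _ _
      _ = _ := by
          rw [abs_mul, abs_mul, abs_of_nonneg (by linarith : (0 : ℝ) ≤ β - x),
            abs_of_nonneg (by linarith : (0 : ℝ) ≤ x - α)]

theorem ae_exitPos_setO (h0 : 0 < γ) (h1 : γ ≤ 1) (hd : 20 * (d + 1) < h)
    (hsep : Separated h zs) {u y : ℤ} (hu : u ∈ grid h zs) (hy : y ∈ closedBlock d u) :
    ∀ᵐ ω ∂(Q γ y), exitPos (setO h zs) ω = exitPos (Set.Ioo (u - (h : ℤ)) (u + h)) ω ∧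
      (exitPos (setO h zs) ω = u - h ∨ exitPos (setO h zs) ω = u + h) := by
  have hy' := mem_closedBlock_iff.1 hy
  filter_upwards [ae_exitTime_setO h0 h1 hd hsep hu hy,
    ae_exitPos_Ioo h0 h1 (α := u - h) (β := u + h) (x := y) (by constructor <;> omega)]
    with ω h2 h3
  have e : exitPos (setO h zs) ω = exitPos (Set.Ioo (u - (h : ℤ)) (u + h)) ω := by
    simp only [exitPos, h2]
  rw [e]
  exact ⟨rfl, h3⟩

/-- The position at the end of an excursion. -/
def excPos {L : ℕ} (h d : ℕ) (zs : Fin L → ℤ) (ω : ℕ → ℤ) : ℤ := shiftBy (excTime h d zs) ω 0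

theorem measurable_excPos : Measurable (excPos h d zs) :=
  measurable_apply_toNat measurable_excTime

theorem lintegral_excPos (h0 : 0 < γ) (h1 : γ ≤ 1) (hd : 20 * (d + 1) < h)
    (hsep : Separated h zs) (x : ℤ) (F : ℤ → ℝ≥0∞) :
    ∫⁻ ω, F (excPos h d zs ω) ∂(Q γ x) =
      ∫⁻ ω, ∫⁻ ω', F (exitPos (setO h zs) ω') ∂(Q γ (hitPos h d zs ω)) ∂(Q γ x) := by
  rw [← lintegral_shiftBy_hitTime h0 h1 hd hsep x
    (F := fun ω' => F (exitPos (setO h zs) ω')) (Measurable.of_discrete.comp (measurable_exitPos _))]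
  refine lintegral_congr_ae ?_
  filter_upwards [(goodTime_excTime h0 h1 hd hsep).ae_ne_top x] with ω hω
  rw [excPos, shiftBy_excTime_zero hω]

theorem exists_Ioo_hitPos (h0 : 0 < γ) (h1 : γ ≤ 1) (hd : 20 * (d + 1) < h)
    (hsep : Separated h zs) (x : ℤ) :
    ∃ α β, α ≤ x ∧ x ≤ β ∧ β ≤ α + 4 * h ∧
      ∀ᵐ ω ∂(Q γ x), hitPos h d zs ω = exitPos (Set.Ioo α β) ω ∧
        (hitPos h d zs ω = α ∨ hitPos h d zs ω = β) := by
  obtain ⟨α, β, hα, hβ, -, -, hαβ, hae⟩ := exists_Ioo_hitTime h0 h1 hd hsep x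
  refine ⟨α, β, hα, hβ, hαβ, ?_⟩
  filter_upwards [hae, ae_exitPos_Ioo h0 h1 ⟨hα, hβ⟩] with ω h2 h3
  have e : hitPos h d zs ω = exitPos (Set.Ioo α β) ω := by simp only [hitPos, h2, exitPos]
  rw [e]
  exact ⟨rfl, h3⟩

/-- The hitting phase moves the walk by at most 4h and the exit phase by at most h + d. -/
theorem ae_excPos (h0 : 0 < γ) (h1 : γ ≤ 1) (hd : 20 * (d + 1) < h)
    (hsep : Separated h zs) (x : ℤ) :
    ∀ᵐ ω ∂(Q γ x), excPos h d zs ω ∈ departureSet h zs ∧ |excPos h d zs ω - x| ≤ 6 * h := by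
  obtain ⟨α, β, hα, hβ, hαβ, hae⟩ := exists_Ioo_hitPos h0 h1 hd hsep x
  filter_upwards [hae, (goodTime_excTime h0 h1 hd hsep).ae_ne_top x,
    ae_shiftBy_hitTime h0 h1 hd hsep (P := fun y ω => ∃ u ∈ grid h zs, y ∈ closedBlock d u ∧
      (exitPos (setO h zs) ω = u - h ∨ exitPos (setO h zs) ω = u + h))
      (fun y => measurable_exitPos (setO h zs) (MeasurableSet.of_discrete (s := {w |
        ∃ u ∈ grid h zs, y ∈ closedBlock d u ∧ (w = u - h ∨ w = u + h)})))
      (fun y hy => by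
        obtain ⟨u, hu, hyu⟩ := mem_setC_iff.1 hy
        filter_upwards [ae_exitPos_setO h0 h1 hd hsep hu hyu] with ω hω
        exact ⟨u, hu, hyu, hω.2⟩) x] with ω h2 h3 h4
  obtain ⟨u, hu, hyu, hw⟩ := h4
  rw [excPos, shiftBy_excTime_zero h3]
  rw [mem_closedBlock_iff] at hyu
  refine ⟨⟨u, hu, hw⟩, ?_⟩
  rw [abs_le]
  omega

theorem integral_excPos_sub (h0 : 0 < γ) (h1 : γ ≤ 1) (hd : 20 * (d + 1) < h)
    (hsep : Separated h zs) (x : ℤ) :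
    ∫ ω, ((excPos h d zs ω : ℝ) - ω 0) ∂(Q γ x) = 0 := by
  have := isProbabilityMeasure_Q h0.le h1 x
  obtain ⟨α, β, hα, hβ, hαβ, hae⟩ := exists_Ioo_hitPos h0 h1 hd hsep x
  have hm : Measurable fun ω => (excPos h d zs ω : ℝ) - x :=
    ((Measurable.of_discrete (f := fun y : ℤ => (y : ℝ))).comp measurable_excPos).sub_const _
  -- Measured from x - 6h every position in the excursion is nonnegative, so conservation of the
  -- mean in both phases can be stated for `[0, ∞]`-valued integrals.
  have e1 : ∫⁻ ω, ENNReal.ofReal (excPos h d zs ω - (x - 6 * h : ℤ)) ∂(Q γ x) =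
      ENNReal.ofReal (6 * h) := by
    rw [lintegral_excPos h0 h1 hd hsep x (fun y => ENNReal.ofReal (y - (x - 6 * h : ℤ)))]
    rw [lintegral_congr_ae (g := fun ω =>
      ENNReal.ofReal (exitPos (Set.Ioo α β) ω - (x - 6 * h : ℤ)))]
    · rw [lintegral_exitPos_sub h0 h1 hα hβ (by omega)]
      congr 1
      push_cast
      ring
    · filter_upwards [hae, ae_hitPos_mem h0 h1 hd hsep x] with ω h2 h3
      obtain ⟨u, hu, hyu⟩ := mem_setC_iff.1 h3
      have hyu' := mem_closedBlock_iff.1 hyu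
      rw [← h2.1]
      rw [lintegral_congr_ae (g := fun ω' =>
        ENNReal.ofReal (exitPos (Set.Ioo (u - (h : ℤ)) (u + h)) ω' - (x - 6 * h : ℤ)))]
      · exact lintegral_exitPos_sub h0 h1 (by omega) (by omega) (by omega)
      · filter_upwards [ae_exitPos_setO h0 h1 hd hsep hu hyu] with ω' h4
        rw [h4.1]
  have hb : ∀ᵐ ω ∂(Q γ x), |(excPos h d zs ω : ℝ) - x| ≤ 6 * h := by
    filter_upwards [ae_excPos h0 h1 hd hsep x] with ω hω
    exact_mod_cast hω.2
  have hint : Integrable (fun ω => (excPos h d zs ω : ℝ) - x) (Q γ x) :=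
    Integrable.of_bound hm.aestronglyMeasurable (6 * h) hb
  have e2 : ∫ ω, ((excPos h d zs ω : ℝ) - x + 6 * h) ∂(Q γ x) = 6 * h := by
    rw [integral_eq_lintegral_of_nonneg_ae _ (hm.add_const _).aestronglyMeasurable]
    · have : ∀ ω, (excPos h d zs ω : ℝ) - x + 6 * h = excPos h d zs ω - (x - 6 * h : ℤ) := by
        intro ω
        push_cast
        ring
      simp_rw [this]
      rw [e1, ENNReal.toReal_ofReal (by positivity)]
    · filter_upwards [hb] with ω hω
      have := (abs_le.1 hω).1
      simp only [Pi.zero_apply]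
      linarith
  rw [integral_add hint (integrable_const _)] at e2
  simp only [integral_const, probReal_univ, one_smul] at e2
  rw [integral_congr_ae (g := fun ω => (excPos h d zs ω : ℝ) - x)]
  · linarith
  · filter_upwards [ae_start γ x] with ω hω
    rw [hω]

/-- One step of a discrete Tanaka formula. The mean distance to v does not decrease in either phase.
If C is hit in the block of v, the walk is then within d of v and leaves O at distance exactly h, a
gain of at least h - d. -/
theorem le_lintegral_abs_excPos (h0 : 0 < γ) (h1 : γ ≤ 1) (hd : 20 * (d + 1) < h)
    (hsep : Separated h zs) (x : ℤ) {v : ℤ} (hv : v ∈ grid h zs) :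
    ENNReal.ofReal |(x : ℝ) - v| +
        ENNReal.ofReal (h - d) * ∫⁻ ω, visit h d zs v ω ∂(Q γ x) ≤
      ∫⁻ ω, ENNReal.ofReal |(excPos h d zs ω : ℝ) - v| ∂(Q γ x) := by
  have hdh : (d : ℝ) ≤ h := by
    have : d ≤ h := by omega
    exact_mod_cast this
  obtain ⟨α, β, hα, hβ, hαβ, hae⟩ := exists_Ioo_hitPos h0 h1 hd hsep x
  rw [lintegral_excPos h0 h1 hd hsep x (fun y => ENNReal.ofReal |(y : ℝ) - v|)]
  calc _ ≤ ∫⁻ ω, ENNReal.ofReal |(exitPos (Set.Ioo α β) ω : ℝ) - v| ∂(Q γ x) +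
        ∫⁻ ω, ENNReal.ofReal (h - d) * visit h d zs v ω ∂(Q γ x) := by
        rw [lintegral_const_mul _ (measurable_visit v)]
        gcongr
        exact le_lintegral_abs_exitPos h0 h1 hα hβ v
    _ = ∫⁻ ω, (ENNReal.ofReal |(exitPos (Set.Ioo α β) ω : ℝ) - v| +
        ENNReal.ofReal (h - d) * visit h d zs v ω) ∂(Q γ x) := by
        rw [lintegral_add_right _ ((measurable_visit v).const_mul _)]
    _ ≤ _ := by
        refine lintegral_mono_ae ?_
        filter_upwards [hae, ae_hitPos_mem h0 h1 hd hsep x] with ω h2 h3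
        rw [← h2.1, visit]
        set y := hitPos h d zs ω
        have := isProbabilityMeasure_Q h0.le h1 y
        by_cases hy : y ∈ closedBlock d v
        · have hy' := mem_closedBlock_iff.1 hy
          have r1 : (v : ℝ) - d ≤ y := by exact_mod_cast hy'.1
          have r2 : (y : ℝ) ≤ v + d := by exact_mod_cast hy'.2
          rw [Set.indicator_of_mem hy, mul_one, ← ENNReal.ofReal_add (abs_nonneg _) (by linarith)]
          calc _ ≤ ENNReal.ofReal h := by
                apply ENNReal.ofReal_le_ofReal
                have : |(y : ℝ) - v| ≤ d := by rw [abs_le]; constructor <;> linarith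
                linarith
            _ = ∫⁻ _, ENNReal.ofReal h ∂(Q γ y) := by simp
            _ ≤ _ := by
                refine lintegral_mono_ae ?_
                filter_upwards [ae_exitPos_setO h0 h1 hd hsep hv hy] with ω' h4
                apply ENNReal.ofReal_le_ofReal
                rcases h4.2 with h5 | h5 <;> rw [h5] <;> push_cast <;> simp
        · rw [Set.indicator_of_notMem hy, mul_zero, add_zero]
          obtain ⟨u, hu, hyu⟩ := mem_setC_iff.1 h3
          have hyu' := mem_closedBlock_iff.1 hyu
          refine (le_lintegral_abs_exitPos h0 h1 (α := u - h) (β := u + h) (by omega) (by omega)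
            v).trans (le_of_eq (lintegral_congr_ae ?_))
          filter_upwards [ae_exitPos_setO h0 h1 hd hsep hu hyu] with ω' h4
          rw [h4.1]

/-! ### A single excursion: local time -/

theorem lintegral_localTime_setO_of_notMem (h0 : 0 < γ) (h1 : γ ≤ 1) (hd : 20 * (d + 1) < h)
    (hsep : Separated h zs) {u y z : ℤ} (hu : u ∈ grid h zs) (hz : z ∈ closedBlock d u)
    (hy : y ∈ setC h d zs) (hyu : y ∉ closedBlock d u) :
    ∀ᵐ ω ∂(Q γ y), localTime z (exitTime (setO h zs) ω) ω = 0 := by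
  obtain ⟨v, hv, hyv⟩ := mem_setC_iff.1 hy
  have hne : u ≠ v := by
    rintro rfl
    exact hyu hyv
  have hsep' := grid_separated hsep hu hv hne
  rw [le_abs] at hsep'
  rw [mem_closedBlock_iff] at hz
  filter_upwards [ae_exitTime_setO h0 h1 hd hsep hv hyv] with ω hω
  refine localTime_eq_zero fun m hm he => ?_
  rw [hω, lt_exitTime_iff] at hm
  have := hm m le_rfl
  rw [he, Set.mem_Ioo] at this
  omega

/-- The Green function is pq/(hγ), where p and q lie in [h - d, h + d] because both y and z are
within d of u. The bounds follow from (h - d)² ≥ h(h - 3d) and (h + d)² ≤ h(h + 3d). -/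
theorem lintegral_localTime_setO_of_mem (h0 : 0 < γ) (h1 : γ ≤ 1) (hd : 20 * (d + 1) < h)
    (hsep : Separated h zs) {u y z : ℤ} (hu : u ∈ grid h zs) (hz : z ∈ closedBlock d u)
    (hy : y ∈ closedBlock d u) :
    ENNReal.ofReal ((h - 3 * d) / γ) ≤ ∫⁻ ω, localTime z (exitTime (setO h zs) ω) ω ∂(Q γ y) ∧
    ∫⁻ ω, localTime z (exitTime (setO h zs) ω) ω ∂(Q γ y) ≤ ENNReal.ofReal ((h + 3 * d) / γ) := by
  have hz' := mem_closedBlock_iff.1 hz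
  have hy' := mem_closedBlock_iff.1 hy
  have hh : (0 : ℝ) < h := by
    have : 0 < h := by omega
    exact_mod_cast this
  have hdh : 20 * ((d : ℝ) + 1) < h := by exact_mod_cast hd
  have hd0 : (0 : ℝ) ≤ d := Nat.cast_nonneg d
  have e : ∫⁻ ω, localTime z (exitTime (setO h zs) ω) ω ∂(Q γ y) =
      ∫⁻ ω, localTime z (exitTime (Set.Ioo (u - (h : ℤ)) (u + h)) ω) ω ∂(Q γ y) :=
    lintegral_congr_ae (by
      filter_upwards [ae_exitTime_setO h0 h1 hd hsep hu hy] with ω hω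
      rw [hω])
  rw [e, lintegral_localTime_Ioo h0 h1 (by constructor <;> omega) (by constructor <;> omega)]
  set p : ℝ := ((min y z - (u - (h : ℤ)) : ℤ) : ℝ) with hp
  set q : ℝ := ((u + (h : ℤ) - max y z : ℤ) : ℝ) with hq
  have p1 : (h : ℝ) - d ≤ p := by
    have : (h : ℤ) - d ≤ min y z - (u - (h : ℤ)) := by omega
    rw [hp]
    exact_mod_cast this
  have p2 : p ≤ (h : ℝ) + d := by
    have : min y z - (u - (h : ℤ)) ≤ (h : ℤ) + d := by omega
    rw [hp]
    exact_mod_cast this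
  have q1 : (h : ℝ) - d ≤ q := by
    have : (h : ℤ) - d ≤ u + (h : ℤ) - max y z := by omega
    rw [hq]
    exact_mod_cast this
  have q2 : q ≤ (h : ℝ) + d := by
    have : u + (h : ℤ) - max y z ≤ (h : ℤ) + d := by omega
    rw [hq]
    exact_mod_cast this
  have e2 : 2 * (p * q) / (γ * ((u + (h : ℤ) : ℤ) - (u - (h : ℤ) : ℤ))) = p * q / h / γ := by
    push_cast
    rw [show (u : ℝ) + h - (u - h) = 2 * h by ring]
    field_simp
  rw [e2]
  constructor
  · apply ENNReal.ofReal_le_ofReal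
    refine div_le_div_of_nonneg_right ?_ h0.le
    rw [le_div_iff₀ hh]
    have : ((h : ℝ) - d) * (h - d) ≤ p * q := mul_le_mul p1 q1 (by linarith) (by linarith)
    nlinarith
  · apply ENNReal.ofReal_le_ofReal
    refine div_le_div_of_nonneg_right ?_ h0.le
    rw [div_le_iff₀ hh]
    have : p * q ≤ ((h : ℝ) + d) * (h + d) := mul_le_mul p2 q2 (by linarith) (by linarith)
    nlinarith

theorem lintegral_localTime_setO_sq_le (h0 : 0 < γ) (h1 : γ ≤ 1) (hd : 20 * (d + 1) < h)
    (hsep : Separated h zs) {u y z : ℤ} (hu : u ∈ grid h zs) (hz : z ∈ closedBlock d u)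
    (hy : y ∈ closedBlock d u) :
    ∫⁻ ω, localTime z (exitTime (setO h zs) ω) ω ^ 2 ∂(Q γ y) ≤
      ENNReal.ofReal (2 * (h / γ) ^ 2) := by
  have hz' := mem_closedBlock_iff.1 hz
  have e : ∫⁻ ω, localTime z (exitTime (setO h zs) ω) ω ^ 2 ∂(Q γ y) =
      ∫⁻ ω, localTime z (exitTime (Set.Ioo (u - (h : ℤ)) (u + h)) ω) ω ^ 2 ∂(Q γ y) :=
    lintegral_congr_ae (by
      filter_upwards [ae_exitTime_setO h0 h1 hd hsep hu hy] with ω hω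
      rw [hω])
  rw [e]
  refine (lintegral_localTime_Ioo_sq_le h0 h1 (by constructor <;> omega) y).trans
    (ENNReal.ofReal_le_ofReal (le_of_eq ?_))
  push_cast
  field_simp
  ring

/-- The local time at `z` collected during an excursion. -/
def excLocal {L : ℕ} (h d : ℕ) (zs : Fin L → ℤ) (z : ℤ) (ω : ℕ → ℤ) : ℝ≥0∞ :=
  localTime z (excTime h d zs ω) ω

theorem measurable_excLocal (z : ℤ) : Measurable (excLocal h d zs z) :=
  measurable_localTime z measurable_excTime

theorem lintegral_excLocal_pow (h0 : 0 < γ) (h1 : γ ≤ 1) (hd : 20 * (d + 1) < h)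
    (hsep : Separated h zs) (x : ℤ) {z : ℤ} (hz : z ∈ setC h d zs) (n : ℕ) :
    ∫⁻ ω, excLocal h d zs z ω ^ n ∂(Q γ x) =
      ∫⁻ ω, ∫⁻ ω', localTime z (exitTime (setO h zs) ω') ω' ^ n ∂(Q γ (hitPos h d zs ω))
        ∂(Q γ x) := by
  rw [← lintegral_shiftBy_hitTime h0 h1 hd hsep x
    ((measurable_localTime z (measurable_exitTime (setO h zs))).pow_const n)]
  refine lintegral_congr_ae ?_
  filter_upwards [(goodTime_hitTime h0 h1 hd hsep).ae_ne_top x] with ω hω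
  rw [excLocal, localTime_excTime hz hω]

theorem lintegral_excLocal_bounds (h0 : 0 < γ) (h1 : γ ≤ 1) (hd : 20 * (d + 1) < h)
    (hsep : Separated h zs) (x : ℤ) {u z : ℤ} (hu : u ∈ grid h zs) (hz : z ∈ closedBlock d u) :
    ENNReal.ofReal ((h - 3 * d) / γ) * ∫⁻ ω, visit h d zs u ω ∂(Q γ x) ≤
        ∫⁻ ω, excLocal h d zs z ω ∂(Q γ x) ∧
      ∫⁻ ω, excLocal h d zs z ω ∂(Q γ x) ≤
        ENNReal.ofReal ((h + 3 * d) / γ) * ∫⁻ ω, visit h d zs u ω ∂(Q γ x) := by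
  have hzC : z ∈ setC h d zs := mem_setC_iff.2 ⟨u, hu, hz⟩
  have e := lintegral_excLocal_pow h0 h1 hd hsep x hzC 1
  simp only [pow_one] at e
  rw [e, ← lintegral_const_mul _ (measurable_visit u), ← lintegral_const_mul _ (measurable_visit u)]
  constructor
  · refine lintegral_mono_ae ?_
    filter_upwards [ae_hitPos_mem h0 h1 hd hsep x] with ω hω
    by_cases hy : hitPos h d zs ω ∈ closedBlock d u
    · rw [visit, Set.indicator_of_mem hy, mul_one]
      exact (lintegral_localTime_setO_of_mem h0 h1 hd hsep hu hz hy).1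
    · simp [visit, Set.indicator_of_notMem hy]
  · refine lintegral_mono_ae ?_
    filter_upwards [ae_hitPos_mem h0 h1 hd hsep x] with ω hω
    by_cases hy : hitPos h d zs ω ∈ closedBlock d u
    · rw [visit, Set.indicator_of_mem hy, mul_one]
      exact (lintegral_localTime_setO_of_mem h0 h1 hd hsep hu hz hy).2
    · rw [lintegral_congr_ae (lintegral_localTime_setO_of_notMem h0 h1 hd hsep hu hz hω hy)]
      simp

/-- The factor of the visit probability is essential: summed over k excursions it makes the variance
of order √k rather than k. -/
theorem lintegral_excLocal_sq_le (h0 : 0 < γ) (h1 : γ ≤ 1) (hd : 20 * (d + 1) < h)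
    (hsep : Separated h zs) (x : ℤ) {u z : ℤ} (hu : u ∈ grid h zs) (hz : z ∈ closedBlock d u) :
    ∫⁻ ω, excLocal h d zs z ω ^ 2 ∂(Q γ x) ≤
      ENNReal.ofReal (2 * (h / γ) ^ 2) * ∫⁻ ω, visit h d zs u ω ∂(Q γ x) := by
  have hzC : z ∈ setC h d zs := mem_setC_iff.2 ⟨u, hu, hz⟩
  rw [lintegral_excLocal_pow h0 h1 hd hsep x hzC 2, ← lintegral_const_mul _ (measurable_visit u)]
  refine lintegral_mono_ae ?_
  filter_upwards [ae_hitPos_mem h0 h1 hd hsep x] with ω hω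
  by_cases hy : hitPos h d zs ω ∈ closedBlock d u
  · rw [visit, Set.indicator_of_mem hy, mul_one]
    exact lintegral_localTime_setO_sq_le h0 h1 hd hsep hu hz hy
  · rw [lintegral_congr_ae (g := fun _ => 0)]
    · simp
    · filter_upwards [lintegral_localTime_setO_of_notMem h0 h1 hd hsep hu hz hω hy] with ω' h2
      rw [h2]
      simp

end

section

variable {γ : ℝ} {L h d : ℕ} {zs : Fin L → ℤ}

/-! ### Decomposition into excursions -/

/-- All successive excursions of the path are finite. -/
def AllFinite {L : ℕ} (h d : ℕ) (zs : Fin L → ℤ) (ω : ℕ → ℤ) : Prop :=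
  ∀ j, excTime h d zs ((shiftBy (excTime h d zs))^[j] ω) ≠ ⊤

theorem ae_allFinite (h0 : 0 < γ) (h1 : γ ≤ 1) (hd : 20 * (d + 1) < h) (hsep : Separated h zs)
    (x : ℤ) : ∀ᵐ ω ∂(Q γ x), AllFinite h d zs ω :=
  ae_forall_shiftBy_iterate h0.le h1 (goodTime_excTime h0 h1 hd hsep)
    (measurable_excTime (MeasurableSet.singleton ⊤)).compl
    (goodTime_excTime h0 h1 hd hsep).ae_ne_top x

theorem depTime_succ (k : ℕ) (ω : ℕ → ℤ) : depTime h d zs (k + 1) ω =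
    depTime h d zs k ω + excTime h d zs (shift (depTime h d zs k ω).toNat ω) := rfl

theorem retTime_succ (k : ℕ) (ω : ℕ → ℤ) : retTime h d zs (k + 1) ω =
    depTime h d zs k ω + hitTime h d zs (shift (depTime h d zs k ω).toNat ω) := rfl

theorem AllFinite.depTime {ω : ℕ → ℤ} (hω : AllFinite h d zs ω) (k : ℕ) :
    depTime h d zs k ω ≠ ⊤ ∧
      shift (depTime h d zs k ω).toNat ω = (shiftBy (excTime h d zs))^[k] ω := by
  induction k with
  | zero => exact ⟨by simp [GridWalk.depTime], by simp [GridWalk.depTime, shift_zero]⟩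
  | succ k ih =>
    obtain ⟨h1, h2⟩ := ih
    rw [depTime_succ, h2, Function.iterate_succ_apply']
    refine ⟨by simp [h1, hω k], ?_⟩
    rw [ENat.toNat_add h1 (hω k), ← shift_shift, h2]
    rfl

theorem AllFinite.depTime_eq {ω : ℕ → ℤ} (hω : AllFinite h d zs ω) (k : ℕ) :
    (GridWalk.depTime h d zs k ω : ℝ≥0∞) =
      iterSum (excTime h d zs) (fun ω => (excTime h d zs ω : ℝ≥0∞)) k ω := by
  induction k with
  | zero => simp [GridWalk.depTime, iterSum]
  | succ k ih =>
    rw [depTime_succ, (hω.depTime k).2, ENat.toENNReal_add, ih, iterSum, iterSum,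
      Finset.sum_range_succ]

theorem AllFinite.localTime_eq {ω : ℕ → ℤ} (hω : AllFinite h d zs ω) (z : ℤ) (k : ℕ) :
    localTime z (GridWalk.depTime h d zs k ω) ω =
      iterSum (excTime h d zs) (excLocal h d zs z) k ω := by
  induction k with
  | zero =>
    simp [GridWalk.depTime, iterSum, localTime]
  | succ k ih =>
    obtain ⟨n, hn⟩ := ENat.ne_top_iff_exists.1 (hω.depTime k).1
    have h2 := (hω.depTime k).2
    rw [← hn, ENat.toNat_natCast] at h2
    rw [← hn] at ih
    rw [depTime_succ, (hω.depTime k).2, ← hn, localTime_add, ih, h2, iterSum, iterSum,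
      Finset.sum_range_succ, excLocal]

theorem AllFinite.visitCount_eq {ω : ℕ → ℤ} (hω : AllFinite h d zs ω) (u : ℤ) (k : ℕ) :
    visitCount h d zs (closedBlock d u) k ω =
      iterSum (excTime h d zs) (visit h d zs u) k ω := by
  classical
  unfold visitCount iterSum
  -- The return R_{j+1} belongs to the excursion that starts at D_j, hence the reindexing by one.
  rw [Finset.range_eq_Ico, Finset.sum_Ico_eq_sum_range, ← Finset.Ico_add_one_right_eq_Icc,
    Finset.sum_Ico_eq_sum_range]
  refine Finset.sum_congr (by simp) fun j _ => ?_
  rw [add_comm 1 j, zero_add, retTime_succ, (hω.depTime j).2]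
  have h1 := (hω.depTime j).1
  have h2 : hitTime h d zs ((shiftBy (excTime h d zs))^[j] ω) ≠ ⊤ := fun ht => by
    have := hω j
    rw [excTime_apply, ht] at this
    simp at this
  have h3 : hitPos h d zs ((shiftBy (excTime h d zs))^[j] ω) =
      ω ((GridWalk.depTime h d zs j ω).toNat +
        (hitTime h d zs ((shiftBy (excTime h d zs))^[j] ω)).toNat) := by
    rw [hitPos]
    conv_lhs => rw [← (hω.depTime j).2]
    rw [shift, (hω.depTime j).2]
  obtain ⟨m, hm⟩ := ENat.ne_top_iff_exists.1 h1
  obtain ⟨n, hn⟩ := ENat.ne_top_iff_exists.1 h2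
  rw [visit, h3, ← hm, ← hn, ENat.toNat_natCast, ENat.toNat_natCast, Set.indicator_apply]
  refine if_congr ?_ rfl rfl
  constructor
  · rintro ⟨i, hi, hi2⟩
    have : m + n = i := by exact_mod_cast hi
    rwa [this]
  · intro h4
    exact ⟨m + n, by push_cast; rfl, h4⟩

/-! ### The number of visits to a component -/

theorem iterSum_excPos_sub (k : ℕ) (ω : ℕ → ℤ) :
    iterSum (excTime h d zs) (fun ω => (excPos h d zs ω : ℝ) - ω 0) k ω =
      ((shiftBy (excTime h d zs))^[k] ω 0 : ℝ) - ω 0 := by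
  unfold iterSum
  have e : ∀ j, excPos h d zs ((shiftBy (excTime h d zs))^[j] ω) =
      (shiftBy (excTime h d zs))^[j + 1] ω 0 := fun j => by
    rw [Function.iterate_succ_apply', excPos]
  simp_rw [e]
  rw [Finset.sum_range_sub (fun j => ((shiftBy (excTime h d zs))^[j] ω 0 : ℝ))]
  simp

theorem lintegral_iterSum_le_of_le (h0 : 0 ≤ γ) (h1 : γ ≤ 1) {τ : (ℕ → ℤ) → ℕ∞}
    {F : (ℕ → ℤ) → ℝ≥0∞} {c : ℝ≥0∞} (hF : ∀ ω, F ω ≤ c) (k : ℕ) (x : ℤ) :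
    ∫⁻ ω, iterSum τ F k ω ∂(Q γ x) ≤ k * c := by
  have := isProbabilityMeasure_Q h0 h1 x
  calc _ ≤ ∫⁻ _, k * c ∂(Q γ x) := by
        refine lintegral_mono fun ω => ?_
        refine (Finset.sum_le_card_nsmul _ _ c fun j _ => hF _).trans ?_
        simp
    _ = _ := by simp

theorem ofReal_sq_rpow_half {a : ℝ} (ha : 0 ≤ a) :
    ENNReal.ofReal (a ^ 2) ^ (1 / 2 : ℝ) = ENNReal.ofReal a := by
  rw [ENNReal.ofReal_rpow_of_nonneg (by positivity) (by norm_num), ← Real.sqrt_eq_rpow,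
    Real.sqrt_sq ha]

/-- The displacement telescopes into centred increments bounded by 6h, so its L² norm is at most
6h√k. -/
theorem lintegral_abs_displacement_le (h0 : 0 < γ) (h1 : γ ≤ 1) (hd : 20 * (d + 1) < h)
    (hsep : Separated h zs) (k : ℕ) (x : ℤ) :
    ∫⁻ ω, ENNReal.ofReal |((shiftBy (excTime h d zs))^[k] ω 0 : ℝ) - ω 0| ∂(Q γ x) ≤
      ENNReal.ofReal (6 * h * √k) := by
  have hm : Measurable fun ω => (excPos h d zs ω : ℝ) - ω 0 :=
    ((Measurable.of_discrete (f := fun y : ℤ => (y : ℝ))).comp measurable_excPos).sub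
      ((Measurable.of_discrete (f := fun y : ℤ => (y : ℝ))).comp (measurable_pi_apply 0))
  have hloc : LocalAt (excTime h d zs) fun ω => (excPos h d zs ω : ℝ) - ω 0 :=
    fun ω₁ ω₂ n h2 h3 => by
      refine ⟨(localAt_shiftBy_zero ω₁ ω₂ n h2 h3).1, ?_⟩
      have := (localAt_shiftBy_zero ω₁ ω₂ n h2 h3).2
      simp only [excPos] at this ⊢
      rw [this, h3 0 (Nat.zero_le _)]
  have hv : ∀ y, ∫⁻ ω, ENNReal.ofReal (((excPos h d zs ω : ℝ) - ω 0) ^ 2) ∂(Q γ y) ≤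
      ENNReal.ofReal ((6 * h) ^ 2) := by
    intro y
    have := isProbabilityMeasure_Q h0.le h1 y
    calc _ ≤ ∫⁻ _, ENNReal.ofReal ((6 * h) ^ 2) ∂(Q γ y) := by
          refine lintegral_mono_ae ?_
          filter_upwards [ae_excPos h0 h1 hd hsep y, ae_start γ y] with ω h2 h3
          apply ENNReal.ofReal_le_ofReal
          rw [h3, ← sq_abs]
          have : |(excPos h d zs ω : ℝ) - y| ≤ 6 * h := by exact_mod_cast h2.2
          gcongr
      _ = _ := by simp
  have key := lintegral_abs_iterSum_le h0.le h1 (goodTime_excTime h0 h1 hd hsep) hm hloc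
    (fun y => ((hv y).trans_lt ENNReal.ofReal_lt_top).ne) k x
  simp_rw [iterSum_excPos_sub, integral_excPos_sub h0 h1 hd hsep, abs_zero, ENNReal.ofReal_zero]
    at key
  refine key.trans ?_
  have e : ∫⁻ ω, iterSum (excTime h d zs) (fun _ => (0 : ℝ≥0∞)) k ω ∂(Q γ x) = 0 := by
    simp [iterSum]
  rw [e, add_zero]
  calc _ ≤ (k * ENNReal.ofReal ((6 * h) ^ 2)) ^ (1 / 2 : ℝ) := by
        refine ENNReal.rpow_le_rpow ?_ (by norm_num)
        exact lintegral_iterSum_le_of_le h0.le h1 (fun ω => hv (ω 0)) k x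
    _ = ENNReal.ofReal ((6 * h * √k) ^ 2) ^ (1 / 2 : ℝ) := by
        congr 1
        rw [mul_pow (6 * (h : ℝ)), Real.sq_sqrt (by positivity), ENNReal.ofReal_mul (by positivity),
          ENNReal.ofReal_natCast, mul_comm]
    _ = _ := ofReal_sq_rpow_half (by positivity)

/-- Iterates the one-excursion Tanaka inequality: every visit to the block of u raises the mean
distance to u by at least h - d. -/
theorem le_lintegral_abs_iterate (h0 : 0 < γ) (h1 : γ ≤ 1) (hd : 20 * (d + 1) < h)
    (hsep : Separated h zs) {u : ℤ} (hu : u ∈ grid h zs) (k : ℕ) (x : ℤ) :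
    ENNReal.ofReal |(x : ℝ) - u| + ENNReal.ofReal (h - d) *
        ∫⁻ ω, iterSum (excTime h d zs) (visit h d zs u) k ω ∂(Q γ x) ≤
      ∫⁻ ω, ENNReal.ofReal |((shiftBy (excTime h d zs))^[k] ω 0 : ℝ) - u| ∂(Q γ x) := by
  have hτ := goodTime_excTime h0 h1 hd hsep
  induction k generalizing x with
  | zero =>
    have := isProbabilityMeasure_Q h0.le h1 x
    rw [lintegral_congr_ae (g := fun _ => ENNReal.ofReal |(x : ℝ) - u|)
      (f := fun ω : ℕ → ℤ => ENNReal.ofReal |((shiftBy (excTime h d zs))^[0] ω 0 : ℝ) - u|)]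
    · simp [iterSum]
    · filter_upwards [ae_start γ x] with ω hω
      simp [hω]
  | succ k ih =>
    simp_rw [Function.iterate_succ_apply]
    rw [lintegral_shiftBy h0.le h1 hτ x (F := fun ω =>
      ENNReal.ofReal |((shiftBy (excTime h d zs))^[k] ω 0 : ℝ) - u|)
      (measurable_lintegral_shiftBy hτ.measurable (fun y => ENNReal.ofReal |(y : ℝ) - u|) k),
      lintegral_iterSum_succ h0.le h1 hτ k x (measurable_visit u)]
    have hm : Measurable fun ω => ENNReal.ofReal |(excPos h d zs ω : ℝ) - u| :=
      (Measurable.of_discrete (f := fun y : ℤ => ENNReal.ofReal |(y : ℝ) - u|)).comp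
        measurable_excPos
    have hm2 : Measurable fun ω => ∫⁻ ω', iterSum (excTime h d zs) (visit h d zs u) k ω'
        ∂(Q γ (shiftBy (excTime h d zs) ω 0)) :=
      measurable_lintegral_shiftBy hτ.measurable (fun y => ∫⁻ ω',
        iterSum (excTime h d zs) (visit h d zs u) k ω' ∂(Q γ y)) 1
    calc _ = (ENNReal.ofReal |(x : ℝ) - u| +
          ENNReal.ofReal (h - d) * ∫⁻ ω, visit h d zs u ω ∂(Q γ x)) +
          ENNReal.ofReal (h - d) * ∫⁻ ω, ∫⁻ ω', iterSum (excTime h d zs) (visit h d zs u) k ω'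
            ∂(Q γ (shiftBy (excTime h d zs) ω 0)) ∂(Q γ x) := by ring
      _ ≤ ∫⁻ ω, ENNReal.ofReal |(excPos h d zs ω : ℝ) - u| ∂(Q γ x) +
          ENNReal.ofReal (h - d) * ∫⁻ ω, ∫⁻ ω', iterSum (excTime h d zs) (visit h d zs u) k ω'
            ∂(Q γ (shiftBy (excTime h d zs) ω 0)) ∂(Q γ x) := by
          gcongr
          exact le_lintegral_abs_excPos h0 h1 hd hsep x hu
      _ = ∫⁻ ω, (ENNReal.ofReal |(excPos h d zs ω : ℝ) - u| +
          ENNReal.ofReal (h - d) * ∫⁻ ω', iterSum (excTime h d zs) (visit h d zs u) k ω'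
            ∂(Q γ (shiftBy (excTime h d zs) ω 0))) ∂(Q γ x) := by
          rw [lintegral_add_left hm, lintegral_const_mul _ hm2]
      _ ≤ _ := lintegral_mono fun ω => ih _

theorem lintegral_iterSum_visit_le (h0 : 0 < γ) (h1 : γ ≤ 1) (hd : 20 * (d + 1) < h)
    (hsep : Separated h zs) {u : ℤ} (hu : u ∈ grid h zs) (k : ℕ) (x : ℤ) :
    ∫⁻ ω, iterSum (excTime h d zs) (visit h d zs u) k ω ∂(Q γ x) ≤
      ENNReal.ofReal (12 * √k) := by
  have := isProbabilityMeasure_Q h0.le h1 x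
  have hdh : 20 * ((d : ℝ) + 1) < h := by exact_mod_cast hd
  have hd0 : (0 : ℝ) ≤ d := Nat.cast_nonneg d
  have h2 := le_lintegral_abs_iterate h0 h1 hd hsep hu k x
  have h3 : ∫⁻ ω, ENNReal.ofReal |((shiftBy (excTime h d zs))^[k] ω 0 : ℝ) - u| ∂(Q γ x) ≤
      ENNReal.ofReal |(x : ℝ) - u| + ENNReal.ofReal (6 * h * √k) := by
    calc _ ≤ ∫⁻ ω, (ENNReal.ofReal |(x : ℝ) - u| +
          ENNReal.ofReal |((shiftBy (excTime h d zs))^[k] ω 0 : ℝ) - ω 0|) ∂(Q γ x) := by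
          refine lintegral_mono_ae ?_
          filter_upwards [ae_start γ x] with ω hω
          rw [hω, ← ENNReal.ofReal_add (abs_nonneg _) (abs_nonneg _)]
          apply ENNReal.ofReal_le_ofReal
          rw [add_comm]
          exact abs_sub_le _ _ _
      _ = ENNReal.ofReal |(x : ℝ) - u| + ∫⁻ ω,
          ENNReal.ofReal |((shiftBy (excTime h d zs))^[k] ω 0 : ℝ) - ω 0| ∂(Q γ x) := by
          rw [lintegral_add_left measurable_const]
          simp
      _ ≤ _ := by
          gcongr
          exact lintegral_abs_displacement_le h0 h1 hd hsep k x
  -- The initial distance |x - u| cancels, which makes the bound uniform in x and u. What remains is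
  -- 6h√k/(h - d), and h - d ≥ h/2.
  have h4 := (ENNReal.add_le_add_iff_left ENNReal.ofReal_ne_top).1 (h2.trans h3)
  have hpos : (0 : ℝ) < h - d := by linarith
  rw [mul_comm, ← ENNReal.le_div_iff_mul_le
      (Or.inl (ENNReal.ofReal_pos.2 hpos).ne') (Or.inl ENNReal.ofReal_ne_top),
    ← ENNReal.ofReal_div_of_pos hpos] at h4
  refine h4.trans (ENNReal.ofReal_le_ofReal ?_)
  rw [div_le_iff₀ hpos]
  have : (0 : ℝ) ≤ √k := Real.sqrt_nonneg _
  nlinarith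

end

section

variable {γ : ℝ} {L h d : ℕ} {zs : Fin L → ℤ}

/-! ### The departure times -/

theorem star_mem_grid (ℓ : Fin L) : zs ℓ ∈ grid h zs := Or.inl ⟨ℓ, rfl⟩

/-- Only the first excursion can start away from the departure set, and it pays the crude bound
once; all later ones start at distance h from the grid, where the bias is controlled by visits to
special blocks. -/
theorem ae_iterSum_mean_le (h0 : 0 < γ) (h1 : γ ≤ 1) (hd : 20 * (d + 1) < h)
    (hsep : Separated h zs) (k : ℕ) (x : ℤ) :
    ∀ᵐ ω ∂(Q γ x), iterSum (excTime h d zs) (fun ω => ENNReal.ofReal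
        |∫ ω', (excReal h d zs ω' - meanExcursion γ h d) ∂(Q γ (ω 0))|) k ω ≤
      ENNReal.ofReal (5 * (h ^ 2 / γ)) + ENNReal.ofReal (25 * (h ^ 2 / γ)) *
        ∑ ℓ, iterSum (excTime h d zs) (fun ω => ∫⁻ ω', visit h d zs (zs ℓ) ω' ∂(Q γ (ω 0))) k ω := by
  filter_upwards [ae_forall_shiftBy_iterate h0.le h1 (goodTime_excTime h0 h1 hd hsep)
    (P := fun ω => excPos h d zs ω ∈ departureSet h zs)
    (measurable_excPos (MeasurableSet.of_discrete (s := departureSet h zs)))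
    (fun y => by filter_upwards [ae_excPos h0 h1 hd hsep y] with ω hω using hω.1) x] with ω hω
  unfold iterSum
  rw [Finset.sum_comm, Finset.mul_sum]
  cases k with
  | zero => simp
  | succ k =>
    rw [Finset.sum_range_succ', Finset.sum_range_succ' (fun j => ENNReal.ofReal _ * _), add_comm,
      add_comm (∑ j ∈ Finset.range k, ENNReal.ofReal _ * _), ← add_assoc]
    refine add_le_add (le_add_right ?_) (Finset.sum_le_sum fun j _ => ?_)
    · exact ENNReal.ofReal_le_ofReal (abs_integral_excReal_sub_le h0 h1 hd hsep _)
    · refine abs_integral_excReal_sub_le_of_mem h0 h1 hd hsep ?_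
      have := hω j
      rw [Function.iterate_succ_apply']
      exact this

/-- Concentration of the departure times, in mean. -/
theorem lintegral_abs_iterSum_excReal_le (h0 : 0 < γ) (h1 : γ ≤ 1) (hd : 20 * (d + 1) < h)
    (hsep : Separated h zs) (k : ℕ) (x : ℤ) :
    ∫⁻ ω, ENNReal.ofReal |iterSum (excTime h d zs)
        (fun ω => excReal h d zs ω - meanExcursion γ h d) k ω| ∂(Q γ x) ≤
      ENNReal.ofReal (h ^ 2 / γ * (5 + (12 + 300 * L) * √k)) := by
  have hτ := goodTime_excTime h0 h1 hd hsep
  have := isProbabilityMeasure_Q h0.le h1 x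
  have hv := lintegral_excReal_sub_sq_le h0 h1 hd hsep
  have key := lintegral_abs_iterSum_le h0.le h1 hτ (measurable_excReal.sub_const _)
    (localAt_excTime.comp fun t => (t : ℝ≥0∞).toReal - meanExcursion γ h d)
    (fun y => ((hv y).trans_lt ENNReal.ofReal_lt_top).ne) k x
  refine key.trans ?_
  -- The 12 dominates √140 in the martingale part; each special point contributes 25 · 12 = 300 to
  -- the drift, and 5 comes from the first excursion.
  have e1 : h ^ 2 / γ * (5 + (12 + 300 * L) * √k) = 12 * (h ^ 2 / γ) * √k +
      (5 * (h ^ 2 / γ) + 25 * (h ^ 2 / γ) * (L * (12 * √k))) := by ring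
  rw [e1, ENNReal.ofReal_add (by positivity) (by positivity)]
  refine add_le_add ?_ ?_
  · calc _ ≤ (k * ENNReal.ofReal (140 * (h ^ 2 / γ) ^ 2)) ^ (1 / 2 : ℝ) := by
          refine ENNReal.rpow_le_rpow ?_ (by norm_num)
          exact lintegral_iterSum_le_of_le h0.le h1 (fun ω => hv (ω 0)) k x
      _ ≤ ENNReal.ofReal ((12 * (h ^ 2 / γ) * √k) ^ 2) ^ (1 / 2 : ℝ) := by
          refine ENNReal.rpow_le_rpow ?_ (by norm_num)
          rw [← ENNReal.ofReal_natCast, ← ENNReal.ofReal_mul (by positivity),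
            mul_pow (12 * ((h : ℝ) ^ 2 / γ)), Real.sq_sqrt (by positivity)]
          apply ENNReal.ofReal_le_ofReal
          have : 0 ≤ ((h : ℝ) ^ 2 / γ) ^ 2 * k := by positivity
          linarith
      _ = _ := ofReal_sq_rpow_half (by positivity)
  · refine (lintegral_mono_ae (ae_iterSum_mean_le h0 h1 hd hsep k x)).trans ?_
    have hm : ∀ ℓ, Measurable fun ω => iterSum (excTime h d zs)
        (fun ω => ∫⁻ ω', visit h d zs (zs ℓ) ω' ∂(Q γ (ω 0))) k ω := fun ℓ =>
      measurable_iterSum hτ.measurable ((Measurable.of_discrete (f := fun y =>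
        ∫⁻ ω', visit h d zs (zs ℓ) ω' ∂(Q γ y))).comp (measurable_pi_apply 0)) k
    rw [lintegral_add_left measurable_const, lintegral_const_mul _ (Finset.measurable_sum _
      fun ℓ _ => hm ℓ), lintegral_finsetSum _ fun ℓ _ => hm ℓ,
      ENNReal.ofReal_add (by positivity) (by positivity),
      ENNReal.ofReal_mul (p := 25 * ((h : ℝ) ^ 2 / γ)) (by positivity)]
    refine add_le_add (by simp) ?_
    gcongr
    calc _ ≤ ∑ _ℓ : Fin L, ENNReal.ofReal (12 * √k) := by
          refine Finset.sum_le_sum fun ℓ _ => ?_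
          rw [← lintegral_iterSum h0.le h1 hτ k x (measurable_visit (zs ℓ))]
          exact lintegral_iterSum_visit_le h0 h1 hd hsep (star_mem_grid ℓ) k x
      _ = _ := by
          rw [ENNReal.ofReal_mul (p := (L : ℝ)) (by positivity), ENNReal.ofReal_natCast]
          simp

theorem AllFinite.iterSum_excReal {ω : ℕ → ℤ} (hω : AllFinite h d zs ω) (t : ℝ) (k : ℕ) :
    iterSum (excTime h d zs) (fun ω => excReal h d zs ω - t) k ω =
      (GridWalk.depTime h d zs k ω).toNat - k * t := by
  have h2 : (iterSum (excTime h d zs) (fun ω => (excTime h d zs ω : ℝ≥0∞)) k ω).toReal =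
      ∑ j ∈ Finset.range k, excReal h d zs ((shiftBy (excTime h d zs))^[j] ω) := by
    unfold iterSum
    rw [ENNReal.toReal_sum]
    · rfl
    · intro j _
      simpa using hω j
  rw [← hω.depTime_eq] at h2
  obtain ⟨n, hn⟩ := ENat.ne_top_iff_exists.1 (hω.depTime k).1
  rw [← hn] at h2 ⊢
  simp only [iterSum, Finset.sum_sub_distrib, ← h2]
  simp

/-! ### Local times -/

theorem localTime_le (z : ℤ) (n : ℕ∞) (ω : ℕ → ℤ) : localTime z n ω ≤ n := by
  classical
  rw [toENNReal_eq_tsum]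
  unfold localTime
  refine ENNReal.tsum_le_tsum fun m => ?_
  by_cases h1 : (m : ℕ∞) < n <;> by_cases h2 : ω m = z <;> simp [h1, h2]

theorem localTime_mono (z : ℤ) {m n : ℕ∞} (hmn : m ≤ n) (ω : ℕ → ℤ) :
    localTime z m ω ≤ localTime z n ω := by
  unfold localTime
  refine ENNReal.tsum_le_tsum fun i => ?_
  by_cases h1 : (i : ℕ∞) < m
  · have h2 := h1.trans_le hmn
    simp [h1, h2]
  · simp [h1]

theorem lintegral_iterSum_excLocal_le (h0 : 0 < γ) (h1 : γ ≤ 1) (hd : 20 * (d + 1) < h)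
    (hsep : Separated h zs) {u z : ℤ} (hu : u ∈ grid h zs) (hz : z ∈ closedBlock d u) (k : ℕ)
    (x : ℤ) :
    ∫⁻ ω, iterSum (excTime h d zs) (excLocal h d zs z) k ω ∂(Q γ x) ≤
      ENNReal.ofReal (24 * (h / γ) * √k) := by
  have hτ := goodTime_excTime h0 h1 hd hsep
  have hdh : 20 * ((d : ℝ) + 1) < h := by exact_mod_cast hd
  have hd0 : (0 : ℝ) ≤ d := Nat.cast_nonneg d
  have hm : Measurable fun ω : ℕ → ℤ => ∫⁻ ω', visit h d zs u ω' ∂(Q γ (ω 0)) :=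
    (Measurable.of_discrete (f := fun y => ∫⁻ ω', visit h d zs u ω' ∂(Q γ y))).comp
      (measurable_pi_apply 0)
  rw [lintegral_iterSum h0.le h1 hτ k x (measurable_excLocal z)]
  calc _ ≤ ∫⁻ ω, ENNReal.ofReal (2 * (h / γ)) * iterSum (excTime h d zs)
        (fun ω => ∫⁻ ω', visit h d zs u ω' ∂(Q γ (ω 0))) k ω ∂(Q γ x) := by
        refine lintegral_mono fun ω => ?_
        unfold iterSum
        rw [Finset.mul_sum]
        refine Finset.sum_le_sum fun j _ => ?_
        refine (lintegral_excLocal_bounds h0 h1 hd hsep _ hu hz).2.trans ?_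
        gcongr
        rw [← mul_div_assoc]
        gcongr
        linarith
    _ = ENNReal.ofReal (2 * (h / γ)) *
        ∫⁻ ω, iterSum (excTime h d zs) (visit h d zs u) k ω ∂(Q γ x) := by
        rw [lintegral_const_mul _ (measurable_iterSum hτ.measurable hm k),
          ← lintegral_iterSum h0.le h1 hτ k x (measurable_visit u)]
    _ ≤ ENNReal.ofReal (2 * (h / γ)) * ENNReal.ofReal (12 * √k) := by
        gcongr
        exact lintegral_iterSum_visit_le h0 h1 hd hsep hu k x
    _ = _ := by
        rw [← ENNReal.ofReal_mul (by positivity)]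
        congr 1
        ring

/-- The local time at `z` collected during an excursion, compensated by the visits. -/
def excDiff {L : ℕ} (γ : ℝ) (h d : ℕ) (zs : Fin L → ℤ) (u z : ℤ) (ω : ℕ → ℤ) : ℝ :=
  (excLocal h d zs z ω).toReal - h / γ * (visit h d zs u ω).toReal

theorem measurable_excDiff (u z : ℤ) : Measurable (excDiff γ h d zs u z) :=
  (measurable_excLocal z).ennreal_toReal.sub ((measurable_visit u).ennreal_toReal.const_mul _)

theorem localAt_excDiff (u z : ℤ) : LocalAt (excTime h d zs) (excDiff γ h d zs u z) :=
  ((localAt_localTime z).prodMk localAt_hitPos).comp fun p : ℝ≥0∞ × ℤ =>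
    p.1.toReal - h / γ * ((closedBlock d u).indicator (fun _ => (1 : ℝ≥0∞)) p.2).toReal

theorem lintegral_visit_ne_top (h0 : 0 < γ) (h1 : γ ≤ 1) (u x : ℤ) :
    ∫⁻ ω, visit h d zs u ω ∂(Q γ x) ≠ ⊤ := by
  have := isProbabilityMeasure_Q h0.le h1 x
  refine ne_top_of_le_ne_top ENNReal.one_ne_top
    ((lintegral_mono (g := fun _ => 1) (visit_le_one u)).trans ?_)
  simp

theorem lintegral_excDiff_sq_le (h0 : 0 < γ) (h1 : γ ≤ 1) (hd : 20 * (d + 1) < h)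
    (hsep : Separated h zs) {u z : ℤ} (hu : u ∈ grid h zs) (hz : z ∈ closedBlock d u) (x : ℤ) :
    ∫⁻ ω, ENNReal.ofReal (excDiff γ h d zs u z ω ^ 2) ∂(Q γ x) ≤
      ENNReal.ofReal (3 * (h / γ) ^ 2) * ∫⁻ ω, visit h d zs u ω ∂(Q γ x) := by
  calc _ ≤ ∫⁻ ω, (excLocal h d zs z ω ^ 2 + ENNReal.ofReal ((h / γ) ^ 2) * visit h d zs u ω)
        ∂(Q γ x) := by
        refine lintegral_mono fun ω => ?_
        have n1 : 0 ≤ (excLocal h d zs z ω).toReal := ENNReal.toReal_nonneg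
        have n2 : (0 : ℝ) ≤ h / γ := by positivity
        have e1 : ENNReal.ofReal ((excLocal h d zs z ω).toReal ^ 2) ≤ excLocal h d zs z ω ^ 2 := by
          rw [ENNReal.ofReal_pow n1]
          gcongr
          exact ENNReal.ofReal_toReal_le
        unfold excDiff visit
        by_cases hy : hitPos h d zs ω ∈ closedBlock d u
        · rw [Set.indicator_of_mem hy, ENNReal.toReal_one, mul_one, mul_one]
          refine le_trans ?_ (add_le_add_left e1 _)
          rw [← ENNReal.ofReal_add (by positivity) (by positivity)]
          apply ENNReal.ofReal_le_ofReal
          -- Again the cross term has a favourable sign; the constant 3 is 2 from the local time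
          -- plus 1 from the visit.
          nlinarith [mul_nonneg n1 n2]
        · rw [Set.indicator_of_notMem hy]
          simpa using e1
    _ = ∫⁻ ω, excLocal h d zs z ω ^ 2 ∂(Q γ x) +
        ENNReal.ofReal ((h / γ) ^ 2) * ∫⁻ ω, visit h d zs u ω ∂(Q γ x) := by
        rw [lintegral_add_left ((measurable_excLocal z).pow_const 2),
          lintegral_const_mul _ (measurable_visit u)]
    _ ≤ ENNReal.ofReal (2 * (h / γ) ^ 2) * ∫⁻ ω, visit h d zs u ω ∂(Q γ x) +
        ENNReal.ofReal ((h / γ) ^ 2) * ∫⁻ ω, visit h d zs u ω ∂(Q γ x) := by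
        gcongr
        exact lintegral_excLocal_sq_le h0 h1 hd hsep x hu hz
    _ = _ := by
        rw [← add_mul, ← ENNReal.ofReal_add (by positivity) (by positivity)]
        congr 2
        ring

theorem abs_integral_excDiff_le (h0 : 0 < γ) (h1 : γ ≤ 1) (hd : 20 * (d + 1) < h)
    (hsep : Separated h zs) {u z : ℤ} (hu : u ∈ grid h zs) (hz : z ∈ closedBlock d u) (x : ℤ) :
    ENNReal.ofReal |∫ ω, excDiff γ h d zs u z ω ∂(Q γ x)| ≤
      ENNReal.ofReal (3 * d / γ) * ∫⁻ ω, visit h d zs u ω ∂(Q γ x) := by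
  have hdh : 20 * ((d : ℝ) + 1) < h := by exact_mod_cast hd
  have hd0 : (0 : ℝ) ≤ d := Nat.cast_nonneg d
  have hp := lintegral_visit_ne_top (h := h) (d := d) (zs := zs) h0 h1 u x
  obtain ⟨b1, b2⟩ := lintegral_excLocal_bounds h0 h1 hd hsep x hu hz
  have hl : ∫⁻ ω, excLocal h d zs z ω ∂(Q γ x) ≠ ⊤ :=
    ne_top_of_le_ne_top (ENNReal.mul_ne_top ENNReal.ofReal_ne_top hp) b2
  have mL := measurable_excLocal (h := h) (d := d) (zs := zs) z
  have mV := measurable_visit (h := h) (d := d) (zs := zs) u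
  have e : ∫ ω, excDiff γ h d zs u z ω ∂(Q γ x) =
      (∫⁻ ω, excLocal h d zs z ω ∂(Q γ x)).toReal -
        h / γ * (∫⁻ ω, visit h d zs u ω ∂(Q γ x)).toReal := by
    unfold excDiff
    rw [integral_sub (integrable_toReal_of_lintegral_ne_top mL.aemeasurable hl)
      ((integrable_toReal_of_lintegral_ne_top mV.aemeasurable hp).const_mul _),
      integral_const_mul, integral_toReal mL.aemeasurable (ae_lt_top mL hl),
      integral_toReal mV.aemeasurable (ae_lt_top mV hp)]
  set p := (∫⁻ ω, visit h d zs u ω ∂(Q γ x)).toReal with hpdef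
  have p0 : 0 ≤ p := ENNReal.toReal_nonneg
  have b1' := ENNReal.toReal_mono hl b1
  have b2' := ENNReal.toReal_mono (ENNReal.mul_ne_top ENNReal.ofReal_ne_top hp) b2
  rw [ENNReal.toReal_mul, ENNReal.toReal_ofReal (div_nonneg (by linarith) h0.le)] at b1'
  rw [ENNReal.toReal_mul, ENNReal.toReal_ofReal (by positivity)] at b2'
  rw [e, ← ENNReal.ofReal_toReal hp, ← ENNReal.ofReal_mul (by positivity)]
  apply ENNReal.ofReal_le_ofReal
  rw [← hpdef] at b1' b2' ⊢
  rw [sub_div, sub_mul] at b1'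
  rw [add_div, add_mul] at b2'
  rw [abs_le]
  constructor <;> linarith

/-- Comparison of local times with the number of visits, in mean. -/
theorem lintegral_abs_iterSum_excDiff_le (h0 : 0 < γ) (h1 : γ ≤ 1) (hd : 20 * (d + 1) < h)
    (hsep : Separated h zs) {u z : ℤ} (hu : u ∈ grid h zs) (hz : z ∈ closedBlock d u) (k : ℕ)
    (x : ℤ) :
    ∫⁻ ω, ENNReal.ofReal |iterSum (excTime h d zs) (excDiff γ h d zs u z) k ω| ∂(Q γ x) ≤
      ENNReal.ofReal (6 * (h / γ) * √(√k) + 36 * (d / γ) * √k) := by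
  have hτ := goodTime_excTime h0 h1 hd hsep
  have hp := lintegral_visit_ne_top (h := h) (d := d) (zs := zs) h0 h1 u
  have hv := lintegral_excDiff_sq_le h0 h1 hd hsep hu hz
  have hmv : Measurable fun ω : ℕ → ℤ => ∫⁻ ω', visit h d zs u ω' ∂(Q γ (ω 0)) :=
    (Measurable.of_discrete (f := fun y => ∫⁻ ω', visit h d zs u ω' ∂(Q γ y))).comp
      (measurable_pi_apply 0)
  have hV : ∫⁻ ω, iterSum (excTime h d zs) (fun ω => ∫⁻ ω', visit h d zs u ω' ∂(Q γ (ω 0))) k ω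
      ∂(Q γ x) ≤ ENNReal.ofReal (12 * √k) := by
    rw [← lintegral_iterSum h0.le h1 hτ k x (measurable_visit u)]
    exact lintegral_iterSum_visit_le h0 h1 hd hsep hu k x
  have hlin : ∀ (c : ℝ) (hc : 0 ≤ c) (F : (ℕ → ℤ) → ℝ≥0∞),
      (∀ ω, F ω ≤ ENNReal.ofReal c * ∫⁻ ω', visit h d zs u ω' ∂(Q γ (ω 0))) →
      ∫⁻ ω, iterSum (excTime h d zs) F k ω ∂(Q γ x) ≤ ENNReal.ofReal (c * (12 * √k)) := by
    intro c hc F hF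
    rw [ENNReal.ofReal_mul hc]
    refine le_trans ?_ (mul_le_mul_right hV _)
    rw [← lintegral_const_mul _ (measurable_iterSum hτ.measurable hmv k)]
    refine lintegral_mono fun ω => ?_
    unfold iterSum
    rw [Finset.mul_sum]
    exact Finset.sum_le_sum fun j _ => hF _
  refine (lintegral_abs_iterSum_le h0.le h1 hτ (measurable_excDiff u z) (localAt_excDiff u z)
    (fun y => ne_top_of_le_ne_top (ENNReal.mul_ne_top ENNReal.ofReal_ne_top (hp y)) (hv y))
    k x).trans ?_
  rw [ENNReal.ofReal_add (by positivity) (by positivity)]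
  refine add_le_add ?_ ?_
  -- The variance is at most 3(h/γ)² · 12√k, with square root 6(h/γ)k^{1/4}; the drift below is 3d/γ
  -- · 12√k.
  · rw [← ofReal_sq_rpow_half (by positivity)]
    refine ENNReal.rpow_le_rpow ?_ (by norm_num)
    refine (hlin _ (by positivity) _ fun ω => hv (ω 0)).trans (ENNReal.ofReal_le_ofReal ?_)
    rw [mul_pow (6 * ((h : ℝ) / γ)), Real.sq_sqrt (Real.sqrt_nonneg _)]
    apply le_of_eq
    ring
  · refine (hlin _ (by positivity) _ fun ω => abs_integral_excDiff_le h0 h1 hd hsep hu hz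
      (ω 0)).trans (ENNReal.ofReal_le_ofReal (le_of_eq ?_))
    ring

theorem absDiff_ofReal {a b : ℝ} (ha : 0 ≤ a) (hb : 0 ≤ b) :
    absDiff (ENNReal.ofReal a) (ENNReal.ofReal b) = ENNReal.ofReal |a - b| := by
  unfold absDiff
  rw [← ENNReal.ofReal_sub _ hb, ← ENNReal.ofReal_sub _ ha]
  rcases le_total a b with hab | hab
  · rw [ENNReal.ofReal_of_nonpos (by linarith : a - b ≤ 0), zero_add,
      abs_of_nonpos (by linarith), neg_sub]
  · rw [ENNReal.ofReal_of_nonpos (by linarith : b - a ≤ 0), add_zero,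
      abs_of_nonneg (by linarith)]

theorem AllFinite.absDiff_eq (h0 : 0 < γ) {ω : ℕ → ℤ} (hω : AllFinite h d zs ω) (u z : ℤ)
    (k : ℕ) :
    absDiff (localTime z (GridWalk.depTime h d zs k ω) ω)
        (ENNReal.ofReal (h / γ) * visitCount h d zs (closedBlock d u) k ω) =
      ENNReal.ofReal |iterSum (excTime h d zs) (excDiff γ h d zs u z) k ω| := by
  have f1 : ∀ j, excLocal h d zs z ((shiftBy (excTime h d zs))^[j] ω) ≠ ⊤ := fun j =>
    ne_top_of_le_ne_top (by simpa using hω j) (localTime_le z _ _)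
  have f2 : ∀ j, visit h d zs u ((shiftBy (excTime h d zs))^[j] ω) ≠ ⊤ := fun j =>
    ne_top_of_le_ne_top ENNReal.one_ne_top (visit_le_one u _)
  have e1 : iterSum (excTime h d zs) (excLocal h d zs z) k ω =
      ENNReal.ofReal (iterSum (excTime h d zs) (fun ω => (excLocal h d zs z ω).toReal) k ω) := by
    unfold iterSum
    rw [ENNReal.ofReal_sum_of_nonneg fun j _ => ENNReal.toReal_nonneg]
    exact Finset.sum_congr rfl fun j _ => (ENNReal.ofReal_toReal (f1 j)).symm
  have e2 : iterSum (excTime h d zs) (visit h d zs u) k ω =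
      ENNReal.ofReal (iterSum (excTime h d zs) (fun ω => (visit h d zs u ω).toReal) k ω) := by
    unfold iterSum
    rw [ENNReal.ofReal_sum_of_nonneg fun j _ => ENNReal.toReal_nonneg]
    exact Finset.sum_congr rfl fun j _ => (ENNReal.ofReal_toReal (f2 j)).symm
  have n1 : 0 ≤ iterSum (excTime h d zs) (fun ω => (excLocal h d zs z ω).toReal) k ω :=
    Finset.sum_nonneg fun j _ => ENNReal.toReal_nonneg
  have n2 : 0 ≤ iterSum (excTime h d zs) (fun ω => (visit h d zs u ω).toReal) k ω :=
    Finset.sum_nonneg fun j _ => ENNReal.toReal_nonneg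
  rw [hω.localTime_eq, hω.visitCount_eq, e1, e2, ← ENNReal.ofReal_mul (by positivity),
    absDiff_ofReal n1 (by positivity)]
  congr 2
  simp only [iterSum, excDiff, Finset.sum_sub_distrib, Finset.mul_sum]

end

section

variable {γ ρ : ℝ} {L a h d : ℕ} {zs : Fin L → ℤ}

/-! ### Calibration -/

theorem meanExcursion_pos (h0 : 0 < γ) (h1 : γ ≤ 1) (hd : 20 * (d + 1) < h) :
    0 < meanExcursion γ h d := by
  refine lt_of_lt_of_le ?_ (le_meanExcursion h0 h1 hd)
  have : (0 : ℝ) < h := by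
    have : 0 < h := by omega
    exact_mod_cast this
  positivity

theorem sigma_mul_le (h0 : 0 < γ) (h1 : γ ≤ 1) (hρ : 0 < ρ) (hd : 20 * (d + 1) < h) (a : ℕ) :
    sigma γ ρ a h d * meanExcursion γ h d ≤ ρ * (a : ℝ) ^ 2 := by
  have ht := meanExcursion_pos h0 h1 hd
  have := Nat.floor_le (a := ρ * ((a : ℝ) ^ 2 / meanExcursion γ h d)) (by positivity)
  rw [← mul_div_assoc, le_div_iff₀ ht] at this
  rwa [sigma, ← mul_div_assoc]

theorem lt_sigma_add_one_mul (h0 : 0 < γ) (h1 : γ ≤ 1) (hd : 20 * (d + 1) < h) (ρ : ℝ) (a : ℕ) :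
    ρ * (a : ℝ) ^ 2 < (sigma γ ρ a h d + 1) * meanExcursion γ h d := by
  have ht := meanExcursion_pos h0 h1 hd
  have := Nat.lt_floor_add_one (ρ * ((a : ℝ) ^ 2 / meanExcursion γ h d))
  rw [← mul_div_assoc, div_lt_iff₀ ht] at this
  rwa [sigma, ← mul_div_assoc]

/-- Combines σ t_N ≤ ρa² with t_N ≥ h²/γ. It is the only bridge between the excursion scale h√σ and
the scale a. -/
theorem mul_sqrt_sigma_le (h0 : 0 < γ) (h1 : γ ≤ 1) (hρ : 0 < ρ) (hd : 20 * (d + 1) < h) (a : ℕ) :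
    h * √(sigma γ ρ a h d) ≤ √(ρ * γ) * a := by
  have h2 := sigma_mul_le h0 h1 hρ hd a
  have h3 := le_meanExcursion h0 h1 hd
  have h4 : (sigma γ ρ a h d : ℝ) * (h ^ 2 / γ) ≤ ρ * a ^ 2 :=
    (mul_le_mul_of_nonneg_left h3 (Nat.cast_nonneg _)).trans h2
  rw [← mul_div_assoc, div_le_iff₀ h0] at h4
  refine (sq_le_sq₀ (by positivity) (by positivity)).1 ?_
  rw [mul_pow, mul_pow, Real.sq_sqrt (by positivity), Real.sq_sqrt (by positivity)]
  linarith

/-- The fourth root of `σ`. -/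
def rootSigma (γ ρ : ℝ) (a h d : ℕ) : ℝ := √(√(sigma γ ρ a h d))

theorem rootSigma_sq : rootSigma γ ρ a h d ^ 2 = √(sigma γ ρ a h d) :=
  Real.sq_sqrt (Real.sqrt_nonneg _)

theorem rootSigma_pow_four : rootSigma γ ρ a h d ^ 4 = sigma γ ρ a h d := by
  rw [show (4 : ℕ) = 2 * 2 from rfl, pow_mul, rootSigma_sq, Real.sq_sqrt (Nat.cast_nonneg _)]

theorem rootSigma_nonneg : 0 ≤ rootSigma γ ρ a h d := Real.sqrt_nonneg _

theorem sigma_rpow : (sigma γ ρ a h d : ℝ) ^ (3 / 4 : ℝ) = rootSigma γ ρ a h d ^ 3 := by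
  rw [← rootSigma_pow_four, ← Real.rpow_natCast, ← Real.rpow_mul rootSigma_nonneg,
    ← Real.rpow_natCast]
  norm_num

/-- The integer part of `σ^{3/4}`. -/
def gapSigma (γ ρ : ℝ) (a h d : ℕ) : ℕ := ⌊rootSigma γ ρ a h d ^ 3⌋₊

theorem kLow_eq : kLow γ ρ a h d = sigma γ ρ a h d - gapSigma γ ρ a h d := by
  rw [kLow, sigma_rpow, gapSigma]

theorem kHigh_eq : kHigh γ ρ a h d = sigma γ ρ a h d + gapSigma γ ρ a h d := by
  rw [kHigh, sigma_rpow, gapSigma]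

theorem kLow_le : kLow γ ρ a h d ≤ sigma γ ρ a h d := Nat.sub_le _ _

theorem gapSigma_le : (gapSigma γ ρ a h d : ℝ) ≤ rootSigma γ ρ a h d ^ 3 :=
  Nat.floor_le (pow_nonneg rootSigma_nonneg 3)

theorem gapSigma_le_sigma (hq : 2 ≤ rootSigma γ ρ a h d) :
    gapSigma γ ρ a h d ≤ sigma γ ρ a h d := by
  have h2 : (gapSigma γ ρ a h d : ℝ) ≤ sigma γ ρ a h d := by
    refine gapSigma_le.trans ?_
    rw [← rootSigma_pow_four]
    exact pow_le_pow_right₀ (by linarith) (by norm_num)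
  exact_mod_cast h2

/-! ### Concentration of the departure times -/

/-- Markov's inequality with q = σ^{1/4}: since √k ≤ 2q², the mean deviation is at most (29 + 600L)
q² t_N, against a threshold q³ t_N/2. -/
theorem measure_abs_iterSum_ge_le (h0 : 0 < γ) (h1 : γ ≤ 1) (hd : 20 * (d + 1) < h)
    (hsep : Separated h zs) {k : ℕ} (hq : 2 ≤ rootSigma γ ρ a h d)
    (hk : k ≤ 2 * sigma γ ρ a h d) :
    Q γ 0 {ω | ENNReal.ofReal (rootSigma γ ρ a h d ^ 3 / 2 * meanExcursion γ h d) ≤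
        ENNReal.ofReal |iterSum (excTime h d zs)
          (fun ω => excReal h d zs ω - meanExcursion γ h d) k ω|} ≤
      ENNReal.ofReal (2 * (29 + 600 * L) / rootSigma γ ρ a h d) := by
  have ht := meanExcursion_pos h0 h1 hd
  have hle := le_meanExcursion h0 h1 hd
  have hkq : √(k : ℝ) ≤ 2 * rootSigma γ ρ a h d ^ 2 := by
    rw [Real.sqrt_le_left (by positivity)]
    have : (k : ℝ) ≤ 2 * sigma γ ρ a h d := by exact_mod_cast hk
    rw [← rootSigma_pow_four] at this
    nlinarith [pow_nonneg (rootSigma_nonneg (γ := γ) (ρ := ρ) (a := a) (h := h) (d := d)) 4]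
  set q := rootSigma γ ρ a h d
  set t := meanExcursion γ h d
  have hq0 : 0 < q := by linarith
  have hm : Measurable fun ω => ENNReal.ofReal |iterSum (excTime h d zs)
      (fun ω => excReal h d zs ω - t) k ω| := by
    have := measurable_iterSum (τ := excTime h d zs) measurable_excTime
      ((measurable_excReal (h := h) (d := d) (zs := zs)).sub_const t) k
    fun_prop
  refine (meas_ge_le_lintegral_div hm.aemeasurable
    (ENNReal.ofReal_pos.2 (by positivity)).ne' ENNReal.ofReal_ne_top).trans ?_
  refine (ENNReal.div_le_div_right (lintegral_abs_iterSum_excReal_le h0 h1 hd hsep k 0) _).trans ?_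
  rw [← ENNReal.ofReal_div_of_pos (by positivity)]
  apply ENNReal.ofReal_le_ofReal
  rw [div_le_div_iff₀ (by positivity) hq0]
  have e1 : (h : ℝ) ^ 2 / γ * (5 + (12 + 300 * L) * √k) ≤ t * ((29 + 600 * L) * q ^ 2) := by
    refine mul_le_mul hle ?_ (by positivity) ht.le
    have : (12 + 300 * (L : ℝ)) * √k ≤ (12 + 300 * L) * (2 * q ^ 2) := by gcongr
    nlinarith
  calc _ ≤ t * ((29 + 600 * L) * q ^ 2) * q := by gcongr
    _ = _ := by ring

theorem measure_compl_good_le (h0 : 0 < γ) (h1 : γ ≤ 1) (hρ : 0 < ρ) (hd : 20 * (d + 1) < h)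
    (hsep : Separated h zs) (hq : 2 ≤ rootSigma γ ρ a h d) :
    Q γ 0 {ω | depTime h d zs (kLow γ ρ a h d) ω ≤ (timeT ρ a : ℕ∞) ∧
        (timeT ρ a : ℕ∞) ≤ depTime h d zs (kHigh γ ρ a h d) ω}ᶜ ≤
      ENNReal.ofReal (4 * (29 + 600 * L) / rootSigma γ ρ a h d) := by
  have ht := meanExcursion_pos h0 h1 hd
  have hmσ := gapSigma_le_sigma hq
  have s1 := sigma_mul_le h0 h1 hρ hd a
  have s2 := lt_sigma_add_one_mul h0 h1 hd ρ a
  have b1 := measure_abs_iterSum_ge_le h0 h1 hd hsep (k := kLow γ ρ a h d) hq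
    (by have := kLow_le (γ := γ) (ρ := ρ) (a := a) (h := h) (d := d); omega)
  have b2 := measure_abs_iterSum_ge_le h0 h1 hd hsep (k := kHigh γ ρ a h d) hq
    (by rw [kHigh_eq]; omega)
  -- The deficit of 1 absorbs the rounding in σ, since only ρa² < (σ + 1)t_N is available for the
  -- upper departure time; q ≥ 2 leaves enough room.
  have hm : rootSigma γ ρ a h d ^ 3 / 2 ≤ gapSigma γ ρ a h d - 1 := by
    have := Nat.lt_floor_add_one (rootSigma γ ρ a h d ^ 3)
    have h8 : (2 : ℝ) ^ 3 ≤ rootSigma γ ρ a h d ^ 3 := by gcongr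
    rw [gapSigma]
    linarith
  have hk1 : (kLow γ ρ a h d : ℝ) = sigma γ ρ a h d - gapSigma γ ρ a h d := by
    rw [kLow_eq, Nat.cast_sub hmσ]
  have hk2 : (kHigh γ ρ a h d : ℝ) = sigma γ ρ a h d + gapSigma γ ρ a h d := by
    rw [kHigh_eq, Nat.cast_add]
  set t := meanExcursion γ h d
  set q := rootSigma γ ρ a h d
  have hmt : q ^ 3 / 2 * t ≤ (gapSigma γ ρ a h d - 1) * t := by gcongr
  have e : 4 * (29 + 600 * (L : ℝ)) / q = 2 * (29 + 600 * L) / q + 2 * (29 + 600 * L) / q := by ring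
  have hq0 : 0 < q := by linarith
  rw [e, ENNReal.ofReal_add (by positivity) (by positivity)]
  refine le_trans ?_ (add_le_add b1 b2)
  refine le_trans (measure_mono_ae ?_) (measure_union_le _ _)
  filter_upwards [ae_allFinite h0 h1 hd hsep 0] with ω hω hbad
  replace hbad := not_and_or.1 hbad
  rw [not_le, not_le] at hbad
  change ω ∈ (_ ∪ _ : Set _)
  rcases hbad with hb | hb
  · left
    obtain ⟨n, hn⟩ := ENat.ne_top_iff_exists.1 (hω.depTime (kLow γ ρ a h d)).1
    rw [Set.mem_ofPred_eq, hω.iterSum_excReal, ← hn, ENat.toNat_natCast]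
    rw [← hn, Nat.cast_lt] at hb
    apply ENNReal.ofReal_le_ofReal
    have h2 : ρ * (a : ℝ) ^ 2 < n := (Nat.floor_lt (by positivity)).1 hb
    refine le_trans ?_ (le_abs_self _)
    rw [hk1]
    linarith
  · right
    obtain ⟨n, hn⟩ := ENat.ne_top_iff_exists.1 (hω.depTime (kHigh γ ρ a h d)).1
    rw [Set.mem_ofPred_eq, hω.iterSum_excReal, ← hn, ENat.toNat_natCast]
    rw [← hn, Nat.cast_lt] at hb
    apply ENNReal.ofReal_le_ofReal
    have h2 : (n : ℝ) ≤ ρ * (a : ℝ) ^ 2 := by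
      have h3 : (n : ℝ) ≤ timeT ρ a := by exact_mod_cast hb.le
      exact h3.trans (Nat.floor_le (by positivity))
    refine le_trans ?_ (neg_le_abs _)
    rw [hk2]
    linarith

/-! ### Local times between `T` and the departure times -/

/-- Off the event D_{k_*} ≤ T ≤ D_{k^*} the minimum is at most 1. On it, the difference is at most
the local time collected in the 2m excursions after D_{k_*}, with m = [σ^{3/4}]. By the Markov
property its mean is O(h√m), and h√m ≤ h q²/√q = O(a/√q). -/
theorem lintegral_min_le (h0 : 0 < γ) (h1 : γ ≤ 1) (hρ : 0 < ρ) (hd : 20 * (d + 1) < h)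
    (ha : 0 < a) (hsep : Separated h zs) (hq : 2 ≤ rootSigma γ ρ a h d) {z : ℤ}
    (hz : z ∈ setC h d zs) :
    ∫⁻ ω, min (absDiff (localTime z (timeT ρ a : ℕ∞) ω)
        (localTime z (depTime h d zs (kLow γ ρ a h d) ω) ω) / (a : ℝ≥0∞)) 1 ∂(Q γ 0) ≤
      ENNReal.ofReal (4 * (29 + 600 * L) / rootSigma γ ρ a h d) +
        ENNReal.ofReal (48 / γ * √(ρ * γ) / √(rootSigma γ ρ a h d)) := by
  have hτ := goodTime_excTime h0 h1 hd hsep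
  obtain ⟨u, hu, hzu⟩ := mem_setC_iff.1 hz
  have hbad := measure_compl_good_le (L := L) (zs := zs) h0 h1 hρ hd hsep hq
  set G := {ω | depTime h d zs (kLow γ ρ a h d) ω ≤ (timeT ρ a : ℕ∞) ∧
        (timeT ρ a : ℕ∞) ≤ depTime h d zs (kHigh γ ρ a h d) ω}
  set m := gapSigma γ ρ a h d
  have hmσ := gapSigma_le_sigma hq
  have hkk : kHigh γ ρ a h d = kLow γ ρ a h d + 2 * m := by
    rw [kHigh_eq, kLow_eq]
    omega
  have ha' : (0 : ℝ) < a := by exact_mod_cast ha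
  have hFm := measurable_comp_iterate hτ.measurable
    (measurable_iterSum hτ.measurable (measurable_excLocal (h := h) (d := d) (zs := zs) z) (2 * m))
    (kLow γ ρ a h d)
  have hpt : ∀ᵐ ω ∂(Q γ 0), min (absDiff (localTime z (timeT ρ a : ℕ∞) ω)
      (localTime z (depTime h d zs (kLow γ ρ a h d) ω) ω) / (a : ℝ≥0∞)) 1 ≤
      Gᶜ.indicator (fun _ => 1) ω + iterSum (excTime h d zs) (excLocal h d zs z) (2 * m)
        ((shiftBy (excTime h d zs))^[kLow γ ρ a h d] ω) / (a : ℝ≥0∞) := by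
    filter_upwards [ae_allFinite h0 h1 hd hsep 0] with ω hω
    by_cases hωG : ω ∈ G
    · refine (min_le_left _ _).trans (le_add_left (ENNReal.div_le_div_right ?_ _))
      obtain ⟨g1, g2⟩ := hωG
      have m1 := localTime_mono z g1 ω
      have m2 := localTime_mono z g2 ω
      rw [absDiff, tsub_eq_zero_of_le m1, add_zero]
      refine tsub_le_iff_left.2 (m2.trans ?_)
      -- The sum over k^* = k_* + 2m excursions is cut at k_*; its tail is the sum of 2m terms for
      -- the path shifted by D_{k_*}.
      rw [hω.localTime_eq, hω.localTime_eq, hkk, iterSum, Finset.sum_range_add]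
      simp only [iterSum, ← Function.iterate_add_apply, add_comm]
      exact le_rfl
    · refine (min_le_right _ _).trans (le_add_right ?_)
      rw [Set.indicator_of_mem hωG]
  refine (lintegral_mono_ae hpt).trans ?_
  rw [lintegral_add_right _ (hFm.div_const _)]
  refine add_le_add ((lintegral_indicator_const_le _ _).trans (by rwa [one_mul])) ?_
  simp only [div_eq_mul_inv _ (a : ℝ≥0∞)]
  rw [lintegral_mul_const _ hFm, ← div_eq_mul_inv,
    lintegral_shiftBy_iterate h0.le h1 hτ (kLow γ ρ a h d) 0
      (measurable_iterSum hτ.measurable (measurable_excLocal z) (2 * m))]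
  have := isProbabilityMeasure_Q h0.le h1 0
  calc _ ≤ (∫⁻ _, ENNReal.ofReal (24 * (h / γ) * √(2 * m : ℕ)) ∂(Q γ 0)) / (a : ℝ≥0∞) := by
        refine ENNReal.div_le_div_right (lintegral_mono fun ω => ?_) _
        exact lintegral_iterSum_excLocal_le h0 h1 hd hsep hu hzu _ _
    _ = ENNReal.ofReal (24 * (h / γ) * √(2 * m : ℕ) / a) := by
        rw [lintegral_const, measure_univ, mul_one, ENNReal.ofReal_div_of_pos ha',
          ENNReal.ofReal_natCast]
    _ ≤ _ := by
        apply ENNReal.ofReal_le_ofReal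
        have c1 := mul_sqrt_sigma_le h0 h1 hρ hd a
        rw [← rootSigma_sq] at c1
        have c2 : (m : ℝ) ≤ rootSigma γ ρ a h d ^ 3 := gapSigma_le
        set q := rootSigma γ ρ a h d
        have hq0 : 0 < q := by linarith
        have hsq : 0 < √q := Real.sqrt_pos.2 hq0
        have hsq2 : √q ^ 2 = q := Real.sq_sqrt hq0.le
        have c3 : √((2 * m : ℕ) : ℝ) * √q ≤ 2 * q ^ 2 := by
          refine (sq_le_sq₀ (by positivity) (by positivity)).1 ?_
          rw [mul_pow, Real.sq_sqrt (by positivity), hsq2]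
          push_cast
          have : (m : ℝ) * q ≤ q ^ 3 * q := by gcongr
          nlinarith [pow_pos hq0 4]
        rw [div_le_div_iff₀ ha' hsq]
        calc 24 * (h / γ) * √((2 * m : ℕ) : ℝ) * √q = 24 / γ * h * (√((2 * m : ℕ) : ℝ) * √q) := by
              ring
          _ ≤ 24 / γ * h * (2 * q ^ 2) := by gcongr
          _ = 48 / γ * (h * q ^ 2) := by ring
          _ ≤ 48 / γ * (√(ρ * γ) * a) := by gcongr
          _ = _ := by ring

/-! ### Visits and local times up to the departure time -/

/-- No lower bound on σ enters, so the estimate covers every admissible N, as required by the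
supremum in the third claim. -/
theorem lintegral_visitCount_le (h0 : 0 < γ) (h1 : γ ≤ 1) (hρ : 0 < ρ) (hd : 20 * (d + 1) < h)
    (ha : 0 < a) (hsep : Separated h zs) {u : ℤ} (hu : u ∈ grid h zs) :
    (h : ℝ≥0∞) / (a : ℝ≥0∞) * ∫⁻ ω, visitCount h d zs (closedBlock d u) (kLow γ ρ a h d) ω
      ∂(Q γ 0) ≤ ENNReal.ofReal (12 * √(ρ * γ)) := by
  have ha' : (0 : ℝ) < a := by exact_mod_cast ha
  have e : ∫⁻ ω, visitCount h d zs (closedBlock d u) (kLow γ ρ a h d) ω ∂(Q γ 0) =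
      ∫⁻ ω, iterSum (excTime h d zs) (visit h d zs u) (kLow γ ρ a h d) ω ∂(Q γ 0) :=
    lintegral_congr_ae (by
      filter_upwards [ae_allFinite h0 h1 hd hsep 0] with ω hω
      exact hω.visitCount_eq u _)
  rw [e]
  refine (mul_le_mul_right (lintegral_iterSum_visit_le h0 h1 hd hsep hu _ 0) _).trans ?_
  rw [← ENNReal.ofReal_natCast h, ← ENNReal.ofReal_natCast a, ← ENNReal.ofReal_div_of_pos ha',
    ← ENNReal.ofReal_mul (by positivity)]
  apply ENNReal.ofReal_le_ofReal
  have c1 := mul_sqrt_sigma_le h0 h1 hρ hd a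
  have c2 : √(kLow γ ρ a h d : ℝ) ≤ √(sigma γ ρ a h d) :=
    Real.sqrt_le_sqrt (by exact_mod_cast kLow_le)
  calc (h : ℝ) / a * (12 * √(kLow γ ρ a h d)) ≤ h / a * (12 * √(sigma γ ρ a h d)) := by gcongr
    _ = 12 * (h * √(sigma γ ρ a h d)) / a := by ring
    _ ≤ 12 * (√(ρ * γ) * a) / a := by gcongr
    _ = _ := by field_simp

/-- Both error terms are compared with hq² = O(a), where q⁴ = σ: the fluctuation hq is smaller by a
factor q, the bias dq² by a factor h/d. -/
theorem lintegral_absDiff_le (h0 : 0 < γ) (h1 : γ ≤ 1) (hρ : 0 < ρ) (hd : 20 * (d + 1) < h)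
    (ha : 0 < a) (hsep : Separated h zs) (hq : 2 ≤ rootSigma γ ρ a h d) {u z : ℤ}
    (hu : u ∈ grid h zs) (hz : z ∈ closedBlock d u) :
    (∫⁻ ω, absDiff (localTime z (depTime h d zs (kLow γ ρ a h d) ω) ω)
        (ENNReal.ofReal ((h : ℝ) / γ) * visitCount h d zs (closedBlock d u) (kLow γ ρ a h d) ω)
        ∂(Q γ 0)) / (a : ℝ≥0∞) ≤
      ENNReal.ofReal (6 / γ * √(ρ * γ) / rootSigma γ ρ a h d +
        36 / γ * √(ρ * γ) * ((d : ℝ) / h)) := by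
  have ha' : (0 : ℝ) < a := by exact_mod_cast ha
  have hh : (0 : ℝ) < h := by
    have : 0 < h := by omega
    exact_mod_cast this
  have e : ∫⁻ ω, absDiff (localTime z (depTime h d zs (kLow γ ρ a h d) ω) ω)
      (ENNReal.ofReal ((h : ℝ) / γ) * visitCount h d zs (closedBlock d u) (kLow γ ρ a h d) ω)
      ∂(Q γ 0) = ∫⁻ ω, ENNReal.ofReal |iterSum (excTime h d zs) (excDiff γ h d zs u z)
        (kLow γ ρ a h d) ω| ∂(Q γ 0) :=
    lintegral_congr_ae (by
      filter_upwards [ae_allFinite h0 h1 hd hsep 0] with ω hω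
      exact hω.absDiff_eq h0 u z _)
  rw [e]
  refine (ENNReal.div_le_div_right (lintegral_abs_iterSum_excDiff_le h0 h1 hd hsep hu hz _ 0)
    _).trans ?_
  rw [← ENNReal.ofReal_natCast a, ← ENNReal.ofReal_div_of_pos ha']
  apply ENNReal.ofReal_le_ofReal
  have c1 := mul_sqrt_sigma_le h0 h1 hρ hd a
  have c2 : √(kLow γ ρ a h d : ℝ) ≤ √(sigma γ ρ a h d) :=
    Real.sqrt_le_sqrt (by exact_mod_cast kLow_le)
  have c3 : √(√(kLow γ ρ a h d : ℝ)) ≤ rootSigma γ ρ a h d := Real.sqrt_le_sqrt c2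
  rw [← rootSigma_sq] at c1 c2
  set q := rootSigma γ ρ a h d
  have hq0 : 0 < q := by linarith
  rw [add_div]
  refine add_le_add ?_ ?_
  · rw [div_le_div_iff₀ ha' hq0]
    calc 6 * (h / γ) * √(√(kLow γ ρ a h d : ℝ)) * q ≤ 6 * (h / γ) * q * q := by gcongr
      _ = 6 / γ * (h * q ^ 2) := by ring
      _ ≤ 6 / γ * (√(ρ * γ) * a) := by gcongr
      _ = _ := by ring
  · rw [div_le_iff₀ ha']
    calc 36 * (d / γ) * √(kLow γ ρ a h d : ℝ) ≤ 36 * (d / γ) * q ^ 2 := by gcongr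
      _ = 36 / γ * (d / h) * (h * q ^ 2) := by field_simp
      _ ≤ 36 / γ * (d / h) * (√(ρ * γ) * a) := by gcongr
      _ = _ := by ring

/-! ### Asymptotics -/

theorem eventually_admissible {a h d : ℕ → ℕ} {zs : ℕ → Fin L → ℤ}
    (ha : Tendsto a atTop atTop) (hh : Tendsto h atTop atTop)
    (hdh : (fun N => (d N : ℝ)) =o[atTop] (fun N => (h N : ℝ)))
    (hha : (fun N => (h N : ℝ)) =o[atTop] (fun N => (a N : ℝ)))
    (hsep : ∀ᶠ N in atTop, Separated (h N) (zs N)) :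
    ∀ᶠ N in atTop, Admissible (a N) (h N) (d N) (zs N) := by
  -- With d ≤ h/40 and h > 40, each of 20d and 20 is at most h/2, the second strictly less.
  filter_upwards [ha.eventually_gt_atTop 0, hh.eventually_gt_atTop 40,
    hdh.def (c := 1 / 40) (by norm_num), hha.def (c := 1 / 200) (by norm_num), hsep]
    with N h1 h2 h3 h4 h5
  simp only [Real.norm_natCast] at h3 h4
  refine ⟨?_, ?_, h5⟩
  · have r2 : (40 : ℝ) < h N := by exact_mod_cast h2
    have : 20 * ((d N : ℝ) + 1) < h N := by linarith
    exact_mod_cast this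
  · have r1 : (0 : ℝ) < a N := by exact_mod_cast h1
    have : 100 * (h N : ℝ) < a N := by linarith
    exact_mod_cast this

theorem tendsto_sigma (h0 : 0 < γ) (h1 : γ ≤ 1) (hρ : 0 < ρ) {a h d : ℕ → ℕ}
    {zs : ℕ → Fin L → ℤ} (hadm : ∀ᶠ N in atTop, Admissible (a N) (h N) (d N) (zs N))
    (hha : (fun N => (h N : ℝ)) =o[atTop] (fun N => (a N : ℝ))) :
    Tendsto (fun N => sigma γ ρ (a N) (h N) (d N)) atTop atTop := by
  rw [tendsto_atTop]
  intro B
  -- This ε makes (B + 1) · 2ε²a²/γ equal to ρa²; together with t_N ≤ 2h²/γ and h ≤ εa it forces σ ≥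
  -- B. Using B + 1 keeps the denominator positive when B = 0.
  set ε : ℝ := √(ρ * γ / (2 * (B + 1)))
  have hε0 : 0 < ε := Real.sqrt_pos.2 (by positivity)
  have hε2 : ε ^ 2 = ρ * γ / (2 * (B + 1)) := Real.sq_sqrt (by positivity)
  filter_upwards [hadm, hha.def hε0] with N hN hN2
  obtain ⟨hd, -, -⟩ := hN
  simp only [Real.norm_natCast] at hN2
  have ht := meanExcursion_pos h0 h1 hd
  have hle := meanExcursion_le h0 h1 hd
  refine Nat.le_floor ?_
  rw [← mul_div_assoc, le_div_iff₀ ht]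
  have hB : (0 : ℝ) ≤ B := Nat.cast_nonneg B
  have s1 : (h N : ℝ) ^ 2 ≤ ε ^ 2 * (a N : ℝ) ^ 2 := by
    rw [← mul_pow]
    gcongr
  calc (B : ℝ) * meanExcursion γ (h N) (d N) ≤ (B + 1) * (2 * ((h N : ℝ) ^ 2 / γ)) :=
        mul_le_mul (by linarith) hle ht.le (by positivity)
    _ ≤ (B + 1) * (2 * (ε ^ 2 * (a N : ℝ) ^ 2 / γ)) := by gcongr
    _ = ρ * (a N : ℝ) ^ 2 := by
        rw [hε2]
        field_simp

theorem tendsto_rootSigma {a h d : ℕ → ℕ}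
    (hσ : Tendsto (fun N => sigma γ ρ (a N) (h N) (d N)) atTop atTop) :
    Tendsto (fun N => rootSigma γ ρ (a N) (h N) (d N)) atTop atTop :=
  Real.tendsto_sqrt_atTop.comp (Real.tendsto_sqrt_atTop.comp
    (tendsto_natCast_atTop_atTop.comp hσ))

end

end GridWalk

end

/-! ### Assembly of the four limits. -/

theorem proposition2p1
    (γ : ℝ) (hγ0 : 0 < γ) (hγ1 : γ ≤ 1) (ρ : ℝ) (hρ : 0 < ρ)
    (a h d : ℕ → ℕ)
    (ha : Tendsto a atTop atTop) (hh : Tendsto h atTop atTop)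
    (hdh : (fun N => (d N : ℝ)) =o[atTop] (fun N => (h N : ℝ)))
    (hha : (fun N => (h N : ℝ)) =o[atTop] (fun N => (a N : ℝ)))
    (L : ℕ) (hL : 1 ≤ L) (zs : ℕ → Fin L → ℤ)
    (hsep : ∀ᶠ N in atTop, GridWalk.Separated (h N) (zs N)) :
    Tendsto
      (fun N => GridWalk.Q γ 0
        {ω | GridWalk.depTime (h N) (d N) (zs N) (GridWalk.kLow γ ρ (a N) (h N) (d N)) ω
              ≤ (GridWalk.timeT ρ (a N) : ℕ∞) ∧
            (GridWalk.timeT ρ (a N) : ℕ∞)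
              ≤ GridWalk.depTime (h N) (d N) (zs N) (GridWalk.kHigh γ ρ (a N) (h N) (d N)) ω})
      atTop (𝓝 1) ∧
    Tendsto
      (fun N => ⨆ z ∈ GridWalk.setC (h N) (d N) (zs N),
        ∫⁻ ω, min
          (GridWalk.absDiff
            (GridWalk.localTime z (GridWalk.timeT ρ (a N) : ℕ∞) ω)
            (GridWalk.localTime z
              (GridWalk.depTime (h N) (d N) (zs N) (GridWalk.kLow γ ρ (a N) (h N) (d N)) ω) ω)
            / (a N : ℝ≥0∞)) 1 ∂(GridWalk.Q γ 0))
      atTop (𝓝 0) ∧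
    (⨆ (N : ℕ) (_ : 1 ≤ N ∧ GridWalk.Admissible (a N) (h N) (d N) (zs N)),
      ⨆ u ∈ GridWalk.grid (h N) (zs N),
        (h N : ℝ≥0∞) / (a N : ℝ≥0∞) *
          ∫⁻ ω, GridWalk.visitCount (h N) (d N) (zs N) (GridWalk.closedBlock (d N) u)
            (GridWalk.kLow γ ρ (a N) (h N) (d N)) ω ∂(GridWalk.Q γ 0)) < ∞ ∧
    Tendsto
      (fun N => ⨆ u ∈ GridWalk.grid (h N) (zs N), ⨆ z ∈ GridWalk.closedBlock (d N) u,
        (∫⁻ ω, GridWalk.absDiff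
          (GridWalk.localTime z
            (GridWalk.depTime (h N) (d N) (zs N) (GridWalk.kLow γ ρ (a N) (h N) (d N)) ω) ω)
          (ENNReal.ofReal ((h N : ℝ) / γ) *
            GridWalk.visitCount (h N) (d N) (zs N) (GridWalk.closedBlock (d N) u)
              (GridWalk.kLow γ ρ (a N) (h N) (d N)) ω) ∂(GridWalk.Q γ 0)) / (a N : ℝ≥0∞))
      atTop (𝓝 0) := by
  have hadm := GridWalk.eventually_admissible ha hh hdh hha hsep
  have hq := GridWalk.tendsto_rootSigma (GridWalk.tendsto_sigma hγ0 hγ1 hρ hadm hha)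
  have hev := hadm.and (hq.eventually_ge_atTop 2)
  have hq0 (c : ℝ) : Tendsto
      (fun N => ENNReal.ofReal (c / GridWalk.rootSigma γ ρ (a N) (h N) (d N))) atTop (𝓝 0) := by
    simpa using ENNReal.tendsto_ofReal (hq.const_div_atTop c)
  have hprob := GridWalk.isProbabilityMeasure_Q hγ0.le hγ1 0
  refine ⟨?_, ?_, ?_, ?_⟩
  · have hlim := ENNReal.Tendsto.sub (tendsto_const_nhds (x := (1 : ℝ≥0∞)))
      (hq0 (4 * (29 + 600 * L))) (Or.inl ENNReal.one_ne_top)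
    rw [tsub_zero] at hlim
    refine tendsto_of_tendsto_of_tendsto_of_le_of_le' hlim tendsto_const_nhds ?_
      (Eventually.of_forall fun N => prob_le_one)
    filter_upwards [hev] with N hN
    -- The lower bound on the probability comes from subadditivity with the complement, so the event
    -- need not be shown measurable.
    refine tsub_le_iff_right.2 ?_
    rw [← measure_univ (μ := GridWalk.Q γ 0)]
    exact (measure_univ_le_add_compl _).trans (add_le_add_right
      (GridWalk.measure_compl_good_le hγ0 hγ1 hρ hN.1.1 hN.1.2.2 hN.2) _)
  · have hlim := (hq0 (4 * (29 + 600 * L))).add (ENNReal.tendsto_ofReal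
      ((Real.tendsto_sqrt_atTop.comp hq).const_div_atTop (48 / γ * √(ρ * γ))))
    rw [ENNReal.ofReal_zero, add_zero] at hlim
    refine tendsto_of_tendsto_of_tendsto_of_le_of_le' tendsto_const_nhds hlim
      (Eventually.of_forall fun N => zero_le) ?_
    filter_upwards [hev] with N hN
    exact iSup₂_le fun z hz => GridWalk.lintegral_min_le hγ0 hγ1 hρ hN.1.1
      (pos_of_gt hN.1.2.1) hN.1.2.2 hN.2 hz
  · refine lt_of_le_of_lt (iSup₂_le fun N hN => iSup₂_le fun u hu => ?_)
      (ENNReal.ofReal_lt_top (r := 12 * √(ρ * γ)))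
    exact GridWalk.lintegral_visitCount_le hγ0 hγ1 hρ hN.2.1 (pos_of_gt hN.2.2.1) hN.2.2.2 hu
  -- The fluctuation vanishes because σ → ∞, the bias because d/h → 0.
  · have hlim := ENNReal.tendsto_ofReal ((hq.const_div_atTop (6 / γ * √(ρ * γ))).add
      (hdh.tendsto_div_nhds_zero.const_mul (36 / γ * √(ρ * γ))))
    rw [mul_zero, add_zero, ENNReal.ofReal_zero] at hlim
    refine tendsto_of_tendsto_of_tendsto_of_le_of_le' tendsto_const_nhds hlim
      (Eventually.of_forall fun N => zero_le) ?_
    filter_upwards [hev] with N hN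
    exact iSup₂_le fun u hu => iSup₂_le fun z hz => GridWalk.lintegral_absDiff_le hγ0 hγ1 hρ
      hN.1.1 (pos_of_gt hN.1.2.1) hN.1.2.2 hN.2 hu hz
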